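/- Let $L>0$, let $\mathbb{T}^2=(\mathbb{R}/L\mathbb{Z})^2$ and fix $\alpha>0$. Write $\nabla^\perp=(-\partial_y,\partial_x)$, let $\|v\|_{s,2}=\big(\sum_{\xi\in\mathbb{Z}^2}(1+|\xi|^2)^s|\widehat v(\xi)|^2\big)^{1/2}$ be the norm of $W^{s,2}(\mathbb{T}^2)$, where $\widehat v(\xi)=L^{-2}\int_{\mathbb{T}^2}v(x)e^{-2\pi i\xi\cdot x/L}\,dx$, and put $\|(b,\omega)\|_{\mathcal M}=\|b\|_{3,2}+\|\omega\|_{2,2}$. Let $\mathbf{u}_h\in W^{3,2}(\mathbb{T}^2;\mathbb{R}^2)$ be weakly divergence-free, let $f\in W^{2,2}(\mathbb{T}^2)$, $b_0\in W^{3,2}(\mathbb{T}^2)$ and $\omega_0\in W^{2,2}(\mathbb{T}^2)$. The $\alpha$-TQG system with these data is $$\partial_t b^\alpha+\mathbf{u}^\alpha\cdot\nabla b^\alpha=0,\qquad \partial_t\omega^\alpha+\mathbf{u}^\alpha\cdot\nabla(\omega^\alpha-b^\alpha)=-\mathbf{u}_h\cdot\nabla b^\alpha,$$ $$\mathbf{u}^\alpha=\nabla^\perp\psi^\alpha,\qquad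 \omega^\alpha=(\Delta-1)(1-\alpha\Delta)\psi^\alpha+f .$$ For $0<T<\infty$, a triple $(b^\alpha,\omega^\alpha,T)$ is a local strong solution if $b^\alpha\in C([0,T];W^{3,2}(\mathbb{T}^2))$, $\omega^\alpha\in C([0,T];W^{2,2}(\mathbb{T}^2))$ and, for all $t\in[0,T]$, $$b^\alpha(t)=b_0-\int_0^t\mathrm{div}(b^\alpha\mathbf{u}^\alpha)\,d\tau,\qquad \omega^\alpha(t)=\omega_0-\int_0^t\big[\mathrm{div}((\omega^\alpha-b^\alpha)\mathbf{u}^\alpha)+\mathrm{div}(b^\alpha\mathbf{u}_h)\big]\,d\tau .$$ A triple $(b^\alpha,\omega^\alpha,T^\alpha_{\max})$ with $T^\alpha_{\max}\in(0,\infty]$ is a maximal solution if there is an increasing sequence $(T_n)$ with $T_n\to T^\alpha_{\max}$ such that $(b^\alpha,\omega^\alpha,T_n)$ is a local strong solution for every $n$ and, if $T^\alpha_{\max}<\infty$, $\limsup_{n\to\infty}\|(b^\alpha,\omega^\alpha)(T_n)\|_{\mathcal M}^2=\infty$. **Theorem.** Let $(b^\alpha,\omega^\alpha,T^\alpha_{\max})$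 be a maximal solution of the $\alpha$-TQG system. If $T^\alpha_{\max}<\infty$, then $$\int_0^{T^\alpha_{\max}}\|\nabla b^\alpha(t)\|_{L^\infty(\mathbb{T}^2)}\,dt=\infty .$$ -/

import Mathlib

open MeasureTheory Set Filter Topology
open scoped ENNReal

noncomputable section

namespace TQG

/-- The flat torus `(ℝ / Lℤ)²`. -/
abbrev Torus (L : ℝ) : Type := Fin 2 → AddCircle L

variable {L : ℝ} [Fact (0 < L)]

/-- Real square-integrable functions on the torus (for Lebesgue measure, of total mass `L²`). -/
abbrev L2 (L : ℝ) [Fact (0 < L)] : Type := Lp ℝ 2 (volume : Measure (Torus L))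

/-- The Fourier coefficient `L⁻² ∫ v(x) exp (-2πi ξ·x / L) dx`. -/
def fourierCoeff₂ (v : Torus L → ℝ) (ξ : Fin 2 → ℤ) : ℂ :=
  ((L ^ 2 : ℝ) : ℂ)⁻¹ *
    ∫ x : Torus L, fourier (-ξ 0) (x 0) * fourier (-ξ 1) (x 1) * (v x : ℂ)

/-- The norm `‖v‖_{s,2} = (∑_ξ (1 + |ξ|²)^s |v̂(ξ)|²)^{1/2}` as an extended number; a
square-integrable `v` belongs to `W^{s,2}` exactly when it is finite. -/
def sobolevNorm (s : ℕ) (v : Torus L → ℝ) : ℝ≥0∞ :=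
  (∑' ξ : Fin 2 → ℤ,
    ENNReal.ofReal ((1 + ((ξ 0 : ℝ) ^ 2 + (ξ 1 : ℝ) ^ 2)) ^ s) * ‖fourierCoeff₂ v ξ‖ₑ ^ 2)
      ^ (1 / 2 : ℝ)

/-- Smooth functions on the torus: those whose periodic lift to the plane is smooth. -/
def IsSmooth (φ : Torus L → ℝ) : Prop :=
  ContDiff ℝ ((⊤ : ℕ∞) : WithTop ℕ∞) (fun y : Fin 2 → ℝ => φ (fun i => (y i : AddCircle L)))

/-- The classical partial derivative `∂_j φ` on the torus. -/
def partialDeriv (j : Fin 2) (φ : Torus L → ℝ) (x : Torus L) : ℝ :=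
  deriv (fun s : ℝ => φ (x + Pi.single j (s : AddCircle L))) 0

/-- The classical Laplacian on the torus. -/
def laplacian (φ : Torus L → ℝ) (x : Torus L) : ℝ :=
  ∑ j : Fin 2, partialDeriv j (partialDeriv j φ) x

/-- `w` is the weak partial derivative `∂_j v`. -/
def IsWeakDeriv (j : Fin 2) (v w : Torus L → ℝ) : Prop :=
  Integrable v volume ∧ Integrable w volume ∧
    ∀ φ : Torus L → ℝ, IsSmooth φ → ∫ x, v x * partialDeriv j φ x = -∫ x, w x * φ x

/-- `w` is the weak divergence of the vector field `V`. -/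
def IsWeakDiv (V : Fin 2 → Torus L → ℝ) (w : Torus L → ℝ) : Prop :=
  (∀ j, Integrable (V j) volume) ∧ Integrable w volume ∧
    ∀ φ : Torus L → ℝ, IsSmooth φ →
      ∫ x, ∑ j : Fin 2, V j x * partialDeriv j φ x = -∫ x, w x * φ x

open Classical in
/-- The weak partial derivative `∂_j v` as a function (it is unique almost everywhere). -/
def weakDeriv (j : Fin 2) (v : Torus L → ℝ) : Torus L → ℝ :=
  if h : ∃ w, IsWeakDeriv j v w then h.choose else 0

/-- `‖∇v‖_∞`: the essential supremum of the Euclidean length of the weak gradient of `v`. -/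
def gradSupNorm (v : Torus L → ℝ) : ℝ≥0∞ :=
  eLpNorm (fun x => (!₂[weakDeriv 0 v x, weakDeriv 1 v x] : EuclideanSpace ℝ (Fin 2))) ⊤ volume

/-- `w = (Δ - 1)(1 - αΔ) ψ` in the sense of distributions (the operator is its own formal
adjoint). -/
def IsStreamFunction (α : ℝ) (w ψ : Torus L → ℝ) : Prop :=
  ∀ φ : Torus L → ℝ, IsSmooth φ →
    ∫ x, ψ x * (laplacian (fun y => φ y - α * laplacian φ y) x - (φ x - α * laplacian φ x))
      = ∫ x, w x * φ x

/-- `u = ∇^⊥ ψ = (-∂_y ψ, ∂_x ψ)` where `w = (Δ - 1)(1 - αΔ) ψ`. -/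
def IsVelocity (α : ℝ) (w : L2 L) (u : Fin 2 → L2 L) : Prop :=
  ∃ ψ : L2 L, IsStreamFunction α w ψ ∧
    IsWeakDeriv 1 ψ (fun x => -u 0 x) ∧ IsWeakDeriv 0 ψ (u 1)

/-- `v ∈ C([0,T]; W^{s,2})`. -/
def ContinuousInSobolev (s : ℕ) (T : ℝ) (v : ℝ → L2 L) : Prop :=
  ∀ t ∈ Icc 0 T, sobolevNorm s (v t) < ⊤ ∧
    Tendsto (fun τ => sobolevNorm s (v τ - v t : L2 L)) (𝓝[Icc 0 T] t) (𝓝 0)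

/-- The triple `(b, ω, T)` is a local strong solution of the `α`-TQG system with data
`u_h`, `f` and initial condition `(b₀, ω₀)`. The time integrals are Bochner integrals in `L²`
of `B = div (b u)`, `W = div ((ω - b) u)` and `Z = div (b u_h)`. -/
structure IsLocalSolution (α : ℝ) (uh : Fin 2 → L2 L) (f b₀ ω₀ : L2 L)
    (b ω : ℝ → L2 L) (T : ℝ) : Prop where
  time_pos : 0 < T
  continuous_b : ContinuousInSobolev 3 T b
  continuous_ω : ContinuousInSobolev 2 T ω
  equations : ∃ (u : ℝ → Fin 2 → L2 L) (B W Z : ℝ → L2 L),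
    (∀ t ∈ Icc 0 T, IsVelocity α (ω t - f) (u t)) ∧
    (∀ t ∈ Icc 0 T, IsWeakDiv (fun j x => b t x * u t j x) (B t)) ∧
    (∀ t ∈ Icc 0 T, IsWeakDiv (fun j x => (ω t x - b t x) * u t j x) (W t)) ∧
    (∀ t ∈ Icc 0 T, IsWeakDiv (fun j x => b t x * uh j x) (Z t)) ∧
    IntervalIntegrable B volume 0 T ∧ IntervalIntegrable W volume 0 T ∧
    IntervalIntegrable Z volume 0 T ∧
    (∀ t ∈ Icc 0 T, b t = b₀ - ∫ τ in (0 : ℝ)..t, B τ) ∧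
    (∀ t ∈ Icc 0 T, ω t = ω₀ - ∫ τ in (0 : ℝ)..t, (W τ + Z τ))

/-- The triple `(b, ω, Tmax)`, with `Tmax ∈ (0, ∞]`, is a maximal solution of the `α`-TQG
system with data `u_h`, `f` and initial condition `(b₀, ω₀)`. -/
def IsMaximalSolution (α : ℝ) (uh : Fin 2 → L2 L) (f b₀ ω₀ : L2 L)
    (b ω : ℝ → L2 L) (Tmax : EReal) : Prop :=
  0 < Tmax ∧ ∃ T : ℕ → ℝ, Monotone T ∧ Tendsto (fun n => (T n : EReal)) atTop (𝓝 Tmax) ∧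
    (∀ n, IsLocalSolution α uh f b₀ ω₀ b ω (T n)) ∧
    (Tmax < ⊤ →
      limsup (fun n => (sobolevNorm 3 (b (T n)) + sobolevNorm 2 (ω (T n))) ^ 2) atTop = ⊤)

end TQG

end

set_option linter.unusedSectionVars false

/-! For fixed `α > 0`, inverting `(Δ - 1)(1 - αΔ)` gains four derivatives, so an `L²` bound on `ω`
already bounds `u` in `W^{3,2}`. Everything therefore reduces to an `L²` bound on `ω`, and this is
the only place where `∇b` is needed.

Since `u` and `u_h` are divergence-free, the vorticity equation reads `∂ₜω + u·∇ω = (u - u_h)·∇b`.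
The transport term does no work in `L²`, and `‖u - u_h‖₂ ≤ C(1 + ‖ω‖₂)`. Hence `1 + ‖ω‖₂²` grows at
a rate bounded by a multiple of `‖∇b‖_∞`, and Grönwall gives the bound as soon as `∫‖∇b‖_∞` is
finite (`exists_ellTwo_source_le`, `ellTwo_gronwall`, `exists_sobolevNorm_zero_vorticity_le`). Next,
`b` is transported without source by a field bounded in `W^{3,2}`, so `‖b‖_{3,2}` grows at most
exponentially (`exists_sobolevNorm_buoyancy_le`). Finally the source `div (b (u - u_h))` is bounded
in `W^{2,2}`, and so is `ω` (`exists_sobolevNorm_vorticity_le`). These bounds are uniform along the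
times `T n`, which contradicts the infinite limsup.

The estimates are made on Fourier coefficients. With `p` the coefficients of the stream function,
`div (v u)` has coefficients `∑ κ (ξ × η) p(ξ - η) v(η)`, where `κ = -(2π/L)²`. The cross product is
antisymmetric and `p` is Hermitian, so an energy with weight `M` only sees the commutator `M(ξ) -
M(η)` (`enorm_transport_energy_le`). The solution is too rough to differentiate its full Sobolev
energy. The weight `⟨ξ⟩^{2s}` is therefore multiplied by a piecewise linear cutoff at scale `N`,
which leaves finitely many modes. The commutator bounds are uniform in `N` for orders two and three
(`tsum_commutator_le`) and of size `1/N` at order zero (`tsum_commutator_zero_le`); then `N → ∞`. -/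

noncomputable section

namespace TQG

variable {L : ℝ} [Fact (0 < L)]

/-! ### Characters and real trigonometric test functions -/

/-- The character `x ↦ exp (2πi ξ·x / L)` of the torus. -/
def character (ξ : Fin 2 → ℤ) : C(Torus L, ℂ) :=
  ⟨fun x => fourier (ξ 0) (x 0) * fourier (ξ 1) (x 1), by fun_prop⟩

lemma character_apply (ξ : Fin 2 → ℤ) (x : Torus L) :
    character ξ x = fourier (ξ 0) (x 0) * fourier (ξ 1) (x 1) := rfl

lemma character_zero (x : Torus L) : character 0 x = 1 := by
  simp [character_apply]

lemma character_add (ξ η : Fin 2 → ℤ) (x : Torus L) :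
    character (ξ + η) x = character ξ x * character η x := by
  simp only [character_apply, Pi.add_apply, fourier_add]; ring

lemma character_neg (ξ : Fin 2 → ℤ) (x : Torus L) :
    character (-ξ) x = (starRingEnd ℂ) (character ξ x) := by
  simp only [character_apply, Pi.neg_apply, fourier_neg, map_mul]

lemma norm_character (ξ : Fin 2 → ℤ) (x : Torus L) : ‖character ξ x‖ = 1 := by
  rw [character_apply, norm_mul, fourier_apply, fourier_apply, Circle.norm_coe, Circle.norm_coe,
    mul_one]

lemma character_add_apply (ξ : Fin 2 → ℤ) (x y : Torus L) :
    character ξ (x + y) = character ξ x * character ξ y := by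
  simp only [character_apply, Pi.add_apply, fourier_apply, smul_add, AddCircle.toCircle_add,
    Circle.coe_mul]
  ring

/-- The frequency factor `2πi k / L`. -/
def freq (L : ℝ) (k : ℤ) : ℂ := 2 * Real.pi * Complex.I * k / L

lemma freq_eq (k : ℤ) : freq L k = ((2 * Real.pi * k / L : ℝ) : ℂ) * Complex.I := by
  simp only [freq]; push_cast; ring

lemma norm_freq (k : ℤ) : ‖freq L k‖ = 2 * Real.pi / L * |(k : ℝ)| := by
  have hL : 0 < L := Fact.out
  rw [freq_eq]
  simp [abs_of_pos hL, abs_of_pos Real.pi_pos]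
  ring

lemma freq_neg (k : ℤ) : freq L (-k) = - freq L k := by
  simp [freq]; ring

lemma conj_freq (k : ℤ) : (starRingEnd ℂ) (freq L k) = - freq L k := by
  rw [freq_eq, map_mul, Complex.conj_ofReal, Complex.conj_I]; ring

lemma character_single (ξ : Fin 2 → ℤ) (j : Fin 2) (s : ℝ) :
    character ξ (Pi.single j (s : AddCircle L)) = Complex.exp (freq L (ξ j) * s) := by
  have h0 : ∀ k : ℤ, fourier k (0 : AddCircle L) = 1 := fun k => fourier_eval_zero k
  have h : ∀ k : ℤ, fourier k (s : AddCircle L) = Complex.exp (freq L k * s) := by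
    intro k
    rw [fourier_coe_apply, freq]; congr 1; ring
  fin_cases j <;> simp [character_apply, h0, h]

lemma character_coe (ξ : Fin 2 → ℤ) (y : Fin 2 → ℝ) :
    character ξ (fun i => (y i : AddCircle L)) =
      Complex.exp (freq L (ξ 0) * y 0 + freq L (ξ 1) * y 1) := by
  rw [character_apply, fourier_coe_apply, fourier_coe_apply, ← Complex.exp_add]
  congr 1; simp only [freq]; ring

/-- The real trigonometric monomial `Re (c exp (2πi ξ·x / L))`. -/
def wave (c : ℂ) (ξ : Fin 2 → ℤ) (x : Torus L) : ℝ := (c * character ξ x).re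

lemma continuous_wave (c : ℂ) (ξ : Fin 2 → ℤ) : Continuous (wave (L := L) c ξ) := by
  unfold wave; fun_prop

lemma isSmooth_wave (c : ℂ) (ξ : Fin 2 → ℤ) : IsSmooth (wave (L := L) c ξ) := by
  unfold IsSmooth wave
  simp only [character_coe]
  have h : ∀ i : Fin 2, ContDiff ℝ ((⊤ : ℕ∞) : WithTop ℕ∞) (fun y : Fin 2 → ℝ => ((y i : ℝ) : ℂ)) :=
    fun i => Complex.ofRealCLM.contDiff.comp (contDiff_apply ℝ ℝ i)
  exact Complex.reCLM.contDiff.comp (contDiff_const.mul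
    (((contDiff_const.mul (h 0)).add (contDiff_const.mul (h 1))).cexp))

lemma partialDeriv_wave (j : Fin 2) (c : ℂ) (ξ : Fin 2 → ℤ) :
    partialDeriv j (wave (L := L) c ξ) = wave (c * freq L (ξ j)) ξ := by
  funext x
  have h1 : HasDerivAt (fun s : ℝ => c * (character ξ x * Complex.exp (freq L (ξ j) * s)))
      (c * (character ξ x * (Complex.exp (freq L (ξ j) * (0 : ℝ)) * freq L (ξ j)))) 0 := by
    have h2 : HasDerivAt (fun s : ℝ => freq L (ξ j) * (s : ℂ)) (freq L (ξ j)) 0 := by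
      simpa using (Complex.ofRealCLM.hasDerivAt (x := (0 : ℝ))).const_mul (freq L (ξ j))
    exact ((h2.cexp).const_mul _).const_mul _
  have h3 := (Complex.reCLM.hasFDerivAt.comp_hasDerivAt (0 : ℝ) h1).deriv
  simp only [partialDeriv, wave, character_add_apply, character_single]
  refine Eq.trans h3 ?_
  simp; ring_nf

lemma wave_re_mul (a : ℝ) (c : ℂ) (ξ : Fin 2 → ℤ) (x : Torus L) :
    wave (a * c) ξ x = a * wave c ξ x := by
  simp only [wave, mul_assoc, Complex.re_ofReal_mul]

/-- The symbol `(2π/L)² |ξ|²` of `-Δ`. -/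
def lapSymbol (L : ℝ) (ξ : Fin 2 → ℤ) : ℝ :=
  (2 * Real.pi / L) ^ 2 * ((ξ 0 : ℝ) ^ 2 + (ξ 1 : ℝ) ^ 2)

lemma laplacian_wave (c : ℂ) (ξ : Fin 2 → ℤ) (x : Torus L) :
    laplacian (wave c ξ) x = - lapSymbol L ξ * wave c ξ x := by
  have h : ∀ k : ℤ, freq L k * freq L k = ((-((2 * Real.pi / L) ^ 2 * (k : ℝ) ^ 2) : ℝ) : ℂ) := by
    intro k
    rw [freq_eq]
    have := Complex.I_mul_I
    push_cast
    linear_combination ((2 * Real.pi * k / L : ℂ) ^ 2) * this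
  simp only [laplacian, partialDeriv_wave, Fin.sum_univ_two, mul_assoc, h]
  rw [mul_comm c, mul_comm c, wave_re_mul, wave_re_mul, lapSymbol]
  ring

/-! ### Smooth functions on the torus and integration by parts -/

/-- The covering map of the torus by the plane. -/
def coverMap (L : ℝ) (y : Fin 2 → ℝ) : Torus L := fun i => (y i : AddCircle L)

/-- Openness is what lets the quotient property pass to the product of the two circles. It allows
continuity to be checked on the periodic lift. -/
lemma isOpenQuotientMap_coverMap : IsOpenQuotientMap (coverMap L) := by
  have := IsOpenQuotientMap.piMap (ι := Fin 2) (f := fun _ => ((↑) : ℝ → AddCircle L))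
    (fun _ => QuotientAddGroup.isOpenQuotientMap_mk)
  exact this

lemma continuous_of_coverMap {φ : Torus L → ℝ} (h : Continuous fun y => φ (coverMap L y)) :
    Continuous φ :=
  isOpenQuotientMap_coverMap.isQuotientMap.continuous_iff.2 h

lemma IsSmooth.continuous {φ : Torus L → ℝ} (h : IsSmooth φ) : Continuous φ :=
  continuous_of_coverMap (ContDiff.continuous h)

lemma coverMap_add_single (y : Fin 2 → ℝ) (j : Fin 2) (s : ℝ) :
    coverMap L (y + s • Pi.single j 1) = coverMap L y + Pi.single j (s : AddCircle L) := by
  funext i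
  by_cases h : i = j
  · subst h; simp [coverMap]
  · simp [coverMap, h]

lemma IsSmooth.hasDerivAt_coverMap {φ : Torus L → ℝ} (h : IsSmooth φ) (j : Fin 2) (y : Fin 2 → ℝ)
    (s : ℝ) :
    HasDerivAt (fun s : ℝ => φ (coverMap L y + Pi.single j (s : AddCircle L)))
      (fderiv ℝ (fun y => φ (coverMap L y)) (y + s • Pi.single j 1) (Pi.single j 1)) s := by
  have h1 : DifferentiableAt ℝ (fun y => φ (coverMap L y)) (y + s • Pi.single j 1) :=
    (ContDiff.differentiable h (by simp)) _
  have h2 : HasDerivAt (fun s : ℝ => y + s • (Pi.single j 1 : Fin 2 → ℝ)) (Pi.single j 1) s := by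
    simpa using ((hasDerivAt_id s).smul_const (Pi.single j 1 : Fin 2 → ℝ)).const_add y
  have h3 := h1.hasFDerivAt.comp_hasDerivAt s h2
  simpa only [Function.comp_def, coverMap_add_single] using h3

lemma IsSmooth.partialDeriv_coverMap {φ : Torus L → ℝ} (h : IsSmooth φ) (j : Fin 2)
    (y : Fin 2 → ℝ) :
    partialDeriv j φ (coverMap L y) =
      fderiv ℝ (fun y => φ (coverMap L y)) y (Pi.single j 1) := by
  unfold partialDeriv
  simpa using (h.hasDerivAt_coverMap j y 0).deriv

lemma IsSmooth.hasDerivAt {φ : Torus L → ℝ} (h : IsSmooth φ) (j : Fin 2) (x : Torus L) (s : ℝ) :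
    HasDerivAt (fun s : ℝ => φ (x + Pi.single j (s : AddCircle L)))
      (partialDeriv j φ (x + Pi.single j (s : AddCircle L))) s := by
  obtain ⟨y, rfl⟩ := isOpenQuotientMap_coverMap.surjective x
  have := h.hasDerivAt_coverMap j y s
  rwa [← h.partialDeriv_coverMap, coverMap_add_single] at this

lemma IsSmooth.continuous_partialDeriv {φ : Torus L → ℝ} (h : IsSmooth φ) (j : Fin 2) :
    Continuous (partialDeriv j φ) := by
  refine continuous_of_coverMap ?_
  simp only [h.partialDeriv_coverMap]
  exact (ContDiff.continuous_fderiv h (by simp)).clm_apply continuous_const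

lemma IsSmooth.mul {φ χ : Torus L → ℝ} (h : IsSmooth φ) (h' : IsSmooth χ) :
    IsSmooth (fun x => φ x * χ x) := ContDiff.mul h h'

lemma IsSmooth.partialDeriv_mul {φ χ : Torus L → ℝ} (h : IsSmooth φ) (h' : IsSmooth χ) (j : Fin 2)
    (x : Torus L) :
    partialDeriv j (fun x => φ x * χ x) x = partialDeriv j φ x * χ x + φ x * partialDeriv j χ x := by
  have h1 := (h.hasDerivAt j x 0).mul (h'.hasDerivAt j x 0)
  exact h1.deriv.trans (by simp)

lemma integrable_of_continuous {E : Type*} [NormedAddCommGroup E] {φ : Torus L → E}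
    (h : Continuous φ) : Integrable φ volume :=
  h.integrable_of_hasCompactSupport (HasCompactSupport.of_compactSpace φ)

/-- The integral of a partial derivative over the torus vanishes. -/
lemma IsSmooth.integral_partialDeriv {φ : Torus L → ℝ} (h : IsSmooth φ) (j : Fin 2) :
    ∫ x, partialDeriv j φ x = 0 := by
  obtain ⟨C, hC⟩ := (isCompact_univ (X := Torus L)).exists_bound_of_continuousOn
    (h.continuous_partialDeriv j).continuousOn
  have hcont : ∀ s : ℝ, Continuous fun x : Torus L => φ (x + Pi.single j (s : AddCircle L)) :=
    fun s => h.continuous.comp (continuous_id.add continuous_const)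
  have hC' : ∀ᵐ x : Torus L, ∀ s ∈ (univ : Set ℝ),
      ‖partialDeriv j φ (x + Pi.single j (s : AddCircle L))‖ ≤ C :=
    Eventually.of_forall fun x s _ => hC _ (mem_univ _)
  have hderiv : ∀ᵐ x : Torus L, ∀ s ∈ (univ : Set ℝ),
      HasDerivAt (fun s : ℝ => φ (x + Pi.single j (s : AddCircle L)))
        (partialDeriv j φ (x + Pi.single j (s : AddCircle L))) s :=
    Eventually.of_forall fun x s _ => h.hasDerivAt j x s
  have hmeas : AEStronglyMeasurable
      (fun x : Torus L => partialDeriv j φ (x + Pi.single j ((0 : ℝ) : AddCircle L))) volume :=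
    ((h.continuous_partialDeriv j).comp (continuous_id.add continuous_const)).aestronglyMeasurable
  have key := (hasDerivAt_integral_of_dominated_loc_of_deriv_le univ_mem
    (Eventually.of_forall fun s => (hcont s).aestronglyMeasurable)
    (integrable_of_continuous (hcont 0)) hmeas hC' (integrable_const C) hderiv).2
  -- Translation invariance makes the integral independent of the shift `s`, while its derivative at
  -- `s = 0` is the integral of `∂_j φ`.
  have hconst : (fun s : ℝ => ∫ x : Torus L, φ (x + Pi.single j (s : AddCircle L))) =
      fun _ => ∫ x : Torus L, φ x :=
    funext fun s => integral_add_right_eq_self φ (Pi.single j (s : AddCircle L))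
  rw [hconst] at key
  have := key.unique (hasDerivAt_const (0 : ℝ) _)
  simpa using this

/-- Integration by parts on the torus. -/
lemma IsSmooth.integral_mul_partialDeriv {φ χ : Torus L → ℝ} (h : IsSmooth φ) (h' : IsSmooth χ)
    (j : Fin 2) : ∫ x, φ x * partialDeriv j χ x = - ∫ x, partialDeriv j φ x * χ x := by
  have h1 := (h.mul h').integral_partialDeriv j
  simp only [h.partialDeriv_mul h'] at h1
  rw [integral_add (f := fun x => partialDeriv j φ x * χ x)
    (g := fun x => φ x * partialDeriv j χ x) (integrable_of_continuous ((h.continuous_partialDeriv j).mul h'.continuous))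
    (integrable_of_continuous (h.continuous.mul (h'.continuous_partialDeriv j)))] at h1
  linarith

lemma period_pos : 0 < L := Fact.out

lemma integrable_character_mul {F : Torus L → ℂ} (hF : Integrable F) (ξ : Fin 2 → ℤ) :
    Integrable (fun x => character ξ x * F x) :=
  hF.bdd_mul (character ξ).continuous.aestronglyMeasurable
    (Eventually.of_forall fun x => (norm_character ξ x).le)

lemma integral_mul_wave {v : Torus L → ℝ} (hv : Integrable v) (c : ℂ) (ξ : Fin 2 → ℤ) :
    ∫ x, v x * wave c ξ x = (c * ∫ x, character ξ x * (v x : ℂ)).re := by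
  rw [← integral_const_mul]
  refine Eq.trans ?_ (Complex.reCLM.integral_comp_comm
    ((integrable_character_mul hv.ofReal ξ).const_mul c))
  refine integral_congr_ae (Eventually.of_forall fun x => ?_)
  simp only [wave, Complex.reCLM_apply]
  rw [← mul_assoc, mul_comm _ (v x : ℂ), Complex.re_ofReal_mul]

lemma complex_eq_of_re_mul {z z' : ℂ} (h : ∀ c : ℂ, (c * z).re = (c * z').re) : z = z' := by
  apply Complex.ext
  · simpa using h 1
  · simpa using h (-Complex.I)

lemma freq_ne_zero {k : ℤ} (hk : k ≠ 0) : freq L k ≠ 0 := by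
  have hL : 0 < L := period_pos
  rw [← norm_ne_zero_iff, norm_freq]
  have := Real.pi_pos
  have hk' : (k : ℝ) ≠ 0 := by exact_mod_cast hk
  positivity

lemma volume_torus : (volume : Measure (Torus L)) univ = ENNReal.ofReal (L ^ 2) := by
  rw [volume_pi, Measure.pi_univ]
  simp [AddCircle.measure_univ, ENNReal.ofReal_pow period_pos.le]

/-- A real wave of nonzero frequency is a partial derivative of another wave, and partial
derivatives integrate to zero. -/
lemma integral_character_of_ne {ξ : Fin 2 → ℤ} (h : ξ ≠ 0) :
    ∫ x : Torus L, character ξ x = 0 := by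
  obtain ⟨j, hj⟩ := Function.ne_iff.mp h
  have hj' : freq L (ξ j) ≠ 0 := freq_ne_zero hj
  refine complex_eq_of_re_mul fun c => ?_
  have h1 := integral_mul_wave (L := L) (v := fun _ => 1) (integrable_const _) c ξ
  simp only [one_mul, Complex.ofReal_one, mul_one] at h1
  have h2 := (isSmooth_wave (L := L) (c / freq L (ξ j)) ξ).integral_partialDeriv j
  rw [partialDeriv_wave, div_mul_cancel₀ _ hj'] at h2
  rw [← h1, h2, mul_zero, Complex.zero_re]

lemma integral_character_zero : ∫ x : Torus L, character 0 x = ((L ^ 2 : ℝ) : ℂ) := by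
  simp only [character_zero, integral_const, Measure.real, volume_torus]
  rw [ENNReal.toReal_ofReal (by positivity)]
  simp

/-! ### Fourier series in `L²`: Parseval, convolution, Riesz–Fischer -/

/-- The normalised characters as elements of `L²`. -/
def characterLp (L : ℝ) [Fact (0 < L)] (ξ : Fin 2 → ℤ) :
    Lp ℂ 2 (volume : Measure (Torus L)) :=
  (L : ℂ)⁻¹ • ContinuousMap.toLp (E := ℂ) 2 volume ℂ (character ξ)

lemma orthonormal_characterLp : Orthonormal ℂ (characterLp L) := by
  have hL : (L : ℂ) ≠ 0 := by exact_mod_cast (period_pos (L := L)).ne'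
  rw [orthonormal_iff_ite]
  intro m n
  simp only [characterLp, inner_smul_left, inner_smul_right, ContinuousMap.inner_toLp,
    ← character_neg, ← character_add]
  split_ifs with h
  · subst h
    rw [add_neg_cancel, integral_character_zero]
    simp; field_simp
  · rw [integral_character_of_ne]
    · simp
    · intro h'
      exact h (by rw [← sub_eq_add_neg, sub_eq_zero] at h'; exact h'.symm)

/-- The star subalgebra of trigonometric polynomials on the torus. -/
def characterSubalgebra (L : ℝ) [Fact (0 < L)] : StarSubalgebra ℂ C(Torus L, ℂ) where
  toSubalgebra := Algebra.adjoin ℂ (range character)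
  star_mem' := by
    change Algebra.adjoin ℂ (range character) ≤ star (Algebra.adjoin ℂ (range character))
    refine Algebra.adjoin_le ?_
    rintro _ ⟨n, rfl⟩
    refine Algebra.subset_adjoin ⟨-n, ?_⟩
    ext1 x
    simp only [character_neg, starRingEnd_apply, ContinuousMap.star_apply]

lemma characterSubalgebra_coe :
    (characterSubalgebra L).toSubalgebra.toSubmodule = Submodule.span ℂ (range character) := by
  apply Algebra.adjoin_eq_span_of_subset
  refine .trans (fun x ↦ Submonoid.closure_induction (fun _ ↦ id) ⟨0, ?_⟩ ?_)
    Submodule.subset_span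
  · ext z
    exact character_zero z
  · rintro _ _ _ _ ⟨m, rfl⟩ ⟨n, rfl⟩
    refine ⟨m + n, ?_⟩
    ext z
    exact character_add m n z

lemma characterSubalgebra_separatesPoints : (characterSubalgebra L).SeparatesPoints := by
  intro x y hxy
  obtain ⟨i, hi⟩ := Function.ne_iff.mp hxy
  refine ⟨_, ⟨character (Pi.single i 1), Algebra.subset_adjoin ⟨Pi.single i 1, rfl⟩, rfl⟩, ?_⟩
  have h : ∀ z : Torus L, character (Pi.single i 1) z = fourier 1 (z i) := by
    intro z
    fin_cases i <;> simp [character_apply]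
  dsimp only
  rw [h, h, fourier_one, fourier_one]
  exact fun h' => hi (AddCircle.injective_toCircle period_pos.ne' (Circle.coe_injective h'))

/-- Stone–Weierstrass: the span of the characters is a star subalgebra, and it separates points
coordinate by coordinate. -/
lemma span_character_closure_eq_top :
    (Submodule.span ℂ (range (character (L := L)))).topologicalClosure = ⊤ := by
  rw [← characterSubalgebra_coe]
  exact congr_arg (Subalgebra.toSubmodule <| StarSubalgebra.toSubalgebra ·)
    (ContinuousMap.starSubalgebra_topologicalClosure_eq_top_of_separatesPoints _
      characterSubalgebra_separatesPoints)

lemma span_characterLp_closure_eq_top :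
    (Submodule.span ℂ (range (characterLp L))).topologicalClosure = ⊤ := by
  have hL : (L : ℂ) ≠ 0 := by exact_mod_cast (period_pos (L := L)).ne'
  have h : (Submodule.span ℂ (range fun ξ =>
      ContinuousMap.toLp (E := ℂ) 2 (volume : Measure (Torus L)) ℂ (character ξ))).topologicalClosure
      = ⊤ := by
    simpa only [Submodule.map_span, ContinuousLinearMap.coe_coe, ← range_comp,
      Function.comp_def] using
      (ContinuousMap.toLp_denseRange ℂ (volume : Measure (Torus L)) ℂ
        (p := 2) (by simp)).topologicalClosure_map_submodule span_character_closure_eq_top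
  rw [eq_top_iff, ← h]
  refine Submodule.topologicalClosure_mono (Submodule.span_le.2 ?_)
  rintro _ ⟨ξ, rfl⟩
  have h1 : characterLp L ξ ∈ Submodule.span ℂ (range (characterLp L)) :=
    Submodule.subset_span ⟨ξ, rfl⟩
  have h2 := Submodule.smul_mem _ (L : ℂ) h1
  rwa [characterLp, smul_smul, mul_inv_cancel₀ hL, one_smul] at h2

/-- The Hilbert basis of normalised characters of the torus. -/
def characterBasis (L : ℝ) [Fact (0 < L)] :
    HilbertBasis (Fin 2 → ℤ) ℂ (Lp ℂ 2 (volume : Measure (Torus L))) :=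
  HilbertBasis.mk orthonormal_characterLp span_characterLp_closure_eq_top.ge

/-- The Fourier coefficients of a complex function. -/
def coeffC (F : Torus L → ℂ) (ξ : Fin 2 → ℤ) : ℂ :=
  ((L ^ 2 : ℝ) : ℂ)⁻¹ * ∫ x : Torus L, character (-ξ) x * F x

lemma fourierCoeff₂_eq_coeffC (v : Torus L → ℝ) (ξ : Fin 2 → ℤ) :
    fourierCoeff₂ v ξ = coeffC (fun x => (v x : ℂ)) ξ := rfl

lemma inner_characterLp (F : Lp ℂ 2 (volume : Measure (Torus L))) (ξ : Fin 2 → ℤ) :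
    inner ℂ (characterLp L ξ) F = L * coeffC F ξ := by
  have hL : (L : ℂ) ≠ 0 := by exact_mod_cast (period_pos (L := L)).ne'
  rw [characterLp, inner_smul_left, L2.inner_def, coeffC]
  have h : ∫ x, inner ℂ (ContinuousMap.toLp (E := ℂ) 2 (volume : Measure (Torus L)) ℂ
      (character ξ) x) (F x) = ∫ x : Torus L, character (-ξ) x * F x := by
    refine integral_congr_ae ?_
    filter_upwards [ContinuousMap.coeFn_toLp (𝕜 := ℂ) (p := 2) (volume : Measure (Torus L))
      (character ξ)] with x hx
    rw [hx, RCLike.inner_apply, character_neg, mul_comm]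
  rw [h]
  simp
  field_simp

lemma characterBasis_repr (F : Lp ℂ 2 (volume : Measure (Torus L))) (ξ : Fin 2 → ℤ) :
    (characterBasis L).repr F ξ = L * coeffC F ξ := by
  rw [HilbertBasis.repr_apply_apply, ← inner_characterLp]
  simp [characterBasis]

lemma coeffC_congr {F G : Torus L → ℂ} (h : F =ᵐ[volume] G) (ξ : Fin 2 → ℤ) :
    coeffC F ξ = coeffC G ξ := by
  unfold coeffC
  congr 1
  refine integral_congr_ae ?_
  filter_upwards [h] with x hx
  rw [hx]

/-- Parseval's identity on the torus. -/
lemma hasSum_conj_coeffC_mul {F G : Torus L → ℂ} (hF : MemLp F 2) (hG : MemLp G 2) :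
    HasSum (fun ξ => (starRingEnd ℂ) (coeffC F ξ) * coeffC G ξ)
      (((L ^ 2 : ℝ) : ℂ)⁻¹ * ∫ x : Torus L, (starRingEnd ℂ) (F x) * G x) := by
  have hL : (L : ℂ) ≠ 0 := by exact_mod_cast (period_pos (L := L)).ne'
  have h := (characterBasis L).hasSum_inner_mul_inner (hF.toLp F) (hG.toLp G)
  have hb : ∀ ξ, (characterBasis L) ξ = characterLp L ξ := fun ξ => by simp [characterBasis]
  have h1 : inner ℂ (hF.toLp F) (hG.toLp G) = ∫ x : Torus L, (starRingEnd ℂ) (F x) * G x := by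
    rw [L2.inner_def]
    refine integral_congr_ae ?_
    filter_upwards [hF.coeFn_toLp, hG.coeFn_toLp] with x hx hx'
    rw [hx, hx', RCLike.inner_apply, mul_comm]
  rw [h1] at h
  refine (h.mul_left (((L ^ 2 : ℝ) : ℂ)⁻¹)).congr_fun fun ξ => ?_
  rw [hb, inner_characterLp, ← inner_conj_symm, inner_characterLp,
    coeffC_congr hF.coeFn_toLp, coeffC_congr hG.coeFn_toLp]
  simp
  field_simp

lemma conj_fourierCoeff₂ (v : Torus L → ℝ) (ξ : Fin 2 → ℤ) :
    (starRingEnd ℂ) (fourierCoeff₂ v ξ) = fourierCoeff₂ v (-ξ) := by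
  simp only [fourierCoeff₂_eq_coeffC, coeffC, map_mul, map_inv₀, Complex.conj_ofReal,
    ← integral_conj, neg_neg]
  simp only [character_neg, Complex.conj_conj]

lemma memLp_character_mul {F : Torus L → ℂ} (hF : MemLp F 2) (ξ : Fin 2 → ℤ) :
    MemLp (fun x => character ξ x * F x) 2 := by
  refine hF.of_le ((character ξ).continuous.aestronglyMeasurable.mul hF.1)
    (Eventually.of_forall fun x => ?_)
  rw [norm_mul, norm_character, one_mul]

/-- The Fourier coefficients of a product are given by the convolution of the coefficients. -/
lemma hasSum_fourierCoeff₂_mul {f g : Torus L → ℝ} (hf : MemLp f 2) (hg : MemLp g 2)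
    (ξ : Fin 2 → ℤ) :
    HasSum (fun η => fourierCoeff₂ f (ξ - η) * fourierCoeff₂ g η)
      (fourierCoeff₂ (fun x => f x * g x) ξ) := by
  -- Parseval for the pair `e_ξ f`, `g`: as `f` is real, the conjugate of the `η`-th coefficient of
  -- `e_ξ f` is the coefficient of `f` at `ξ - η`.
  have h := hasSum_conj_coeffC_mul (memLp_character_mul hf.ofReal ξ) hg.ofReal
  have h1 : fourierCoeff₂ (fun x => f x * g x) ξ = ((L ^ 2 : ℝ) : ℂ)⁻¹ * ∫ x : Torus L,
      (starRingEnd ℂ) (character ξ x * ((f x : ℝ) : ℂ)) * ((g x : ℝ) : ℂ) := by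
    rw [fourierCoeff₂_eq_coeffC, coeffC]
    congr 2
    funext x
    rw [map_mul, Complex.conj_ofReal, character_neg]
    push_cast; ring
  rw [h1]
  refine h.congr_fun fun η => ?_
  rw [← neg_sub η ξ, ← conj_fourierCoeff₂, fourierCoeff₂_eq_coeffC, fourierCoeff₂_eq_coeffC]
  unfold coeffC
  simp only [show -(η - ξ) = -η + ξ by abel, character_add, mul_assoc]
  rfl

lemma fourierCoeff₂_congr {f g : Torus L → ℝ} (h : f =ᵐ[volume] g) (ξ : Fin 2 → ℤ) :
    fourierCoeff₂ f ξ = fourierCoeff₂ g ξ := by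
  refine coeffC_congr ?_ ξ
  filter_upwards [h] with x hx
  simp [hx]

lemma integrable_of_memLp {v : Torus L → ℝ} (hv : MemLp v 2) : Integrable v :=
  hv.integrable (by norm_num)

/-- Parseval's identity for the real inner product. -/
lemma hasSum_conj_fourierCoeff₂_mul {f g : Torus L → ℝ} (hf : MemLp f 2) (hg : MemLp g 2) :
    HasSum (fun ξ => (starRingEnd ℂ) (fourierCoeff₂ f ξ) * fourierCoeff₂ g ξ)
      (((L ^ 2)⁻¹ * ∫ x : Torus L, f x * g x : ℝ) : ℂ) := by
  have h := hasSum_conj_coeffC_mul hf.ofReal hg.ofReal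
  have h1 : (((L ^ 2)⁻¹ * ∫ x : Torus L, f x * g x : ℝ) : ℂ) = ((L ^ 2 : ℝ) : ℂ)⁻¹ * ∫ x : Torus L,
      (starRingEnd ℂ) ((f x : ℝ) : ℂ) * ((g x : ℝ) : ℂ) := by
    rw [Complex.ofReal_mul, ← integral_complex_ofReal]
    simp
  rw [h1]
  exact h

lemma hasSum_sq_fourierCoeff₂ {f : Torus L → ℝ} (hf : MemLp f 2) :
    HasSum (fun ξ => ‖fourierCoeff₂ f ξ‖ ^ 2) ((L ^ 2)⁻¹ * ∫ x : Torus L, f x ^ 2) := by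
  have h := Complex.hasSum_re (hasSum_conj_fourierCoeff₂_mul hf hf)
  rw [Complex.ofReal_re] at h
  simp only [← pow_two] at h
  refine h.congr_fun fun ξ => ?_
  rw [Complex.conj_mul', ← Complex.ofReal_pow, Complex.ofReal_re]

/-- Parseval's identity for extended norms. -/
lemma tsum_enorm_sq_fourierCoeff₂ {f : Torus L → ℝ} (hf : MemLp f 2) :
    ∑' ξ, ‖fourierCoeff₂ f ξ‖ₑ ^ 2 = (ENNReal.ofReal (L ^ 2))⁻¹ * eLpNorm f 2 volume ^ 2 := by
  have h := hasSum_sq_fourierCoeff₂ hf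
  have hL : 0 < L := period_pos
  have h1 : ∑' ξ, ‖fourierCoeff₂ f ξ‖ₑ ^ 2 = ∑' ξ, ENNReal.ofReal (‖fourierCoeff₂ f ξ‖ ^ 2) := by
    refine tsum_congr fun ξ => ?_
    rw [ENNReal.ofReal_pow (norm_nonneg _), ofReal_norm]
  rw [h1, ← ENNReal.ofReal_tsum_of_nonneg (fun _ => by positivity) h.summable, h.tsum_eq,
    ENNReal.ofReal_mul (by positivity), ENNReal.ofReal_inv_of_pos (by positivity)]
  congr 1
  rw [ofReal_integral_eq_lintegral_ofReal hf.integrable_sq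
    (Eventually.of_forall fun x => sq_nonneg _)]
  rw [eLpNorm_eq_lintegral_rpow_enorm_toReal (by norm_num) (by norm_num)]
  simp only [ENNReal.toReal_ofNat]
  rw [← ENNReal.rpow_natCast, ← ENNReal.rpow_mul]
  norm_num
  refine lintegral_congr fun x => ?_
  rw [← ofReal_norm, ← ENNReal.ofReal_pow (norm_nonneg _)]
  simp

/-- The Riesz–Fischer theorem for real functions. -/
lemma exists_fourierCoeff₂_eq {a : (Fin 2 → ℤ) → ℂ} (ha : Summable fun ξ => ‖a ξ‖ ^ 2)
    (hconj : ∀ ξ, (starRingEnd ℂ) (a ξ) = a (-ξ)) :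
    ∃ w : Torus L → ℝ, MemLp w 2 ∧ ∀ ξ, fourierCoeff₂ w ξ = a ξ := by
  have hL : (L : ℂ) ≠ 0 := by exact_mod_cast (period_pos (L := L)).ne'
  have hmem : Memℓp (fun ξ => (L : ℂ) * a ξ) 2 := by
    refine memℓp_gen ?_
    simp only [norm_mul, ENNReal.toReal_ofNat, Real.rpow_ofNat, mul_pow]
    exact ha.mul_left _
  set F := (characterBasis L).repr.symm ⟨_, hmem⟩ with hF
  have hFc : ∀ ξ, coeffC F ξ = a ξ := by
    intro ξ
    have := characterBasis_repr F ξ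
    rw [hF, LinearIsometryEquiv.apply_symm_apply] at this
    exact (mul_left_cancel₀ hL this).symm
  have hFi : Integrable F := (Lp.memLp F).integrable (by norm_num)
  -- Taking the real part symmetrizes the coefficients, and they are already Hermitian by `hconj`,
  -- so they do not change.
  refine ⟨fun x => (F x).re, (Lp.memLp F).re, fun ξ => ?_⟩
  have h1 : fourierCoeff₂ (fun x => (F x).re) ξ =
      (coeffC F ξ + (starRingEnd ℂ) (coeffC F (-ξ))) / 2 := by
    rw [fourierCoeff₂_eq_coeffC, coeffC, coeffC, coeffC, map_mul, ← integral_conj, map_inv₀,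
      Complex.conj_ofReal, ← mul_add, mul_div_assoc]
    have hi : Integrable (fun x => (starRingEnd ℂ) (character (- -ξ) x * F x)) :=
      Complex.conjCLE.toContinuousLinearMap.integrable_comp (integrable_character_mul hFi _)
    rw [← integral_add (integrable_character_mul hFi _) hi, ← integral_div]
    congr 2
    funext x
    rw [map_mul, character_neg (-ξ), Complex.conj_conj, Complex.re_eq_add_conj]
    ring
  rw [h1, hFc, hFc, hconj, neg_neg]
  ring

/-! ### Weighted sequences and trilinear Young inequalities -/

section Sequences

variable {ι : Type*}

/-- The `ℓ²` norm of a family of extended nonnegative numbers. -/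
def ellTwo (f : ι → ℝ≥0∞) : ℝ≥0∞ := (∑' i, f i ^ 2) ^ (1 / 2 : ℝ)

lemma ellTwo_sq (f : ι → ℝ≥0∞) : ellTwo f ^ 2 = ∑' i, f i ^ 2 := by
  rw [ellTwo, ← ENNReal.rpow_natCast, ← ENNReal.rpow_mul]
  norm_num

lemma ellTwo_mono {f g : ι → ℝ≥0∞} (h : ∀ i, f i ≤ g i) : ellTwo f ≤ ellTwo g :=
  ENNReal.rpow_le_rpow (ENNReal.tsum_le_tsum fun i => by gcongr; exact h i) (by norm_num)

lemma ellTwo_const_mul (c : ℝ≥0∞) (f : ι → ℝ≥0∞) : ellTwo (fun i => c * f i) = c * ellTwo f := by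
  simp only [ellTwo, mul_pow]
  rw [ENNReal.tsum_mul_left, ENNReal.mul_rpow_of_nonneg _ _ (by norm_num),
    ← ENNReal.rpow_natCast, ← ENNReal.rpow_mul]
  norm_num

lemma ellTwo_comp_equiv (e : ι ≃ ι) (f : ι → ℝ≥0∞) : ellTwo (fun i => f (e i)) = ellTwo f := by
  rw [ellTwo, ellTwo, e.tsum_eq (fun i => f i ^ 2)]

/-- The Cauchy–Schwarz inequality. -/
lemma tsum_mul_le_ellTwo (f g : ι → ℝ≥0∞) : ∑' i, f i * g i ≤ ellTwo f * ellTwo g := by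
  rw [ENNReal.tsum_eq_iSup_sum]
  refine iSup_le fun s => (ENNReal.inner_le_Lp_mul_Lq s f g Real.HolderConjugate.two_two).trans ?_
  simp only [ENNReal.rpow_ofNat]
  exact mul_le_mul' (ENNReal.rpow_le_rpow (ENNReal.sum_le_tsum s) (by norm_num))
    (ENNReal.rpow_le_rpow (ENNReal.sum_le_tsum s) (by norm_num))

/-- Minkowski's inequality. -/
lemma ellTwo_add_le (f g : ι → ℝ≥0∞) : ellTwo (fun i => f i + g i) ≤ ellTwo f + ellTwo g := by
  rw [ellTwo, ENNReal.tsum_eq_iSup_sum, one_div, ENNReal.rpow_inv_le_iff (by norm_num)]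
  refine iSup_le fun s => ?_
  rw [← ENNReal.rpow_inv_le_iff (by norm_num), ← one_div]
  have h := ENNReal.Lp_add_le s f g (p := 2) (by norm_num)
  simp only [ENNReal.rpow_ofNat] at h
  exact h.trans (add_le_add (ENNReal.rpow_le_rpow (ENNReal.sum_le_tsum s) (by norm_num))
    (ENNReal.rpow_le_rpow (ENNReal.sum_le_tsum s) (by norm_num)))

variable {G : Type*} [AddCommGroup G]

/-- Substituting `ξ = δ + η` and applying Cauchy–Schwarz in `η` for each `δ`: translates of `p` keep
their `ℓ²` norm. The next two lemmas place the `ℓ¹` norm on the other factors instead. -/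
lemma tsum_trilinear_mid (p k q : G → ℝ≥0∞) :
    ∑' ξ, ∑' η, p ξ * (k (ξ - η) * q η) ≤ ellTwo p * (∑' δ, k δ) * ellTwo q := by
  rw [ENNReal.tsum_comm]
  calc ∑' η, ∑' ξ, p ξ * (k (ξ - η) * q η)
      = ∑' η, ∑' δ, k δ * (p (δ + η) * q η) := by
        refine tsum_congr fun η => ?_
        rw [← (Equiv.addRight η).tsum_eq fun ξ => p ξ * (k (ξ - η) * q η)]
        refine tsum_congr fun δ => ?_
        simp only [Equiv.coe_addRight, add_sub_cancel_right]
        ring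
    _ = ∑' δ, k δ * ∑' η, p (δ + η) * q η := by
        rw [ENNReal.tsum_comm]
        exact tsum_congr fun δ => ENNReal.tsum_mul_left
    _ ≤ ∑' δ, k δ * (ellTwo p * ellTwo q) := by
        refine ENNReal.tsum_le_tsum fun δ => ?_
        gcongr
        refine (tsum_mul_le_ellTwo _ _).trans_eq ?_
        rw [← ellTwo_comp_equiv (Equiv.addLeft δ) p]
        rfl
    _ = _ := by rw [ENNReal.tsum_mul_right]; ring

lemma tsum_trilinear_right (p k q : G → ℝ≥0∞) :
    ∑' ξ, ∑' η, p ξ * (k (ξ - η) * q η) ≤ ellTwo p * ellTwo k * ∑' η, q η := by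
  rw [ENNReal.tsum_comm]
  calc ∑' η, ∑' ξ, p ξ * (k (ξ - η) * q η)
      = ∑' η, (∑' ξ, p ξ * k (ξ - η)) * q η := by
        refine tsum_congr fun η => ?_
        rw [← ENNReal.tsum_mul_right]
        exact tsum_congr fun ξ => by ring
    _ ≤ ∑' η, (ellTwo p * ellTwo k) * q η := by
        refine ENNReal.tsum_le_tsum fun η => ?_
        gcongr
        refine (tsum_mul_le_ellTwo _ _).trans_eq ?_
        rw [← ellTwo_comp_equiv (Equiv.subRight η) k]
        rfl
    _ = _ := ENNReal.tsum_mul_left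

lemma tsum_trilinear_left (p k q : G → ℝ≥0∞) :
    ∑' ξ, ∑' η, p ξ * (k (ξ - η) * q η) ≤ (∑' ξ, p ξ) * ellTwo k * ellTwo q := by
  calc ∑' ξ, ∑' η, p ξ * (k (ξ - η) * q η)
      ≤ ∑' ξ, p ξ * (ellTwo k * ellTwo q) := by
        refine ENNReal.tsum_le_tsum fun ξ => ?_
        rw [ENNReal.tsum_mul_left]
        gcongr
        refine (tsum_mul_le_ellTwo _ _).trans_eq ?_
        rw [← ellTwo_comp_equiv (Equiv.subLeft ξ) k]
        rfl
    _ = _ := by rw [ENNReal.tsum_mul_right]; ring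

end Sequences

/-! ### Brackets, truncated Sobolev weights and their commutators -/

section Weights

/-- The bracket `⟨ξ⟩ = (1 + |ξ|²)^{1/2}`. -/
def bracket (ξ : Fin 2 → ℤ) : ℝ := √(1 + ((ξ 0 : ℝ) ^ 2 + (ξ 1 : ℝ) ^ 2))

lemma bracket_sq (ξ : Fin 2 → ℤ) : bracket ξ ^ 2 = 1 + ((ξ 0 : ℝ) ^ 2 + (ξ 1 : ℝ) ^ 2) :=
  Real.sq_sqrt (by positivity)

lemma one_le_bracket (ξ : Fin 2 → ℤ) : 1 ≤ bracket ξ :=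
  Real.one_le_sqrt.2 (by linarith [sq_nonneg (ξ 0 : ℝ), sq_nonneg (ξ 1 : ℝ)])

lemma bracket_pos (ξ : Fin 2 → ℤ) : 0 < bracket ξ := one_pos.trans_le (one_le_bracket ξ)

lemma bracket_neg (ξ : Fin 2 → ℤ) : bracket (-ξ) = bracket ξ := by simp [bracket]

lemma bracket_sub_comm (ξ η : Fin 2 → ℤ) : bracket (ξ - η) = bracket (η - ξ) := by
  rw [← neg_sub, bracket_neg]

lemma abs_le_bracket (ξ : Fin 2 → ℤ) (j : Fin 2) : |(ξ j : ℝ)| ≤ bracket ξ := by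
  refine abs_le_of_sq_le_sq ?_ (bracket_pos ξ).le
  rw [bracket_sq]
  fin_cases j <;> simp <;> nlinarith [sq_nonneg (ξ 0 : ℝ), sq_nonneg (ξ 1 : ℝ)]

lemma bracket_le_add (ξ η : Fin 2 → ℤ) : bracket ξ ≤ bracket η + bracket (ξ - η) := by
  have h1 := bracket_pos η
  have h2 := bracket_pos (ξ - η)
  have e1 := bracket_sq ξ
  have e2 := bracket_sq η
  have e3 := bracket_sq (ξ - η)
  simp only [Pi.sub_apply, Int.cast_sub] at e3
  have h3 : (η 0 : ℝ) * (ξ 0 - η 0) + η 1 * (ξ 1 - η 1) ≤ bracket η * bracket (ξ - η) := by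
    refine le_of_abs_le (abs_le_of_sq_le_sq ?_ (by positivity))
    rw [mul_pow, e2, e3]
    nlinarith [sq_nonneg ((η 0 : ℝ) * (ξ 1 - η 1) - η 1 * (ξ 0 - η 0)), sq_nonneg (η 0 : ℝ),
      sq_nonneg (η 1 : ℝ), sq_nonneg (ξ 0 - η 0 : ℝ), sq_nonneg (ξ 1 - η 1 : ℝ)]
  refine le_of_abs_le (abs_le_of_sq_le_sq ?_ (by positivity))
  nlinarith

lemma abs_bracket_sub_le (ξ η : Fin 2 → ℤ) : |bracket ξ - bracket η| ≤ bracket (ξ - η) := by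
  rw [abs_le]
  have := bracket_le_add ξ η
  have := bracket_le_add η ξ
  rw [bracket_sub_comm] at this
  constructor <;> linarith

/-- The cross product `ξ × η`. -/
def cross (ξ η : Fin 2 → ℤ) : ℝ := ξ 0 * η 1 - ξ 1 * η 0

lemma cross_swap (ξ η : Fin 2 → ℤ) : cross η ξ = - cross ξ η := by
  simp only [cross]; ring

/-- By antisymmetry `ξ × η = (ξ - η) × η`, so one derivative falls on the difference frequency;
Lagrange's identity then gives the bound. -/
lemma abs_cross_le_right (ξ η : Fin 2 → ℤ) : |cross ξ η| ≤ bracket (ξ - η) * bracket η := by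
  have h2 := bracket_pos η
  have h3 := bracket_pos (ξ - η)
  refine abs_le_of_sq_le_sq ?_ (by positivity)
  rw [mul_pow, bracket_sq, bracket_sq, cross]
  simp only [Pi.sub_apply, Int.cast_sub]
  nlinarith [sq_nonneg ((η 0 : ℝ) * (ξ 0 - η 0) + η 1 * (ξ 1 - η 1)), sq_nonneg (η 0 : ℝ),
      sq_nonneg (η 1 : ℝ), sq_nonneg (ξ 0 - η 0 : ℝ), sq_nonneg (ξ 1 - η 1 : ℝ)]

/-- The cutoff `max 0 (1 - r / N)`. -/
def cutoff (N r : ℝ) : ℝ := max 0 (1 - r / N)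

lemma cutoff_nonneg (N r : ℝ) : 0 ≤ cutoff N r := le_max_left _ _

lemma cutoff_le_one {N r : ℝ} (hN : 0 < N) (hr : 0 ≤ r) : cutoff N r ≤ 1 :=
  max_le zero_le_one (by have := div_nonneg hr hN.le; linarith)

lemma cutoff_eq_zero {N r : ℝ} (hN : 0 < N) (hr : N ≤ r) : cutoff N r = 0 :=
  max_eq_left (by rw [sub_nonpos]; exact (one_le_div hN).2 hr)

lemma abs_cutoff_sub_le {N : ℝ} (hN : 0 < N) (r q : ℝ) :
    |cutoff N r - cutoff N q| ≤ |r - q| / N := by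
  rw [cutoff, cutoff, max_comm 0, max_comm 0]
  refine (abs_max_sub_max_le_abs _ _ _).trans_eq ?_
  rw [show 1 - r / N - (1 - q / N) = -((r - q) / N) by ring, abs_neg, abs_div, abs_of_pos hN]

lemma one_sub_cutoff_le (N r : ℝ) : 1 - cutoff N r ≤ r / N := by
  have := le_max_right 0 (1 - r / N)
  unfold cutoff
  linarith

lemma pow_succ_sub_le {r q : ℝ} (hq : 0 ≤ q) (h : q ≤ r) (p : ℕ) :
    r ^ (p + 1) - q ^ (p + 1) ≤ (p + 1) * r ^ p * (r - q) := by
  have hr : 0 ≤ r := hq.trans h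
  induction p with
  | zero => simp
  | succ p ih =>
    have h1 : q * (r ^ (p + 1) - q ^ (p + 1)) ≤ r * ((p + 1) * r ^ p * (r - q)) :=
      (mul_le_mul_of_nonneg_right h (sub_nonneg.2 (pow_le_pow_left₀ hq h _))).trans
        (mul_le_mul_of_nonneg_left ih hr)
    have h2 : r ^ (p + 1 + 1) - q ^ (p + 1 + 1) =
        r ^ (p + 1) * (r - q) + q * (r ^ (p + 1) - q ^ (p + 1)) := by ring
    have h3 : r * ((p + 1) * r ^ p * (r - q)) = (p + 1) * r ^ (p + 1) * (r - q) := by ring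
    rw [h2]; push_cast; linarith

/-- The point is independence of `N`. The slope `1/N` of the cutoff only matters when `q ≤ N`, and
there it is absorbed by one factor `q`; beyond `N` both cutoffs vanish. -/
lemma abs_pow_mul_cutoff_sub_le {N r q : ℝ} (hN : 0 < N) (hq : 0 ≤ q) (h : q ≤ r) (p : ℕ) :
    |r ^ (p + 1) * cutoff N r - q ^ (p + 1) * cutoff N q| ≤ (p + 2) * r ^ p * (r - q) := by
  have hr : 0 ≤ r := hq.trans h
  have hpow : 0 ≤ r ^ (p + 1) - q ^ (p + 1) := sub_nonneg.2 (pow_le_pow_left₀ hq h _)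
  have h1 : |(r ^ (p + 1) - q ^ (p + 1)) * cutoff N r| ≤ (p + 1) * r ^ p * (r - q) := by
    rw [abs_of_nonneg (mul_nonneg hpow (cutoff_nonneg _ _))]
    exact (mul_le_of_le_one_right hpow (cutoff_le_one hN hr)).trans (pow_succ_sub_le hq h p)
  have h2 : |q ^ (p + 1) * (cutoff N r - cutoff N q)| ≤ r ^ p * (r - q) := by
    rcases le_total N q with hNq | hNq
    · rw [cutoff_eq_zero hN hNq, cutoff_eq_zero hN (hNq.trans h)]
      simp only [sub_self, mul_zero, abs_zero]
      exact mul_nonneg (pow_nonneg hr _) (sub_nonneg.2 h)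
    · rw [abs_mul, abs_of_nonneg (pow_nonneg hq _)]
      calc q ^ (p + 1) * |cutoff N r - cutoff N q| ≤ q ^ (p + 1) * (|r - q| / N) := by
            gcongr; exact abs_cutoff_sub_le hN r q
        _ = q ^ p * (r - q) * (q / N) := by
            rw [abs_of_nonneg (sub_nonneg.2 h), pow_succ]; ring
        _ ≤ q ^ p * (r - q) * 1 := by
            have := sub_nonneg.2 h
            gcongr
            exact (div_le_one hN).2 hNq
        _ ≤ r ^ p * (r - q) := by
            have := sub_nonneg.2 h
            rw [mul_one]; gcongr
  have h3 : r ^ (p + 1) * cutoff N r - q ^ (p + 1) * cutoff N q =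
      (r ^ (p + 1) - q ^ (p + 1)) * cutoff N r + q ^ (p + 1) * (cutoff N r - cutoff N q) := by ring
  rw [h3]
  refine (abs_add_le _ _).trans ?_
  linarith

/-- The truncated Sobolev weight `⟨ξ⟩^{2s} max 0 (1 - ⟨ξ⟩ / N)`. -/
def truncWeight (s : ℕ) (N : ℝ) (ξ : Fin 2 → ℤ) : ℝ := bracket ξ ^ (2 * s) * cutoff N (bracket ξ)

lemma truncWeight_nonneg (s : ℕ) (N : ℝ) (ξ : Fin 2 → ℤ) : 0 ≤ truncWeight s N ξ :=
  mul_nonneg (pow_nonneg (bracket_pos ξ).le _) (cutoff_nonneg _ _)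

lemma truncWeight_le (s : ℕ) {N : ℝ} (hN : 0 < N) (ξ : Fin 2 → ℤ) :
    truncWeight s N ξ ≤ bracket ξ ^ (2 * s) :=
  mul_le_of_le_one_right (pow_nonneg (bracket_pos ξ).le _) (cutoff_le_one hN (bracket_pos ξ).le)

/-- Write `r`, `q`, `d` for the brackets of `ξ`, `η`, `ξ - η`. The mean-value bound and the cross
product give `7 r^{2k+3} d · d q`. Keeping `r^{k+2}` and spreading the other `r^{k+1}` over `q + d`
costs a factor 2. The restriction `k ≤ 1` keeps the power of `d` at most four, which is what the
stream function of an `L²` vorticity affords. -/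
lemma abs_truncWeight_sub_mul_cross_le_aux {k : ℕ} (hk : k ≤ 1) {N : ℝ} (hN : 0 < N)
    {ξ η : Fin 2 → ℤ} (h : bracket η ≤ bracket ξ) :
    |truncWeight (k + 2) N ξ - truncWeight (k + 2) N η| * |cross ξ η| ≤
      14 * (bracket ξ ^ (k + 2) * bracket η ^ (k + 2) * bracket (ξ - η) ^ 2 +
        bracket ξ ^ (k + 2) * bracket η ^ k * bracket (ξ - η) ^ 4) := by
  have hq := bracket_pos η
  have hd := bracket_pos (ξ - η)
  have hr := bracket_pos ξ
  have h1 := abs_cross_le_right ξ η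
  have h2 := bracket_le_add ξ η
  have h3 : bracket ξ - bracket η ≤ bracket (ξ - η) := by linarith
  have h4 := abs_pow_mul_cutoff_sub_le hN hq.le h (2 * (k + 2) - 1)
  rw [show 2 * (k + 2) - 1 + 1 = 2 * (k + 2) by omega] at h4
  unfold truncWeight
  generalize bracket ξ = r at *
  generalize bracket η = q at *
  generalize bracket (ξ - η) = d at *
  have h5 : |r ^ (2 * (k + 2)) * cutoff N r - q ^ (2 * (k + 2)) * cutoff N q| * |cross ξ η| ≤
      7 * r ^ (2 * (k + 2) - 1) * d * (d * q) := by
    refine mul_le_mul (h4.trans ?_) h1 (abs_nonneg _) (by positivity)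
    -- The worst case is `k = 1`, where the exponent is 5.
    have h6 : (((2 * (k + 2) - 1 : ℕ) : ℝ) + 2) ≤ 7 := by
      have : 2 * (k + 2) - 1 + 2 ≤ 7 := by omega
      exact_mod_cast this
    have := sub_nonneg.2 h
    gcongr
  refine h5.trans ?_
  interval_cases k
  · have h6 : r * (q * d ^ 2) ≤ 2 * (q ^ 2 * d ^ 2 + d ^ 4) := by
      have : r * (q * d ^ 2) ≤ (q + d) * (q * d ^ 2) := by gcongr
      nlinarith [sq_nonneg (q * d - d ^ 2), sq_nonneg (q * d), sq_nonneg (d ^ 2)]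
    have := mul_le_mul_of_nonneg_left h6 (show 0 ≤ 7 * r ^ 2 by positivity)
    norm_num
    nlinarith
  · have h6 : r ^ 2 * (q * d ^ 2) ≤ 2 * (q ^ 3 * d ^ 2 + q * d ^ 4) := by
      have : r ^ 2 * (q * d ^ 2) ≤ (q + d) ^ 2 * (q * d ^ 2) := by gcongr
      have h7 : (q + d) ^ 2 * (q * d ^ 2) ≤ (2 * (q ^ 2 + d ^ 2)) * (q * d ^ 2) := by
        gcongr
        nlinarith [sq_nonneg (q - d)]
      nlinarith
    have := mul_le_mul_of_nonneg_left h6 (show 0 ≤ 7 * r ^ 3 by positivity)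
    norm_num
    nlinarith

/-- The commutator bound for the truncated Sobolev weight. -/
lemma abs_truncWeight_sub_mul_cross_le {k : ℕ} (hk : k ≤ 1) {N : ℝ} (hN : 0 < N)
    (ξ η : Fin 2 → ℤ) :
    |truncWeight (k + 2) N ξ - truncWeight (k + 2) N η| * |cross ξ η| ≤
      14 * (bracket ξ ^ (k + 2) * bracket η ^ (k + 2) * bracket (ξ - η) ^ 2 +
        bracket ξ ^ (k + 2) * bracket η ^ k * bracket (ξ - η) ^ 4 +
        bracket ξ ^ k * bracket η ^ (k + 2) * bracket (ξ - η) ^ 4) := by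
  have hq := bracket_pos η
  have hd := bracket_pos (ξ - η)
  have hr := bracket_pos ξ
  rcases le_total (bracket η) (bracket ξ) with h | h
  · refine (abs_truncWeight_sub_mul_cross_le_aux hk hN h).trans ?_
    have : 0 ≤ bracket ξ ^ k * bracket η ^ (k + 2) * bracket (ξ - η) ^ 4 := by positivity
    linarith
  · have h1 := abs_truncWeight_sub_mul_cross_le_aux hk hN h
    rw [cross_swap, abs_neg, abs_sub_comm, bracket_sub_comm] at h1
    refine h1.trans ?_
    have : 0 ≤ bracket ξ ^ (k + 2) * bracket η ^ k * bracket (ξ - η) ^ 4 := by positivity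
    nlinarith

/-- At order zero only the cutoff varies, with slope `1/N`. The right side is deliberately wasteful:
the order-two norm of the vorticity is finite and the prefactor tends to zero. -/
lemma abs_truncWeight_zero_sub_mul_cross_le {N : ℝ} (hN : 0 < N) (ξ η : Fin 2 → ℤ) :
    |truncWeight 0 N ξ - truncWeight 0 N η| * |cross ξ η| ≤
      N⁻¹ * (bracket ξ ^ 2 * bracket η ^ 2 * bracket (ξ - η) ^ 2) := by
  have hq := one_le_bracket η
  have hd := bracket_pos (ξ - η)
  have hr := one_le_bracket ξ
  have h1 := abs_cross_le_right ξ η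
  have h2 := (abs_cutoff_sub_le hN (bracket ξ) (bracket η)).trans
    (div_le_div_of_nonneg_right (abs_bracket_sub_le ξ η) hN.le)
  simp only [truncWeight, mul_zero, pow_zero, one_mul]
  refine (mul_le_mul h2 h1 (abs_nonneg _) (by positivity)).trans ?_
  have h3 : bracket η ≤ bracket ξ ^ 2 * bracket η ^ 2 :=
    (le_self_pow₀ hq two_ne_zero).trans (le_mul_of_one_le_left (by positivity) (one_le_pow₀ hr))
  calc bracket (ξ - η) / N * (bracket (ξ - η) * bracket η)
      = N⁻¹ * (bracket η * bracket (ξ - η) ^ 2) := by ring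
    _ ≤ _ := by gcongr

/-- The bracket as an extended nonnegative number. -/
def wt (ξ : Fin 2 → ℤ) : ℝ≥0∞ := ENNReal.ofReal (bracket ξ)

lemma one_le_wt (ξ : Fin 2 → ℤ) : 1 ≤ wt ξ := by
  rw [wt, ENNReal.one_le_ofReal]; exact one_le_bracket ξ

lemma wt_ne_zero (ξ : Fin 2 → ℤ) : wt ξ ≠ 0 := (one_pos.trans_le (one_le_wt ξ)).ne'

lemma wt_ne_top (ξ : Fin 2 → ℤ) : wt ξ ≠ ⊤ := ENNReal.ofReal_ne_top

lemma wt_le_add (ξ η : Fin 2 → ℤ) : wt ξ ≤ wt (ξ - η) + wt η := by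
  rw [wt, wt, wt, ← ENNReal.ofReal_add (bracket_pos _).le (bracket_pos _).le]
  exact ENNReal.ofReal_le_ofReal (by linarith [bracket_le_add ξ η])

lemma ofReal_bracket_pow (ξ : Fin 2 → ℤ) (n : ℕ) :
    ENNReal.ofReal (bracket ξ ^ n) = wt ξ ^ n := ENNReal.ofReal_pow (bracket_pos ξ).le n

lemma summable_int_inv_one_add_sq : Summable fun n : ℤ => (1 + (n : ℝ) ^ 2)⁻¹ := by
  refine Summable.of_norm_bounded_eventually (g := fun n : ℤ => 1 / (n : ℝ) ^ 2)
    (Real.summable_one_div_int_pow.2 one_lt_two) ?_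
  filter_upwards [(finite_singleton (0 : ℤ)).compl_mem_cofinite] with n hn
  have hn' : (n : ℝ) ≠ 0 := by exact_mod_cast hn
  rw [Real.norm_of_nonneg (by positivity), one_div]
  gcongr
  linarith

/-- The embedding constant of `ℓ²` with weight `⟨ξ⟩²` into `ℓ¹`. -/
def embConst : ℝ≥0∞ := ellTwo fun ξ => (wt ξ ^ 2)⁻¹

/-- In two dimensions `⟨ξ⟩⁻⁴` is summable, since `(1 + |ξ|²)² ≥ (1 + ξ₀²)(1 + ξ₁²)` separates the
variables. -/
lemma embConst_ne_top : embConst ≠ ⊤ := by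
  refine ENNReal.rpow_ne_top_of_nonneg (by norm_num) ?_
  have h : ∀ ξ : Fin 2 → ℤ, ((wt ξ ^ 2)⁻¹) ^ 2 ≤
      ENNReal.ofReal ((1 + (ξ 0 : ℝ) ^ 2)⁻¹) * ENNReal.ofReal ((1 + (ξ 1 : ℝ) ^ 2)⁻¹) := by
    intro ξ
    rw [← ofReal_bracket_pow, ← ENNReal.ofReal_inv_of_pos (by have := bracket_pos ξ; positivity),
      ← ENNReal.ofReal_pow (by have := bracket_pos ξ; positivity),
      ← ENNReal.ofReal_mul (by positivity), bracket_sq]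
    refine ENNReal.ofReal_le_ofReal ?_
    rw [inv_pow, ← mul_inv]
    gcongr
    nlinarith [sq_nonneg (ξ 0 : ℝ), sq_nonneg (ξ 1 : ℝ)]
  refine ne_top_of_le_ne_top ?_ (ENNReal.tsum_le_tsum h)
  rw [← (finTwoArrowEquiv ℤ).symm.tsum_eq, ENNReal.tsum_prod']
  simp only [finTwoArrowEquiv_symm_apply, Matrix.cons_val_zero, Matrix.cons_val_one]
  simp only [ENNReal.tsum_mul_left, ENNReal.tsum_mul_right]
  have := summable_int_inv_one_add_sq.tsum_ofReal_ne_top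
  exact ENNReal.mul_ne_top this this

lemma tsum_le_embConst_mul (f : (Fin 2 → ℤ) → ℝ≥0∞) :
    ∑' ξ, f ξ ≤ embConst * ellTwo fun ξ => wt ξ ^ 2 * f ξ := by
  refine le_trans (le_of_eq (tsum_congr fun ξ => ?_)) (tsum_mul_le_ellTwo _ _)
  rw [← mul_assoc, ENNReal.inv_mul_cancel (pow_ne_zero _ (wt_ne_zero ξ))
    (ENNReal.pow_ne_top (wt_ne_top ξ)), one_mul]

lemma ellTwo_wt_mono {m n : ℕ} (h : m ≤ n) (f : (Fin 2 → ℤ) → ℝ≥0∞) :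
    (ellTwo fun ξ => wt ξ ^ m * f ξ) ≤ ellTwo fun ξ => wt ξ ^ n * f ξ :=
  ellTwo_mono fun ξ => by
    gcongr
    exact one_le_wt ξ

lemma tsum_wt_pow_mul_le (k : ℕ) (f : (Fin 2 → ℤ) → ℝ≥0∞) :
    ∑' ξ, wt ξ ^ k * f ξ ≤ embConst * ellTwo fun ξ => wt ξ ^ (k + 2) * f ξ := by
  refine (tsum_le_embConst_mul _).trans_eq ?_
  congr 2
  funext ξ
  ring

/-- The trilinear commutator estimate in the spaces of order `k + 2`, `k ≤ 1`. -/
lemma tsum_commutator_le {k : ℕ} (hk : k ≤ 1) {N : ℝ} (hN : 0 < N) (P V : (Fin 2 → ℤ) → ℝ≥0∞) :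
    ∑' ξ, ∑' η, ENNReal.ofReal
        (|truncWeight (k + 2) N ξ - truncWeight (k + 2) N η| * |cross ξ η|) *
          (V ξ * (P (ξ - η) * V η)) ≤
      42 * embConst * (ellTwo fun ξ => wt ξ ^ 4 * P ξ) *
        (ellTwo fun ξ => wt ξ ^ (k + 2) * V ξ) ^ 2 := by
  set A := ellTwo fun ξ => wt ξ ^ 4 * P ξ with hA
  set E := ellTwo fun ξ => wt ξ ^ (k + 2) * V ξ with hE
  -- In each term of the pointwise commutator bound one factor lacks two weights. That factor is put
  -- in `ℓ¹`, at the price of `embConst`. Three terms with constant 14 make 42.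
  have h1 := tsum_trilinear_mid (fun ξ => wt ξ ^ (k + 2) * V ξ) (fun ξ => wt ξ ^ 2 * P ξ)
    (fun ξ => wt ξ ^ (k + 2) * V ξ)
  have h2 := tsum_trilinear_right (fun ξ => wt ξ ^ (k + 2) * V ξ) (fun ξ => wt ξ ^ 4 * P ξ)
    (fun ξ => wt ξ ^ k * V ξ)
  have h3 := tsum_trilinear_left (fun ξ => wt ξ ^ k * V ξ) (fun ξ => wt ξ ^ 4 * P ξ)
    (fun ξ => wt ξ ^ (k + 2) * V ξ)
  have hP : ∑' ξ, wt ξ ^ 2 * P ξ ≤ embConst * A := tsum_wt_pow_mul_le 2 P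
  have hV : ∑' ξ, wt ξ ^ k * V ξ ≤ embConst * E := tsum_wt_pow_mul_le k V
  calc _ ≤ ∑' ξ, ∑' η, (14 * (wt ξ ^ (k + 2) * V ξ * (wt (ξ - η) ^ 2 * P (ξ - η) *
          (wt η ^ (k + 2) * V η))) +
        14 * (wt ξ ^ (k + 2) * V ξ * (wt (ξ - η) ^ 4 * P (ξ - η) * (wt η ^ k * V η))) +
        14 * (wt ξ ^ k * V ξ * (wt (ξ - η) ^ 4 * P (ξ - η) * (wt η ^ (k + 2) * V η)))) := by
        refine ENNReal.tsum_le_tsum fun ξ => ENNReal.tsum_le_tsum fun η => ?_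
        have h := ENNReal.ofReal_le_ofReal (abs_truncWeight_sub_mul_cross_le hk hN ξ η)
        have p1 := bracket_pos ξ
        have p2 := bracket_pos η
        have p3 := bracket_pos (ξ - η)
        rw [ENNReal.ofReal_mul (p := 14) (by norm_num), ENNReal.ofReal_add (by positivity) (by positivity),
          ENNReal.ofReal_add (by positivity) (by positivity),
          ENNReal.ofReal_mul (by positivity), ENNReal.ofReal_mul (by positivity),
          ENNReal.ofReal_mul (by positivity), ENNReal.ofReal_mul (by positivity),
          ENNReal.ofReal_mul (by positivity), ENNReal.ofReal_mul (by positivity)] at h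
        rw [← ENNReal.ofReal_mul (abs_nonneg _),
          ENNReal.ofReal_mul (p := bracket ξ ^ k) (by positivity)] at h
        simp only [ofReal_bracket_pow, ENNReal.ofReal_ofNat] at h
        refine (mul_le_mul_left h _).trans_eq ?_
        ring
    _ = 14 * (∑' ξ, ∑' η, wt ξ ^ (k + 2) * V ξ * (wt (ξ - η) ^ 2 * P (ξ - η) *
          (wt η ^ (k + 2) * V η))) +
        14 * (∑' ξ, ∑' η, wt ξ ^ (k + 2) * V ξ * (wt (ξ - η) ^ 4 * P (ξ - η) *
          (wt η ^ k * V η))) +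
        14 * (∑' ξ, ∑' η, wt ξ ^ k * V ξ * (wt (ξ - η) ^ 4 * P (ξ - η) *
          (wt η ^ (k + 2) * V η))) := by
        simp only [ENNReal.tsum_add, ENNReal.tsum_mul_left]
    _ ≤ 14 * (E * (embConst * A) * E) + 14 * (E * A * (embConst * E)) +
          14 * (embConst * E * A * E) := by
        gcongr
        · exact h1.trans (by gcongr)
        · exact h2.trans (by gcongr)
        · exact h3.trans (by gcongr)
    _ = _ := by ring

/-- The trilinear commutator estimate at order zero. -/
lemma tsum_commutator_zero_le {N : ℝ} (hN : 0 < N) (P V : (Fin 2 → ℤ) → ℝ≥0∞) :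
    ∑' ξ, ∑' η, ENNReal.ofReal (|truncWeight 0 N ξ - truncWeight 0 N η| * |cross ξ η|) *
          (V ξ * (P (ξ - η) * V η)) ≤
      ENNReal.ofReal N⁻¹ * (embConst * (ellTwo fun ξ => wt ξ ^ 4 * P ξ) *
        (ellTwo fun ξ => wt ξ ^ 2 * V ξ) ^ 2) := by
  have h1 := tsum_trilinear_mid (fun ξ => wt ξ ^ 2 * V ξ) (fun ξ => wt ξ ^ 2 * P ξ)
    (fun ξ => wt ξ ^ 2 * V ξ)
  have hP := tsum_wt_pow_mul_le 2 P
  calc _ ≤ ∑' ξ, ∑' η, (ENNReal.ofReal N⁻¹ * (wt ξ ^ 2 * V ξ * (wt (ξ - η) ^ 2 * P (ξ - η) *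
          (wt η ^ 2 * V η)))) := by
        refine ENNReal.tsum_le_tsum fun ξ => ENNReal.tsum_le_tsum fun η => ?_
        have h := ENNReal.ofReal_le_ofReal (abs_truncWeight_zero_sub_mul_cross_le hN ξ η)
        have p1 := bracket_pos ξ
        have p2 := bracket_pos η
        have p3 := bracket_pos (ξ - η)
        rw [ENNReal.ofReal_mul (p := N⁻¹) (by positivity),
          ENNReal.ofReal_mul (p := bracket ξ ^ 2 * bracket η ^ 2) (by positivity),
          ENNReal.ofReal_mul (p := bracket ξ ^ 2) (by positivity)] at h
        simp only [ofReal_bracket_pow] at h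
        refine (mul_le_mul_left h _).trans_eq ?_
        ring
    _ = ENNReal.ofReal N⁻¹ * (∑' ξ, ∑' η, wt ξ ^ 2 * V ξ * (wt (ξ - η) ^ 2 * P (ξ - η) *
          (wt η ^ 2 * V η))) := by
        simp only [ENNReal.tsum_mul_left]
    _ ≤ _ := by
        gcongr
        refine h1.trans ?_
        calc _ ≤ (ellTwo fun ξ => wt ξ ^ 2 * V ξ) *
              (embConst * ellTwo fun ξ => wt ξ ^ (2 + 2) * P ξ) *
              ellTwo fun ξ => wt ξ ^ 2 * V ξ := by gcongr
          _ = _ := by ring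

/-- The estimate for a source term in divergence form. -/
lemma tsum_source_le (Q R V : (Fin 2 → ℤ) → ℝ≥0∞) :
    ∑' ξ, ∑' η, wt ξ ^ 2 * V ξ * (wt ξ ^ 3 * (Q (ξ - η) * R η)) ≤
      8 * embConst * (ellTwo fun ξ => wt ξ ^ 2 * V ξ) * (ellTwo fun ξ => wt ξ ^ 3 * Q ξ) *
        (ellTwo fun ξ => wt ξ ^ 3 * R ξ) := by
  have h1 := tsum_trilinear_mid (fun ξ => wt ξ ^ 2 * V ξ) Q (fun ξ => wt ξ ^ 3 * R ξ)
  have h2 := tsum_trilinear_right (fun ξ => wt ξ ^ 2 * V ξ) (fun ξ => wt ξ ^ 3 * Q ξ) R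
  have hQ : ∑' ξ, Q ξ ≤ embConst * ellTwo fun ξ => wt ξ ^ 3 * Q ξ :=
    (tsum_le_embConst_mul Q).trans (by gcongr; exact ellTwo_wt_mono (by norm_num) Q)
  have hR : ∑' ξ, R ξ ≤ embConst * ellTwo fun ξ => wt ξ ^ 3 * R ξ :=
    (tsum_le_embConst_mul R).trans (by gcongr; exact ellTwo_wt_mono (by norm_num) R)
  -- Convexity of the cube lets the three weights fall entirely on one of the two factors, as in the
  -- proof that `W^{3,2}` is an algebra.
  have hcube : ∀ a b : ℝ≥0∞, (a + b) ^ 3 ≤ 4 * (a ^ 3 + b ^ 3) := by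
    intro a b
    have := ENNReal.rpow_add_le_mul_rpow_add_rpow a b (p := 3) (by norm_num)
    norm_num at this
    exact this
  calc _ ≤ ∑' ξ, ∑' η, (4 * (wt ξ ^ 2 * V ξ * (Q (ξ - η) * (wt η ^ 3 * R η))) +
        4 * (wt ξ ^ 2 * V ξ * (wt (ξ - η) ^ 3 * Q (ξ - η) * R η))) := by
        refine ENNReal.tsum_le_tsum fun ξ => ENNReal.tsum_le_tsum fun η => ?_
        calc _ ≤ wt ξ ^ 2 * V ξ * (4 * (wt (ξ - η) ^ 3 + wt η ^ 3) * (Q (ξ - η) * R η)) := by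
              gcongr
              exact (pow_le_pow_left' (wt_le_add ξ η) 3).trans (hcube _ _)
          _ = _ := by ring
    _ = 4 * (∑' ξ, ∑' η, wt ξ ^ 2 * V ξ * (Q (ξ - η) * (wt η ^ 3 * R η))) +
        4 * (∑' ξ, ∑' η, wt ξ ^ 2 * V ξ * (wt (ξ - η) ^ 3 * Q (ξ - η) * R η)) := by
        simp only [ENNReal.tsum_add, ENNReal.tsum_mul_left]
    _ ≤ 4 * ((ellTwo fun ξ => wt ξ ^ 2 * V ξ) * (embConst * ellTwo fun ξ => wt ξ ^ 3 * Q ξ) *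
          (ellTwo fun ξ => wt ξ ^ 3 * R ξ)) +
        4 * ((ellTwo fun ξ => wt ξ ^ 2 * V ξ) * (ellTwo fun ξ => wt ξ ^ 3 * Q ξ) *
          (embConst * ellTwo fun ξ => wt ξ ^ 3 * R ξ)) := by
        gcongr
        · exact h1.trans (by gcongr)
        · exact h2.trans (by gcongr)
    _ = _ := by ring

end Weights

/-! ### Weak derivatives, divergences and stream functions on the Fourier side -/

lemma integral_mul_wave_neg {v : Torus L → ℝ} (hv : Integrable v) (c : ℂ) (ξ : Fin 2 → ℤ) :
    ∫ x, v x * wave c (-ξ) x = (c * (((L ^ 2 : ℝ) : ℂ) * fourierCoeff₂ v ξ)).re := by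
  have hL : ((L ^ 2 : ℝ) : ℂ) ≠ 0 := by
    exact_mod_cast (pow_pos (period_pos (L := L)) 2).ne'
  rw [integral_mul_wave hv, fourierCoeff₂_eq_coeffC, coeffC, mul_inv_cancel_left₀ hL]

lemma fourierCoeff₂_add {f g : Torus L → ℝ} (hf : Integrable f) (hg : Integrable g)
    (ξ : Fin 2 → ℤ) :
    fourierCoeff₂ (fun x => f x + g x) ξ = fourierCoeff₂ f ξ + fourierCoeff₂ g ξ := by
  simp only [fourierCoeff₂_eq_coeffC, coeffC, ← mul_add, Complex.ofReal_add]
  rw [← integral_add (f := fun x => character (-ξ) x * (f x : ℂ))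
    (g := fun x => character (-ξ) x * (g x : ℂ)) (integrable_character_mul hf.ofReal _)
    (integrable_character_mul hg.ofReal _)]
  simp only [mul_add]

lemma fourierCoeff₂_ext_of_wave {w : Torus L → ℝ} {z : ℂ} (hw : Integrable w) {ξ : Fin 2 → ℤ}
    (h : ∀ c, ∫ x, w x * wave c (-ξ) x = (c * (((L ^ 2 : ℝ) : ℂ) * z)).re) :
    fourierCoeff₂ w ξ = z := by
  have hL : ((L ^ 2 : ℝ) : ℂ) ≠ 0 := by
    exact_mod_cast (pow_pos (period_pos (L := L)) 2).ne'
  refine mul_left_cancel₀ hL (complex_eq_of_re_mul fun c => ?_)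
  rw [← integral_mul_wave_neg hw, h]

lemma IsWeakDeriv.fourierCoeff₂_eq {j : Fin 2} {v w : Torus L → ℝ} (h : IsWeakDeriv j v w)
    (ξ : Fin 2 → ℤ) : fourierCoeff₂ w ξ = freq L (ξ j) * fourierCoeff₂ v ξ := by
  obtain ⟨hv, hw, h⟩ := h
  refine fourierCoeff₂_ext_of_wave hw fun c => ?_
  have h1 := h _ (isSmooth_wave c (-ξ))
  rw [partialDeriv_wave, integral_mul_wave_neg hv] at h1
  rw [← neg_inj, ← h1, ← Complex.neg_re, Pi.neg_apply, freq_neg]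
  congr 1; ring

lemma IsWeakDiv.fourierCoeff₂_eq {V : Fin 2 → Torus L → ℝ} {w : Torus L → ℝ} (h : IsWeakDiv V w)
    (ξ : Fin 2 → ℤ) : fourierCoeff₂ w ξ = ∑ j, freq L (ξ j) * fourierCoeff₂ (V j) ξ := by
  obtain ⟨hV, hw, h⟩ := h
  refine fourierCoeff₂_ext_of_wave hw fun c => ?_
  have h1 := h _ (isSmooth_wave c (-ξ))
  simp only [partialDeriv_wave] at h1
  have hi : ∀ j (c : ℂ), Integrable fun x => V j x * wave c (-ξ) x := fun j c =>
    (hV j).mul_bdd (c := ‖c‖) (continuous_wave c (-ξ)).aestronglyMeasurable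
      (Eventually.of_forall fun x => (Complex.abs_re_le_norm _).trans
        (by rw [norm_mul, norm_character, mul_one]))
  rw [integral_finsetSum _ fun j _ => hi j _] at h1
  simp only [integral_mul_wave_neg (hV _)] at h1
  rw [← neg_inj, ← h1, ← Complex.neg_re, ← Complex.re_sum]
  congr 1
  simp only [Pi.neg_apply, freq_neg, Fin.sum_univ_two]
  ring

lemma lapSymbol_nonneg (ξ : Fin 2 → ℤ) : 0 ≤ lapSymbol L ξ := by
  unfold lapSymbol; positivity

lemma lapSymbol_neg (ξ : Fin 2 → ℤ) : lapSymbol L (-ξ) = lapSymbol L ξ := by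
  simp [lapSymbol]

lemma IsStreamFunction.fourierCoeff₂_eq {α : ℝ} {w ψ : Torus L → ℝ} (h : IsStreamFunction α w ψ)
    (hw : Integrable w) (hψ : Integrable ψ) (ξ : Fin 2 → ℤ) :
    fourierCoeff₂ w ξ =
      -(((1 + lapSymbol L ξ) * (1 + α * lapSymbol L ξ) : ℝ) : ℂ) * fourierCoeff₂ ψ ξ := by
  refine fourierCoeff₂_ext_of_wave hw fun c => ?_
  rw [← h _ (isSmooth_wave c (-ξ))]
  have h1 : (fun y : Torus L => wave c (-ξ) y - α * laplacian (wave c (-ξ)) y) =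
      wave ((1 + α * lapSymbol L ξ : ℝ) * c) (-ξ) := by
    funext y
    rw [laplacian_wave, wave_re_mul, lapSymbol_neg]; ring
  have h2 : ∀ x, laplacian (fun y : Torus L => wave c (-ξ) y - α * laplacian (wave c (-ξ)) y) x -
      (wave c (-ξ) x - α * laplacian (wave c (-ξ)) x) =
      wave ((-((1 + lapSymbol L ξ) * (1 + α * lapSymbol L ξ)) : ℝ) * c) (-ξ) x := by
    intro x
    rw [h1, laplacian_wave, laplacian_wave, wave_re_mul, wave_re_mul, lapSymbol_neg]
    ring
  simp only [h2]
  rw [integral_mul_wave_neg hψ]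
  congr 1
  push_cast
  ring

lemma memLp_of_continuous {φ : Torus L → ℝ} (h : Continuous φ) : MemLp φ 2 volume :=
  h.memLp_of_hasCompactSupport (HasCompactSupport.of_compactSpace φ)

lemma IsSmooth.isWeakDeriv {φ : Torus L → ℝ} (h : IsSmooth φ) (j : Fin 2) :
    IsWeakDeriv j φ (partialDeriv j φ) :=
  ⟨integrable_of_continuous h.continuous, integrable_of_continuous (h.continuous_partialDeriv j),
    fun _ hχ => h.integral_mul_partialDeriv hχ j⟩

/-- Functions in `W^{1,2}` have weak partial derivatives. -/
lemma exists_isWeakDeriv {v : Torus L → ℝ} (hv : MemLp v 2) (j : Fin 2)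
    (hs : Summable fun ξ : Fin 2 → ℤ => ‖freq L (ξ j) * fourierCoeff₂ v ξ‖ ^ 2) :
    ∃ w, IsWeakDeriv j v w := by
  obtain ⟨w, hw, hwc⟩ := exists_fourierCoeff₂_eq (L := L) hs fun ξ => by
    rw [map_mul, conj_freq, conj_fourierCoeff₂, Pi.neg_apply, freq_neg]
  refine ⟨w, integrable_of_memLp hv, integrable_of_memLp hw, fun φ hφ => ?_⟩
  have h1 := hasSum_conj_fourierCoeff₂_mul hv (memLp_of_continuous (hφ.continuous_partialDeriv j))
  have h2 := hasSum_conj_fourierCoeff₂_mul hw (memLp_of_continuous hφ.continuous)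
  -- Parseval on both sides: moving the symbol across the conjugate changes its sign because `freq`
  -- is purely imaginary.
  have h3 := h1.unique (h2.neg.congr_fun fun ξ => by
    rw [(hφ.isWeakDeriv j).fourierCoeff₂_eq, hwc, map_mul, conj_freq]; ring)
  have hL : (L ^ 2)⁻¹ ≠ 0 := inv_ne_zero (pow_pos (period_pos (L := L)) 2).ne'
  have h4 : (L ^ 2)⁻¹ * ∫ x : Torus L, v x * partialDeriv j φ x =
      (L ^ 2)⁻¹ * (-∫ x : Torus L, w x * φ x) := by
    have h5 : (((L ^ 2)⁻¹ * ∫ x : Torus L, v x * partialDeriv j φ x : ℝ) : ℂ) =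
        ((-((L ^ 2)⁻¹ * ∫ x : Torus L, w x * φ x) : ℝ) : ℂ) := by
      rw [h3]; push_cast; rfl
    rw [mul_neg]
    exact_mod_cast h5
  exact mul_left_cancel₀ hL h4

lemma sobolevNorm_eq_ellTwo (s : ℕ) (v : Torus L → ℝ) :
    sobolevNorm s v = ellTwo fun ξ => wt ξ ^ s * ‖fourierCoeff₂ v ξ‖ₑ := by
  unfold sobolevNorm ellTwo
  congr 1
  refine tsum_congr fun ξ => ?_
  rw [mul_pow, ← ofReal_bracket_pow, ← ENNReal.ofReal_pow (by have := bracket_pos ξ; positivity),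
    ← pow_mul, mul_comm s 2, pow_mul, bracket_sq]

lemma ellTwo_fourierCoeff₂ {v : Torus L → ℝ} (hv : MemLp v 2) :
    (ellTwo fun ξ => ‖fourierCoeff₂ v ξ‖ₑ) = (ENNReal.ofReal L)⁻¹ * eLpNorm v 2 volume := by
  have hL : 0 < L := period_pos
  rw [ellTwo, tsum_enorm_sq_fourierCoeff₂ hv, ENNReal.ofReal_pow hL.le, ENNReal.inv_pow,
    ← mul_pow, ← ENNReal.rpow_natCast, ← ENNReal.rpow_mul]
  norm_num

/-! ### Divergence-form terms controlled by the gradient -/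

/-- The Fourier coefficients of `div (b g)`. -/
def divCoeff (g : Fin 2 → Torus L → ℝ) (b : Torus L → ℝ) (ξ : Fin 2 → ℤ) : ℂ :=
  ∑ j, freq L (ξ j) * fourierCoeff₂ (fun x => g j x * b x) ξ

lemma enorm_freq_le (k : Fin 2 → ℤ) (j : Fin 2) :
    ‖freq L (k j)‖ₑ ≤ ENNReal.ofReal (2 * Real.pi / L) * wt k := by
  have hL : 0 < L := period_pos
  have := Real.pi_pos
  rw [← ofReal_norm, norm_freq, wt, ← ENNReal.ofReal_mul (by positivity)]
  refine ENNReal.ofReal_le_ofReal ?_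
  have := abs_le_bracket k j
  gcongr

lemma summable_sq_of_sobolevNorm_lt_top {v : Torus L → ℝ} (h : sobolevNorm 1 v < ⊤) (j : Fin 2) :
    Summable fun ξ : Fin 2 → ℤ => ‖freq L (ξ j) * fourierCoeff₂ v ξ‖ ^ 2 := by
  rw [sobolevNorm_eq_ellTwo] at h
  have h1 : ∑' ξ : Fin 2 → ℤ, ‖freq L (ξ j) * fourierCoeff₂ v ξ‖ₑ ^ 2 ≠ ⊤ := by
    rw [← ellTwo_sq]
    refine ENNReal.pow_ne_top (ne_top_of_le_ne_top
      (ENNReal.mul_ne_top (ENNReal.ofReal_ne_top (r := 2 * Real.pi / L)) h.ne) ?_)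
    rw [← ellTwo_const_mul]
    refine ellTwo_mono fun ξ => ?_
    rw [enorm_mul, ← mul_assoc, pow_one]
    gcongr
    exact enorm_freq_le ξ j
  refine (ENNReal.summable_toReal h1).congr fun ξ => ?_
  rw [ENNReal.toReal_pow, toReal_enorm]

lemma isWeakDeriv_weakDeriv {v : Torus L → ℝ} (hv : MemLp v 2) (h : sobolevNorm 1 v < ⊤)
    (j : Fin 2) : IsWeakDeriv j v (weakDeriv j v) := by
  have hex := exists_isWeakDeriv hv j (summable_sq_of_sobolevNorm_lt_top h j)
  rw [weakDeriv, dif_pos hex]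
  exact hex.choose_spec

lemma eLpNorm_weakDeriv_le (v : Torus L → ℝ) (j : Fin 2) :
    eLpNorm (weakDeriv j v) ⊤ volume ≤ gradSupNorm v := by
  refine eLpNorm_mono fun x => ?_
  have h := EuclideanSpace.norm_eq (!₂[weakDeriv 0 v x, weakDeriv 1 v x] : EuclideanSpace ℝ (Fin 2))
  rw [h]
  refine Real.le_sqrt_of_sq_le ?_
  fin_cases j <;> simp <;> positivity

lemma memLp_two_mul_of_top {f g : Torus L → ℝ} (hf : MemLp f 2) (hg : MemLp g ⊤) :
    MemLp (fun x => f x * g x) 2 := hg.mul hf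

lemma eLpNorm_mul_le_top {f : Torus L → ℝ} (hf : MemLp f 2) (g : Torus L → ℝ) :
    eLpNorm (fun x => f x * g x) 2 volume ≤ eLpNorm f 2 volume * eLpNorm g ⊤ volume := by
  have h := eLpNorm_le_eLpNorm_mul_eLpNorm_top 2 hf.1 g (fun a b => a * b) 1
    (Eventually.of_forall fun x => by rw [nnnorm_mul, one_mul])
  rwa [ENNReal.coe_one, one_mul] at h

/-- For a divergence-free field `g`, the `ℓ²` norm of the coefficients of `div (b g)` is controlled
by the `L²` norm of `g` and the supremum of `∇b`. -/
lemma ellTwo_divCoeff_le {g : Fin 2 → Torus L → ℝ} (hg : ∀ j, MemLp (g j) 2)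
    (hdiv : ∀ ξ : Fin 2 → ℤ, ∑ j, freq L (ξ j) * fourierCoeff₂ (g j) ξ = 0)
    {b : Torus L → ℝ} (hb : MemLp b 2) (hb1 : sobolevNorm 1 b < ⊤) (hgrad : gradSupNorm b < ⊤) :
    (ellTwo fun ξ => ‖divCoeff g b ξ‖ₑ) ≤
      (ENNReal.ofReal L)⁻¹ * ((eLpNorm (g 0) 2 volume + eLpNorm (g 1) 2 volume) *
        gradSupNorm b) := by
  have hd := fun j => isWeakDeriv_weakDeriv hb hb1 j
  have hdt : ∀ j, MemLp (weakDeriv j b) ⊤ := fun j =>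
    ⟨(hd j).2.1.1, (eLpNorm_weakDeriv_le b j).trans_lt hgrad⟩
  have hd2 : ∀ j, MemLp (weakDeriv j b) 2 := fun j => (hdt j).mono_exponent le_top
  have hm : ∀ j, MemLp (fun x => g j x * weakDeriv j b x) 2 := fun j =>
    memLp_two_mul_of_top (hg j) (hdt j)
  have hsum : ∀ ξ, HasSum (fun η => ∑ j, freq L (ξ j) * (fourierCoeff₂ (g j) (ξ - η) *
      fourierCoeff₂ b η)) (divCoeff g b ξ) := fun ξ =>
    hasSum_sum fun j _ => (hasSum_fourierCoeff₂_mul (hg j) hb ξ).mul_left _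
  have hsum' : ∀ ξ, HasSum (fun η => ∑ j, fourierCoeff₂ (g j) (ξ - η) *
      fourierCoeff₂ (weakDeriv j b) η)
      (∑ j, fourierCoeff₂ (fun x => g j x * weakDeriv j b x) ξ) := fun ξ =>
    hasSum_sum fun j _ => hasSum_fourierCoeff₂_mul (hg j) (hd2 j) ξ
  have hadd : ∀ ξ, fourierCoeff₂ (fun x => g 0 x * weakDeriv 0 b x + g 1 x * weakDeriv 1 b x) ξ =
      ∑ j, fourierCoeff₂ (fun x => g j x * weakDeriv j b x) ξ := by
    intro ξ
    rw [fourierCoeff₂_add (integrable_of_memLp (hm 0)) (integrable_of_memLp (hm 1)),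
      Fin.sum_univ_two]
  have heq : ∀ ξ, divCoeff g b ξ =
      fourierCoeff₂ (fun x => g 0 x * weakDeriv 0 b x + g 1 x * weakDeriv 1 b x) ξ := by
    intro ξ
    rw [hadd]
    refine (hsum ξ).unique ((hsum' ξ).congr_fun fun η => ?_)
    -- Splitting the frequency of `ξ` into those of `ξ - η` and `η`, the first part is the
    -- divergence of `g` and vanishes; the second is `g·∇b`.
    have h0 := hdiv (ξ - η)
    have hf : ∀ j, freq L (ξ j) = freq L ((ξ - η) j) + freq L (η j) := by
      intro j; simp only [freq, Pi.sub_apply]; push_cast; ring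
    simp only [Fin.sum_univ_two, (hd _).fourierCoeff₂_eq, hf] at h0 ⊢
    linear_combination fourierCoeff₂ b η * h0
  simp only [heq]
  rw [ellTwo_fourierCoeff₂ (v := fun x => g 0 x * weakDeriv 0 b x + g 1 x * weakDeriv 1 b x)
    ((hm 0).add (hm 1))]
  gcongr
  refine (eLpNorm_add_le (hm 0).1 (hm 1).1 (by norm_num)).trans ?_
  rw [add_mul]
  gcongr
  · exact (eLpNorm_mul_le_top (hg 0) _).trans (by gcongr; exact eLpNorm_weakDeriv_le b 0)
  · exact (eLpNorm_mul_le_top (hg 1) _).trans (by gcongr; exact eLpNorm_weakDeriv_le b 1)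

lemma fourierCoeff₂_const_mul (c : ℝ) (f : Torus L → ℝ) (ξ : Fin 2 → ℤ) :
    fourierCoeff₂ (fun x => c * f x) ξ = c * fourierCoeff₂ f ξ := by
  simp only [fourierCoeff₂_eq_coeffC, coeffC, Complex.ofReal_mul, mul_left_comm _ (c : ℂ)]
  rw [integral_const_mul]
  ring

lemma fourierCoeff₂_neg (f : Torus L → ℝ) (ξ : Fin 2 → ℤ) :
    fourierCoeff₂ (fun x => -f x) ξ = -fourierCoeff₂ f ξ := by
  simpa using fourierCoeff₂_const_mul (-1) f ξ

/-! ### Fourier coefficients as continuous maps on `L²` -/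

lemma integrable_L2 (v : L2 L) : Integrable v := integrable_of_memLp (Lp.memLp v)

lemma enorm_le_ellTwo {ι : Type*} (f : ι → ℝ≥0∞) (i : ι) : f i ≤ ellTwo f := by
  have h : f i ^ 2 ≤ ellTwo f ^ 2 := by
    rw [ellTwo_sq]
    exact ENNReal.le_tsum i
  exact (ENNReal.pow_le_pow_left_iff two_ne_zero).1 h

lemma ellTwo_fourierCoeff₂_L2 (v : L2 L) :
    (ellTwo fun ξ => ‖fourierCoeff₂ v ξ‖ₑ) = (ENNReal.ofReal L)⁻¹ * ‖v‖ₑ := by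
  rw [ellTwo_fourierCoeff₂ (Lp.memLp v), Lp.enorm_def]

lemma enorm_eq_mul_ellTwo (v : L2 L) :
    ‖v‖ₑ = ENNReal.ofReal L * ellTwo fun ξ => ‖fourierCoeff₂ v ξ‖ₑ := by
  rw [ellTwo_fourierCoeff₂_L2, ← mul_assoc, ENNReal.mul_inv_cancel, one_mul]
  · simpa using period_pos (L := L)
  · exact ENNReal.ofReal_ne_top

/-- The `ξ`-th Fourier coefficient as a continuous linear functional on `L²`. -/
def coeffCLM (L : ℝ) [Fact (0 < L)] (ξ : Fin 2 → ℤ) : L2 L →L[ℝ] ℂ :=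
  LinearMap.mkContinuous
    { toFun := fun v => fourierCoeff₂ v ξ
      map_add' := fun v w => by
        rw [fourierCoeff₂_congr (Lp.coeFn_add v w)]
        exact fourierCoeff₂_add (integrable_L2 v) (integrable_L2 w) ξ
      map_smul' := fun c v => by
        rw [fourierCoeff₂_congr (Lp.coeFn_smul c v)]
        exact fourierCoeff₂_const_mul c v ξ } L⁻¹ fun v => by
    have hL : 0 < L := period_pos
    have h := (enorm_le_ellTwo (fun ξ => ‖fourierCoeff₂ v ξ‖ₑ) ξ).trans_eq
      (ellTwo_fourierCoeff₂_L2 v)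
    rw [← ofReal_norm, ← ofReal_norm, ← ENNReal.ofReal_inv_of_pos hL,
      ← ENNReal.ofReal_mul (by positivity)] at h
    exact (ENNReal.ofReal_le_ofReal_iff (by positivity)).1 h

lemma coeffCLM_apply (v : L2 L) (ξ : Fin 2 → ℤ) : coeffCLM L ξ v = fourierCoeff₂ v ξ := rfl

lemma fourierCoeff₂_sub (v w : L2 L) (ξ : Fin 2 → ℤ) :
    fourierCoeff₂ (v - w : L2 L) ξ = fourierCoeff₂ v ξ - fourierCoeff₂ w ξ := by
  simp only [← coeffCLM_apply, map_sub]

lemma integrable_mul_L2 (v w : L2 L) : Integrable fun x => v x * w x :=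
  (Lp.memLp v).integrable_mul (Lp.memLp w)

/-- The Fourier coefficients of a product depend continuously on the factors. -/
lemma isBoundedBilinearMap_fourierCoeff₂_mul (ξ : Fin 2 → ℤ) :
    IsBoundedBilinearMap ℝ fun p : L2 L × L2 L => fourierCoeff₂ (fun x => p.1 x * p.2 x) ξ where
  add_left v v' w := by
    rw [← fourierCoeff₂_add (integrable_mul_L2 v w) (integrable_mul_L2 v' w)]
    refine fourierCoeff₂_congr ?_ ξ
    filter_upwards [Lp.coeFn_add v v'] with x hx
    rw [hx, Pi.add_apply, add_mul]
  smul_left c v w := by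
    rw [Complex.real_smul, ← fourierCoeff₂_const_mul]
    refine fourierCoeff₂_congr ?_ ξ
    filter_upwards [Lp.coeFn_smul c v] with x hx
    rw [hx, Pi.smul_apply, smul_eq_mul, mul_assoc]
  add_right v w w' := by
    rw [← fourierCoeff₂_add (integrable_mul_L2 v w) (integrable_mul_L2 v w')]
    refine fourierCoeff₂_congr ?_ ξ
    filter_upwards [Lp.coeFn_add w w'] with x hx
    rw [hx, Pi.add_apply, mul_add]
  smul_right c v w := by
    rw [Complex.real_smul, ← fourierCoeff₂_const_mul]
    refine fourierCoeff₂_congr ?_ ξ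
    filter_upwards [Lp.coeFn_smul c w] with x hx
    rw [hx, Pi.smul_apply, smul_eq_mul, mul_left_comm]
  bound := by
    have hL : 0 < L := period_pos
    refine ⟨L⁻¹ * L⁻¹, by positivity, fun v w => ?_⟩
    have h1 : ‖fourierCoeff₂ (fun x => v x * w x) ξ‖ₑ ≤
        ∑' η, ‖fourierCoeff₂ v (ξ - η)‖ₑ * ‖fourierCoeff₂ w η‖ₑ := by
      rw [← (hasSum_fourierCoeff₂_mul (Lp.memLp v) (Lp.memLp w) ξ).tsum_eq]
      refine enorm_tsum_le_tsum_enorm.trans_eq ?_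
      simp only [enorm_mul]
    have h2 := h1.trans (tsum_mul_le_ellTwo _ _)
    have e := ellTwo_comp_equiv (Equiv.subLeft ξ) (fun η => ‖fourierCoeff₂ v η‖ₑ)
    simp only [Equiv.subLeft_apply] at e
    rw [e, ellTwo_fourierCoeff₂_L2, ellTwo_fourierCoeff₂_L2, ← ofReal_norm, ← ofReal_norm,
      ← ofReal_norm, ← ENNReal.ofReal_inv_of_pos hL, ← ENNReal.ofReal_mul (by positivity),
      ← ENNReal.ofReal_mul (by positivity), ← ENNReal.ofReal_mul (by positivity)] at h2
    refine ((ENNReal.ofReal_le_ofReal_iff (by positivity)).1 h2).trans_eq ?_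
    ring

/-! ### Recovering the velocity from the vorticity -/

/-- The symbol of `(1 - Δ)(1 - αΔ)`. -/
def streamSymbol (L α : ℝ) (ξ : Fin 2 → ℤ) : ℝ := (1 + lapSymbol L ξ) * (1 + α * lapSymbol L ξ)

lemma streamSymbol_pos {α : ℝ} (hα : 0 < α) (ξ : Fin 2 → ℤ) : 0 < streamSymbol L α ξ := by
  have := lapSymbol_nonneg (L := L) ξ
  unfold streamSymbol; positivity

/-- The two factors `1 + κ|ξ|²` and `1 + ακ|ξ|²`, with `κ = (2π/L)²`, each dominate a multiple of
`⟨ξ⟩²`. Positivity of `α` is essential for the second. -/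
lemma exists_bracket_le_streamSymbol (L : ℝ) [Fact (0 < L)] {α : ℝ} (hα : 0 < α) :
    ∃ c : ℝ, 0 ≤ c ∧ ∀ ξ, bracket ξ ^ 4 * (streamSymbol L α ξ)⁻¹ ≤ c := by
  have hL : 0 < L := period_pos
  have hπ := Real.pi_pos
  have key : ∀ κ : ℝ, 0 < κ → ∀ x : ℝ, 0 ≤ x → 1 + x ≤ max 1 κ⁻¹ * (1 + κ * x) := by
    intro κ hκ x hx
    have h1 : 1 ≤ max 1 κ⁻¹ := le_max_left _ _
    have h2 : 1 ≤ max 1 κ⁻¹ * κ := by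
      rw [← inv_mul_cancel₀ hκ.ne']
      gcongr
      exact le_max_right _ _
    nlinarith
  set κ : ℝ := (2 * Real.pi / L) ^ 2 with hκdef
  have hκ : 0 < κ := by positivity
  refine ⟨max 1 κ⁻¹ * max 1 (α * κ)⁻¹, by positivity, fun ξ => ?_⟩
  rw [← div_eq_mul_inv, div_le_iff₀ (streamSymbol_pos hα ξ)]
  set x : ℝ := (ξ 0 : ℝ) ^ 2 + (ξ 1 : ℝ) ^ 2 with hx
  have hx0 : 0 ≤ x := by positivity
  have h1 := key κ hκ x hx0
  have h2 := key (α * κ) (by positivity) x hx0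
  calc bracket ξ ^ 4 = (1 + x) * (1 + x) := by
        rw [show bracket ξ ^ 4 = bracket ξ ^ 2 * bracket ξ ^ 2 by ring, bracket_sq]
    _ ≤ (max 1 κ⁻¹ * (1 + κ * x)) * (max 1 (α * κ)⁻¹ * (1 + α * κ * x)) := by gcongr
    _ = _ := by
        simp only [streamSymbol, lapSymbol, ← hκdef, ← hx]
        ring

/-- The Fourier coefficients of the solution `ψ` of `(Δ - 1)(1 - αΔ) ψ = w`. -/
def streamCoeff (α : ℝ) (w : Torus L → ℝ) (ξ : Fin 2 → ℤ) : ℂ :=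
  -((streamSymbol L α ξ : ℝ) : ℂ)⁻¹ * fourierCoeff₂ w ξ

lemma streamSymbol_neg (α : ℝ) (ξ : Fin 2 → ℤ) : streamSymbol L α (-ξ) = streamSymbol L α ξ := by
  simp only [streamSymbol, lapSymbol_neg]

lemma conj_streamCoeff (α : ℝ) (w : Torus L → ℝ) (ξ : Fin 2 → ℤ) :
    (starRingEnd ℂ) (streamCoeff α w ξ) = streamCoeff α w (-ξ) := by
  simp only [streamCoeff, map_mul, map_neg, map_inv₀, Complex.conj_ofReal, conj_fourierCoeff₂,
    streamSymbol_neg]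

/-- The elliptic gain of four derivatives. -/
lemma exists_wt_mul_streamCoeff_le (L : ℝ) [Fact (0 < L)] {α : ℝ} (hα : 0 < α) :
    ∃ C : ℝ≥0∞, C ≠ ⊤ ∧ ∀ (w : Torus L → ℝ) (ξ : Fin 2 → ℤ),
      wt ξ ^ 4 * ‖streamCoeff α w ξ‖ₑ ≤ C * ‖fourierCoeff₂ w ξ‖ₑ := by
  obtain ⟨c, hc, h⟩ := exists_bracket_le_streamSymbol L hα
  refine ⟨ENNReal.ofReal c, ENNReal.ofReal_ne_top, fun w ξ => ?_⟩
  have hs := streamSymbol_pos (L := L) hα ξ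
  rw [streamCoeff, enorm_mul, enorm_neg, ← mul_assoc]
  gcongr
  rw [← ofReal_norm, norm_inv, Complex.norm_real, Real.norm_of_nonneg hs.le, ← ofReal_bracket_pow,
    ← ENNReal.ofReal_mul (by have := bracket_pos ξ; positivity)]
  exact ENNReal.ofReal_le_ofReal (h ξ)

/-- The symbol never vanishes, so the stream function, and with it the velocity, is determined mode
by mode by `w`. -/
lemma IsVelocity.fourierCoeff₂_eq {α : ℝ} (hα : 0 < α) {w : L2 L} {u : Fin 2 → L2 L}
    (h : IsVelocity α w u) (ξ : Fin 2 → ℤ) :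
    fourierCoeff₂ (u 0) ξ = -freq L (ξ 1) * streamCoeff α w ξ ∧
      fourierCoeff₂ (u 1) ξ = freq L (ξ 0) * streamCoeff α w ξ := by
  obtain ⟨ψ, hψ, h1, h0⟩ := h
  have hs : ((streamSymbol L α ξ : ℝ) : ℂ) ≠ 0 := by
    exact_mod_cast (streamSymbol_pos (L := L) hα ξ).ne'
  have hp : streamCoeff α w ξ = fourierCoeff₂ ψ ξ := by
    rw [streamCoeff, hψ.fourierCoeff₂_eq (integrable_L2 w) (integrable_L2 ψ), ← streamSymbol]
    field_simp
  have e1 := h1.fourierCoeff₂_eq ξ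
  have e0 := h0.fourierCoeff₂_eq ξ
  rw [fourierCoeff₂_neg] at e1
  rw [hp]
  exact ⟨by rw [neg_mul, ← e1, neg_neg], e0⟩

lemma IsVelocity.div_eq_zero {α : ℝ} (hα : 0 < α) {w : L2 L} {u : Fin 2 → L2 L}
    (h : IsVelocity α w u) (ξ : Fin 2 → ℤ) : ∑ j, freq L (ξ j) * fourierCoeff₂ (u j) ξ = 0 := by
  rw [Fin.sum_univ_two, (h.fourierCoeff₂_eq hα ξ).1, (h.fourierCoeff₂_eq hα ξ).2]
  ring

lemma IsVelocity.enorm_fourierCoeff₂_le {α : ℝ} (hα : 0 < α) {w : L2 L} {u : Fin 2 → L2 L}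
    (h : IsVelocity α w u) (j : Fin 2) (ξ : Fin 2 → ℤ) :
    ‖fourierCoeff₂ (u j) ξ‖ₑ ≤
      ENNReal.ofReal (2 * Real.pi / L) * (wt ξ * ‖streamCoeff α w ξ‖ₑ) := by
  have hj : j = 0 ∨ j = 1 := by fin_cases j <;> simp
  rcases hj with rfl | rfl
  · rw [(h.fourierCoeff₂_eq hα ξ).1, enorm_mul, enorm_neg, ← mul_assoc]
    gcongr
    exact enorm_freq_le ξ 1
  · rw [(h.fourierCoeff₂_eq hα ξ).2, enorm_mul, ← mul_assoc]
    gcongr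
    exact enorm_freq_le ξ 0

lemma freq_mul_freq (k l : ℤ) :
    freq L k * freq L l = ((-(2 * Real.pi / L) ^ 2 * (k * l) : ℝ) : ℂ) := by
  simp only [freq_eq]
  push_cast
  linear_combination ((2 * Real.pi * k / L : ℂ) * (2 * Real.pi * l / L : ℂ)) * Complex.I_mul_I

/-- The convolution formula for the transport term `div (v u)` in terms of the stream function. -/
lemma IsVelocity.hasSum_divCoeff {α : ℝ} (hα : 0 < α) {w : L2 L} {u : Fin 2 → L2 L}
    (h : IsVelocity α w u) {v : Torus L → ℝ} (hv : MemLp v 2) (ξ : Fin 2 → ℤ) :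
    HasSum (fun η => ((-(2 * Real.pi / L) ^ 2 * cross ξ η : ℝ) : ℂ) *
        (streamCoeff α w (ξ - η) * fourierCoeff₂ v η))
      (divCoeff (fun j => u j) v ξ) := by
  have hsum : HasSum (fun η => ∑ j, freq L (ξ j) * (fourierCoeff₂ (u j) (ξ - η) *
      fourierCoeff₂ v η)) (divCoeff (fun j => u j) v ξ) :=
    hasSum_sum fun j _ => (hasSum_fourierCoeff₂_mul (Lp.memLp (u j)) hv ξ).mul_left _
  refine hsum.congr_fun fun η => ?_
  rw [Fin.sum_univ_two, (h.fourierCoeff₂_eq hα _).1, (h.fourierCoeff₂_eq hα _).2]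
  have e1 := freq_mul_freq (L := L) (ξ 0) ((ξ - η) 1)
  have e2 := freq_mul_freq (L := L) (ξ 1) ((ξ - η) 0)
  have e3 : ((-(2 * Real.pi / L) ^ 2 * cross ξ η : ℝ) : ℂ) =
      -((-(2 * Real.pi / L) ^ 2 * (ξ 0 * (ξ - η) 1 : ℝ) : ℝ) : ℂ) +
        ((-(2 * Real.pi / L) ^ 2 * (ξ 1 * (ξ - η) 0 : ℝ) : ℝ) : ℂ) := by
    simp only [cross, Pi.sub_apply]
    push_cast; ring
  rw [e3, ← e1, ← e2]
  ring

/-! ### Antisymmetry of the transport term -/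

section EnergyIdentity

variable {ι : Type*}

lemma summable_of_tsum_enorm_ne_top {E : Type*} [NormedAddCommGroup E] [CompleteSpace E]
    {f : ι → E} (h : ∑' i, ‖f i‖ₑ ≠ ⊤) : Summable f := by
  refine Summable.of_norm ((ENNReal.summable_toReal h).congr fun i => ?_)
  rw [toReal_enorm]

lemma tsum_enorm_ne_top {E : Type*} [NormedAddCommGroup E] {f : ι → E}
    (h : Summable fun i => ‖f i‖) : ∑' i, ‖f i‖ₑ ≠ ⊤ := by
  simp only [← ofReal_norm]
  exact h.tsum_ofReal_ne_top

/-- Symmetrization of a weighted double sum with antisymmetric kernel. -/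
lemma enorm_two_mul_sum_le {H : ι → ι → ℝ} (hH : ∀ i j, H j i = -H i j)
    (hs : ∀ i, Summable (H i)) {M : ι → ℝ} {F : Finset ι} (hM : ∀ i ∉ F, M i = 0) :
    ‖2 * ∑ i ∈ F, M i * ∑' j, H i j‖ₑ ≤ ∑' i, ∑' j, ‖(M i - M j) * H i j‖ₑ := by
  -- Only the rows indexed by `F` are nonzero, and each is absolutely summable. This is what
  -- legitimizes exchanging the two indices.
  have hsum : Summable fun p : ι × ι => M p.1 * H p.1 p.2 := by
    refine summable_of_tsum_enorm_ne_top ?_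
    rw [ENNReal.tsum_prod' (f := fun p : ι × ι => ‖M p.1 * H p.1 p.2‖ₑ),
      tsum_eq_sum (s := F) fun i hi => by simp [hM i hi]]
    refine ENNReal.sum_ne_top.2 fun i _ => tsum_enorm_ne_top ((hs i).mul_left (M i)).norm
  have hsum' : Summable fun p : ι × ι => M p.2 * H p.1 p.2 := by
    have := ((Equiv.prodComm ι ι).summable_iff.2 hsum).neg
    refine this.congr fun p => ?_
    simp [hH p.1 p.2]
  have h1 : ∑' p : ι × ι, M p.1 * H p.1 p.2 = ∑ i ∈ F, M i * ∑' j, H i j := by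
    rw [hsum.tsum_prod, tsum_eq_sum (s := F) fun i hi => by simp [hM i hi]]
    simp only [tsum_mul_left]
  have h2 : ∑' p : ι × ι, M p.2 * H p.1 p.2 = -∑' p : ι × ι, M p.1 * H p.1 p.2 := by
    rw [← (Equiv.prodComm ι ι).tsum_eq fun p : ι × ι => M p.1 * H p.1 p.2, ← tsum_neg]
    refine tsum_congr fun p => ?_
    simp [hH p.1 p.2]
  have h3 : 2 * ∑ i ∈ F, M i * ∑' j, H i j = ∑' p : ι × ι, (M p.1 - M p.2) * H p.1 p.2 := by
    simp only [sub_mul]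
    rw [hsum.tsum_sub hsum', h2, h1]
    ring
  rw [h3]
  exact enorm_tsum_le_tsum_enorm.trans_eq
    (ENNReal.tsum_prod' (f := fun p : ι × ι => ‖(M p.1 - M p.2) * H p.1 p.2‖ₑ))

/-- The contribution of an incompressible transport term to a weighted energy is controlled by
the commutator with the weight. -/
lemma enorm_transport_energy_le {κ : ℝ} {a p T : (Fin 2 → ℤ) → ℂ}
    (hp : ∀ ξ, (starRingEnd ℂ) (p ξ) = p (-ξ))
    (hT : ∀ ξ, HasSum (fun η => ((κ * cross ξ η : ℝ) : ℂ) * (p (ξ - η) * a η)) (T ξ))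
    {M : (Fin 2 → ℤ) → ℝ} {F : Finset (Fin 2 → ℤ)} (hM : ∀ ξ ∉ F, M ξ = 0) :
    ‖2 * ∑ ξ ∈ F, M ξ * ((starRingEnd ℂ) (a ξ) * T ξ).re‖ₑ ≤ ENNReal.ofReal |κ| *
      ∑' ξ, ∑' η, ENNReal.ofReal (|M ξ - M η| * |cross ξ η|) *
        (‖a ξ‖ₑ * (‖p (ξ - η)‖ₑ * ‖a η‖ₑ)) := by
  set H : (Fin 2 → ℤ) → (Fin 2 → ℤ) → ℝ := fun ξ η =>
    ((starRingEnd ℂ) (a ξ) * (((κ * cross ξ η : ℝ) : ℂ) * (p (ξ - η) * a η))).re with hHdef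
  have hsum : ∀ ξ, HasSum (H ξ) ((starRingEnd ℂ) (a ξ) * T ξ).re := fun ξ =>
    Complex.hasSum_re ((hT ξ).mul_left _)
  -- Conjugation exchanges `ξ` and `η` because `p` is Hermitian; the real part is unaffected and the
  -- cross product supplies the sign.
  have hH : ∀ ξ η, H η ξ = -H ξ η := by
    intro ξ η
    simp only [hHdef]
    rw [← Complex.conj_re, ← Complex.neg_re]
    congr 1
    simp only [map_mul, Complex.conj_conj, Complex.conj_ofReal, hp, neg_sub]
    rw [cross_swap ξ η]
    push_cast; ring
  have h := enorm_two_mul_sum_le hH (fun ξ => (hsum ξ).summable) hM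
  simp only [(hsum _).tsum_eq] at h
  refine h.trans ?_
  rw [← ENNReal.tsum_mul_left]
  refine ENNReal.tsum_le_tsum fun ξ => ?_
  rw [← ENNReal.tsum_mul_left]
  refine ENNReal.tsum_le_tsum fun η => ?_
  rw [enorm_mul]
  have h1 : ‖H ξ η‖ₑ ≤ ENNReal.ofReal |κ| * ENNReal.ofReal |cross ξ η| *
      (‖a ξ‖ₑ * (‖p (ξ - η)‖ₑ * ‖a η‖ₑ)) := by
    have h2 : ‖H ξ η‖ₑ ≤
        ‖(starRingEnd ℂ) (a ξ) * (((κ * cross ξ η : ℝ) : ℂ) * (p (ξ - η) * a η))‖ₑ := by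
      rw [← ofReal_norm, ← ofReal_norm]
      exact ENNReal.ofReal_le_ofReal (Complex.abs_re_le_norm _)
    refine h2.trans_eq ?_
    rw [enorm_mul, enorm_mul, enorm_mul, ← ofReal_norm ((κ * cross ξ η : ℝ) : ℂ),
      Complex.norm_real, Real.norm_eq_abs, abs_mul, ENNReal.ofReal_mul (abs_nonneg _),
      ← ofReal_norm ((starRingEnd ℂ) (a ξ)), RCLike.norm_conj, ofReal_norm]
    ring
  refine (mul_le_mul_right h1 _).trans_eq ?_
  rw [← ofReal_norm (M ξ - M η), Real.norm_eq_abs, ENNReal.ofReal_mul (abs_nonneg _)]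
  ring

end EnergyIdentity

/-! ### Truncated energies and Grönwall estimates -/

lemma finite_bracket_lt (N : ℝ) : {ξ : Fin 2 → ℤ | bracket ξ < N}.Finite := by
  refine (finite_Icc (fun _ => -⌈N⌉ : Fin 2 → ℤ) (fun _ => ⌈N⌉)).subset fun ξ hξ => ?_
  have h : ∀ j, |(ξ j : ℝ)| ≤ (⌈N⌉ : ℝ) := fun j =>
    (abs_le_bracket ξ j).trans ((le_of_lt hξ).trans (Int.le_ceil N))
  have h' : ∀ j, |ξ j| ≤ ⌈N⌉ := fun j => by exact_mod_cast h j
  exact ⟨fun j => (abs_le.1 (h' j)).1, fun j => (abs_le.1 (h' j)).2⟩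

/-- The frequencies with `⟨ξ⟩ < N`. -/
def lowFreq (N : ℝ) : Finset (Fin 2 → ℤ) := (finite_bracket_lt N).toFinset

lemma truncWeight_eq_zero {s : ℕ} {N : ℝ} (hN : 0 < N) (ξ : Fin 2 → ℤ) (h : ξ ∉ lowFreq N) :
    truncWeight s N ξ = 0 := by
  rw [truncWeight, cutoff_eq_zero hN, mul_zero]
  simpa [lowFreq] using h

lemma tendsto_truncWeight (s : ℕ) (ξ : Fin 2 → ℤ) :
    Tendsto (fun N => truncWeight s N ξ) atTop (𝓝 (bracket ξ ^ (2 * s))) := by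
  have h : Tendsto (fun N : ℝ => max 0 (1 - bracket ξ / N)) atTop (𝓝 (max 0 (1 - 0))) :=
    tendsto_const_nhds.max (tendsto_const_nhds.sub (tendsto_const_nhds.div_atTop tendsto_id))
  simpa [truncWeight, cutoff] using h.const_mul (bracket ξ ^ (2 * s))

/-- Extending integrands continuously to the whole line gives primitives that are differentiable
everywhere, with no one-sided derivatives at the end points. -/
lemma exists_continuous_extension {E : Type*} [TopologicalSpace E] {T : ℝ} (hT : 0 ≤ T)
    {f : ℝ → E} (hf : ContinuousOn f (Icc 0 T)) :
    ∃ g : ℝ → E, Continuous g ∧ EqOn g f (Icc 0 T) :=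
  ⟨IccExtend hT ((Icc 0 T).domRestrict f), (continuousOn_iff_continuous_domRestrict.1 hf).Icc_extend',
    fun t ht => by rw [IccExtend_of_mem hT _ ht]; rfl⟩

lemma integral_congr_of_eqOn {E : Type*} [NormedAddCommGroup E] [NormedSpace ℝ E] {T t : ℝ}
    {f g : ℝ → E} (h : EqOn f g (Icc 0 T)) (ht : t ∈ Icc 0 T) :
    ∫ τ in (0 : ℝ)..t, f τ = ∫ τ in (0 : ℝ)..t, g τ :=
  intervalIntegral.integral_congr fun τ hτ => by
    rw [uIcc_of_le ht.1] at hτ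
    exact h ⟨hτ.1, hτ.2.trans ht.2⟩

/-- Grönwall's inequality in integral form. -/
lemma gronwall_integral {T a : ℝ} {y k : ℝ → ℝ} (hy : ContinuousOn y (Icc 0 T))
    (hk : ContinuousOn k (Icc 0 T)) (hk0 : ∀ t ∈ Icc 0 T, 0 ≤ k t)
    (h : ∀ t ∈ Icc 0 T, y t ≤ a + ∫ τ in (0 : ℝ)..t, k τ * y τ) {t : ℝ} (ht : t ∈ Icc 0 T) :
    y t ≤ a * Real.exp (∫ τ in (0 : ℝ)..t, k τ) := by
  have hT : 0 ≤ T := ht.1.trans ht.2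
  obtain ⟨y', hy', hyy⟩ := exists_continuous_extension hT hy
  obtain ⟨k', hk', hkk⟩ := exists_continuous_extension hT hk
  set K : ℝ → ℝ := fun t => ∫ τ in (0 : ℝ)..t, k' τ with hK
  set Y : ℝ → ℝ := fun t => a + ∫ τ in (0 : ℝ)..t, k' τ * y' τ with hY
  have hKd : ∀ t, HasDerivAt K (k' t) t := fun t => hk'.integral_hasStrictDerivAt 0 t |>.hasDerivAt
  have hYd : ∀ t, HasDerivAt Y (k' t * y' t) t := fun t =>
    ((hk'.mul hy').integral_hasStrictDerivAt 0 t).hasDerivAt.const_add a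
  have hle : ∀ t ∈ Icc 0 T, y' t ≤ Y t := by
    intro t ht
    rw [hyy ht]
    refine (h t ht).trans_eq ?_
    simp only [hY]
    rw [integral_congr_of_eqOn (f := fun τ => k τ * y τ) (fun τ hτ => ?_) ht]
    simp only [hyy hτ, hkk hτ]
  have hDd : ∀ t, HasDerivAt (fun t => Y t * Real.exp (-K t))
      (k' t * y' t * Real.exp (-K t) + Y t * (Real.exp (-K t) * (-k' t))) t := fun t =>
    (hYd t).mul ((hKd t).neg.exp)
  -- The derivative is `k (y - Y) exp (-K)`, which is nonpositive since `y ≤ Y` and `k ≥ 0`.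
  have hanti : AntitoneOn (fun t => Y t * Real.exp (-K t)) (Icc 0 T) := by
    refine antitoneOn_of_deriv_nonpos (convex_Icc 0 T)
      (fun t _ => (hDd t).continuousAt.continuousWithinAt)
      (fun t _ => (hDd t).differentiableAt.differentiableWithinAt) fun t ht => ?_
    rw [interior_Icc] at ht
    have ht' : t ∈ Icc 0 T := ⟨ht.1.le, ht.2.le⟩
    rw [(hDd t).deriv]
    have h1 : 0 ≤ k' t := by rw [hkk ht']; exact hk0 t ht'
    have h2 := mul_le_mul_of_nonneg_left (hle t ht') h1
    nlinarith [Real.exp_pos (-K t)]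
  have hfin := hanti ⟨le_rfl, hT⟩ ht ht.1
  simp only [hK, hY, intervalIntegral.integral_same, add_zero, neg_zero, Real.exp_zero,
    mul_one] at hfin
  rw [integral_congr_of_eqOn hkk.symm ht]
  calc y t = y' t := (hyy ht).symm
    _ ≤ Y t := hle t ht
    _ = Y t * Real.exp (-K t) * Real.exp (K t) := by
        rw [mul_assoc, ← Real.exp_add, neg_add_cancel, Real.exp_zero, mul_one]
    _ ≤ a * Real.exp (K t) := by gcongr

/-- The integrated energy inequality for finitely many modes. -/
lemma weighted_energy_le {ι : Type*} {F : Finset ι} {M : ι → ℝ} {T : ℝ} {a R : ℝ → ι → ℂ}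
    (hR : ∀ ξ, ContinuousOn (fun t => R t ξ) (Icc 0 T))
    (ha : ∀ ξ, ∀ t ∈ Icc 0 T, a t ξ = a 0 ξ + ∫ τ in (0 : ℝ)..t, R τ ξ)
    {Φ : ℝ → ℝ} (hΦ : ContinuousOn Φ (Icc 0 T))
    (hle : ∀ t ∈ Icc 0 T, 2 * ∑ ξ ∈ F, M ξ * ((starRingEnd ℂ) (a t ξ) * R t ξ).re ≤ Φ t)
    {t : ℝ} (ht : t ∈ Icc 0 T) :
    ∑ ξ ∈ F, M ξ * ‖a t ξ‖ ^ 2 ≤ ∑ ξ ∈ F, M ξ * ‖a 0 ξ‖ ^ 2 + ∫ τ in (0 : ℝ)..t, Φ τ := by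
  have hT : 0 ≤ T := ht.1.trans ht.2
  choose R' hR' hRR using fun ξ => exists_continuous_extension hT (hR ξ)
  set a' : ℝ → ι → ℂ := fun t ξ => a 0 ξ + ∫ τ in (0 : ℝ)..t, R' ξ τ with ha'
  have haa : ∀ ξ, ∀ t ∈ Icc 0 T, a' t ξ = a t ξ := by
    intro ξ t ht
    rw [ha ξ t ht, ha']
    simp only
    rw [integral_congr_of_eqOn (hRR ξ) ht]
  have hd : ∀ ξ t, HasDerivAt (fun t => a' t ξ) (R' ξ t) t := fun ξ t =>
    ((hR' ξ).integral_hasStrictDerivAt 0 t).hasDerivAt.const_add _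
  have hcont : ∀ ξ, Continuous fun t => a' t ξ := fun ξ =>
    continuous_iff_continuousAt.2 fun t => (hd ξ t).continuousAt
  have hE : ∀ t, HasDerivAt (fun t => ∑ ξ ∈ F, M ξ * ‖a' t ξ‖ ^ 2)
      (∑ ξ ∈ F, M ξ * (2 * ((starRingEnd ℂ) (a' t ξ) * R' ξ t).re)) t := by
    intro t
    refine HasDerivAt.fun_sum fun ξ _ => HasDerivAt.const_mul _ ?_
    have h := (hd ξ t).norm_sq
    rwa [Complex.inner, mul_comm (R' ξ t)] at h
  have hEc : Continuous fun t => ∑ ξ ∈ F, M ξ * (2 * ((starRingEnd ℂ) (a' t ξ) * R' ξ t).re) := by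
    refine continuous_finsetSum _ fun ξ _ => ?_
    have h1 := hcont ξ
    have h2 := hR' ξ
    have h3 : Continuous fun t => (starRingEnd ℂ) (a' t ξ) := Complex.continuous_conj.comp h1
    exact continuous_const.mul (continuous_const.mul (Complex.continuous_re.comp (h3.mul h2)))
  have hint := intervalIntegral.integral_eq_sub_of_hasDerivAt (a := 0) (b := t)
    (fun τ _ => hE τ) (hEc.intervalIntegrable _ _)
  have hmono : ∫ τ in (0 : ℝ)..t, ∑ ξ ∈ F, M ξ * (2 * ((starRingEnd ℂ) (a' τ ξ) * R' ξ τ).re) ≤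
      ∫ τ in (0 : ℝ)..t, Φ τ := by
    refine intervalIntegral.integral_mono_on ht.1 (hEc.intervalIntegrable _ _) ?_ fun τ hτ => ?_
    · refine ContinuousOn.intervalIntegrable ?_
      rw [uIcc_of_le ht.1]
      exact hΦ.mono (Icc_subset_Icc_right ht.2)
    · have hτ' : τ ∈ Icc 0 T := ⟨hτ.1, hτ.2.trans ht.2⟩
      refine le_trans (le_of_eq ?_) (hle τ hτ')
      rw [Finset.mul_sum]
      refine Finset.sum_congr rfl fun ξ _ => ?_
      rw [haa ξ τ hτ', hRR ξ hτ']
      ring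
  have h0 : (0 : ℝ) ∈ Icc 0 T := ⟨le_rfl, hT⟩
  simp only [haa _ t ht, haa _ 0 h0] at hint
  linarith

lemma ofReal_sum_weight (s : ℕ) (a : (Fin 2 → ℤ) → ℂ) (G : Finset (Fin 2 → ℤ)) :
    ENNReal.ofReal (∑ ξ ∈ G, bracket ξ ^ (2 * s) * ‖a ξ‖ ^ 2) =
      ∑ ξ ∈ G, (wt ξ ^ s * ‖a ξ‖ₑ) ^ 2 := by
  have hb : ∀ ξ, 0 ≤ bracket ξ := fun ξ => (bracket_pos ξ).le
  rw [ENNReal.ofReal_sum_of_nonneg fun ξ _ => mul_nonneg (pow_nonneg (hb ξ) _) (sq_nonneg _)]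
  refine Finset.sum_congr rfl fun ξ _ => ?_
  rw [ENNReal.ofReal_mul (pow_nonneg (hb ξ) _), ofReal_bracket_pow,
    ENNReal.ofReal_pow (norm_nonneg _), ofReal_norm, mul_pow, ← pow_mul, mul_comm s]

lemma sum_truncWeight_le (s : ℕ) {N : ℝ} (hN : 0 < N) (a : (Fin 2 → ℤ) → ℂ)
    (G : Finset (Fin 2 → ℤ)) :
    ENNReal.ofReal (∑ ξ ∈ G, truncWeight s N ξ * ‖a ξ‖ ^ 2) ≤
      (ellTwo fun ξ => wt ξ ^ s * ‖a ξ‖ₑ) ^ 2 := by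
  rw [ellTwo_sq]
  refine le_trans ?_ (ENNReal.sum_le_tsum G)
  rw [← ofReal_sum_weight]
  refine ENNReal.ofReal_le_ofReal (Finset.sum_le_sum fun ξ _ => ?_)
  gcongr
  exact truncWeight_le s hN ξ

/-- The integrated energy inequality in Sobolev norms, by removing the truncation. -/
lemma sobolev_energy_le {s : ℕ} {T : ℝ} {a R : ℝ → (Fin 2 → ℤ) → ℂ}
    (hR : ∀ ξ, ContinuousOn (fun t => R t ξ) (Icc 0 T))
    (ha : ∀ ξ, ∀ t ∈ Icc 0 T, a t ξ = a 0 ξ + ∫ τ in (0 : ℝ)..t, R τ ξ)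
    {Φ : ℝ → ℝ} (hΦ : ContinuousOn Φ (Icc 0 T))
    (hle : ∀ N > 0, ∀ t ∈ Icc 0 T,
      2 * ∑ ξ ∈ lowFreq N, truncWeight s N ξ * ((starRingEnd ℂ) (a t ξ) * R t ξ).re ≤ Φ t)
    {t : ℝ} (ht : t ∈ Icc 0 T) :
    (ellTwo fun ξ => wt ξ ^ s * ‖a t ξ‖ₑ) ^ 2 ≤
      (ellTwo fun ξ => wt ξ ^ s * ‖a 0 ξ‖ₑ) ^ 2 + ENNReal.ofReal (∫ τ in (0 : ℝ)..t, Φ τ) := by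
  classical
  rw [ellTwo_sq, ENNReal.tsum_eq_iSup_sum]
  refine iSup_le fun G => ?_
  rw [← ofReal_sum_weight]
  have hlim : Tendsto (fun N => ENNReal.ofReal (∑ ξ ∈ G, truncWeight s N ξ * ‖a t ξ‖ ^ 2)) atTop
      (𝓝 (ENNReal.ofReal (∑ ξ ∈ G, bracket ξ ^ (2 * s) * ‖a t ξ‖ ^ 2))) :=
    ENNReal.tendsto_ofReal (tendsto_finsetSum _ fun ξ _ => (tendsto_truncWeight s ξ).mul_const _)
  refine le_of_tendsto hlim ?_
  filter_upwards [eventually_gt_atTop 0] with N hN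
  -- `G` stays fixed as `N` grows, so the limit is termwise, while the energy inequality is
  -- available on all the modes of `lowFreq N`.
  have h1 : ∑ ξ ∈ G, truncWeight s N ξ * ‖a t ξ‖ ^ 2 ≤
      ∑ ξ ∈ lowFreq N, truncWeight s N ξ * ‖a t ξ‖ ^ 2 := by
    refine (Finset.sum_le_sum_of_subset_of_nonneg (Finset.subset_union_right (s₁ := lowFreq N))
      fun ξ _ _ => mul_nonneg (truncWeight_nonneg s N ξ) (sq_nonneg _)).trans_eq ?_
    refine (Finset.sum_subset Finset.subset_union_left fun ξ _ hξ => ?_).symm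
    rw [truncWeight_eq_zero hN ξ hξ, zero_mul]
  have h2 := h1.trans (weighted_energy_le hR ha hΦ (hle N hN) ht)
  refine (ENNReal.ofReal_le_ofReal h2).trans (ENNReal.ofReal_add_le.trans ?_)
  gcongr
  exact sum_truncWeight_le s hN _ _

lemma le_toReal_of_enorm_le {x : ℝ} {c : ℝ≥0∞} (hc : c ≠ ⊤) (h : ‖x‖ₑ ≤ c) : |x| ≤ c.toReal := by
  rw [← Real.norm_eq_abs, ← toReal_enorm]
  exact ENNReal.toReal_mono hc h

/-- The a priori estimate for a transport equation with a source, in the Sobolev space of order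
`k + 2` with `k ≤ 1`. -/
lemma sobolev_gronwall {k : ℕ} (hk : k ≤ 1) {κ T : ℝ} {a p τ S R : ℝ → (Fin 2 → ℤ) → ℂ}
    (hp : ∀ t ∈ Icc 0 T, ∀ ξ, (starRingEnd ℂ) (p t ξ) = p t (-ξ))
    (hτ : ∀ t ∈ Icc 0 T, ∀ ξ,
      HasSum (fun η => ((κ * cross ξ η : ℝ) : ℂ) * (p t (ξ - η) * a t η)) (τ t ξ))
    (hRdef : ∀ t ∈ Icc 0 T, ∀ ξ, R t ξ = -τ t ξ + S t ξ)
    (hR : ∀ ξ, ContinuousOn (fun t => R t ξ) (Icc 0 T))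
    (ha : ∀ ξ, ∀ t ∈ Icc 0 T, a t ξ = a 0 ξ + ∫ τ in (0 : ℝ)..t, R τ ξ)
    {A B : ℝ≥0∞} (hAtop : A ≠ ⊤) (hBtop : B ≠ ⊤)
    (hA : ∀ t ∈ Icc 0 T, (ellTwo fun ξ => wt ξ ^ 4 * ‖p t ξ‖ₑ) ≤ A)
    (hS : ∀ t ∈ Icc 0 T, ∑' ξ, wt ξ ^ (2 * (k + 2)) * (‖a t ξ‖ₑ * ‖S t ξ‖ₑ) ≤
      B * ellTwo fun ξ => wt ξ ^ (k + 2) * ‖a t ξ‖ₑ)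
    (hfin : ∀ t ∈ Icc 0 T, (ellTwo fun ξ => wt ξ ^ (k + 2) * ‖a t ξ‖ₑ) ≠ ⊤)
    (hcont : ContinuousOn (fun t => (ellTwo fun ξ => wt ξ ^ (k + 2) * ‖a t ξ‖ₑ).toReal) (Icc 0 T))
    {t : ℝ} (ht : t ∈ Icc 0 T) :
    1 + (ellTwo fun ξ => wt ξ ^ (k + 2) * ‖a t ξ‖ₑ).toReal ^ 2 ≤
      (1 + (ellTwo fun ξ => wt ξ ^ (k + 2) * ‖a 0 ξ‖ₑ).toReal ^ 2) *
        Real.exp (t * ((ENNReal.ofReal |κ| * (42 * embConst * A)).toReal + 2 * B.toReal)) := by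
  set E : ℝ → ℝ≥0∞ := fun t => ellTwo fun ξ => wt ξ ^ (k + 2) * ‖a t ξ‖ₑ with hE
  set c₁ : ℝ := (ENNReal.ofReal |κ| * (42 * embConst * A)).toReal with hc₁
  have hc₁top : ENNReal.ofReal |κ| * (42 * embConst * A) ≠ ⊤ :=
    ENNReal.mul_ne_top ENNReal.ofReal_ne_top
      (ENNReal.mul_ne_top (ENNReal.mul_ne_top (by norm_num) embConst_ne_top) hAtop)
  set C : ℝ := c₁ + 2 * B.toReal with hC
  have hC0 : 0 ≤ C := by positivity
  have hle : ∀ N > 0, ∀ t ∈ Icc 0 T, 2 * ∑ ξ ∈ lowFreq N, truncWeight (k + 2) N ξ *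
      ((starRingEnd ℂ) (a t ξ) * R t ξ).re ≤ C * (1 + (E t).toReal ^ 2) := by
    intro N hN t ht
    have h1 := enorm_transport_energy_le (hp t ht) (hτ t ht)
      (truncWeight_eq_zero (s := k + 2) hN)
    have h2 : ‖2 * ∑ ξ ∈ lowFreq N, truncWeight (k + 2) N ξ *
        ((starRingEnd ℂ) (a t ξ) * τ t ξ).re‖ₑ ≤
        ENNReal.ofReal |κ| * (42 * embConst * A) * E t ^ 2 := by
      refine h1.trans ?_
      rw [mul_assoc]
      gcongr
      refine (tsum_commutator_le hk hN (fun ξ => ‖p t ξ‖ₑ) (fun ξ => ‖a t ξ‖ₑ)).trans ?_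
      gcongr
      exact hA t ht
    have h3 := le_toReal_of_enorm_le
      (ENNReal.mul_ne_top hc₁top (ENNReal.pow_ne_top (hfin t ht))) h2
    rw [ENNReal.toReal_mul, ENNReal.toReal_pow, ← hc₁] at h3
    have h4 : ‖∑ ξ ∈ lowFreq N, truncWeight (k + 2) N ξ *
        ((starRingEnd ℂ) (a t ξ) * S t ξ).re‖ₑ ≤ B * E t := by
      refine (enorm_sum_le _ _).trans (le_trans ?_ (hS t ht))
      refine le_trans (Finset.sum_le_sum fun ξ _ => ?_) (ENNReal.sum_le_tsum (lowFreq N))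
      rw [enorm_mul, ← ofReal_bracket_pow]
      gcongr
      · rw [← ofReal_norm, Real.norm_of_nonneg (truncWeight_nonneg _ _ _)]
        exact ENNReal.ofReal_le_ofReal (truncWeight_le _ hN ξ)
      · rw [← ofReal_norm, ← ofReal_norm, ← ofReal_norm, ← ENNReal.ofReal_mul (norm_nonneg _)]
        refine ENNReal.ofReal_le_ofReal ((Complex.abs_re_le_norm _).trans_eq ?_)
        rw [norm_mul, RCLike.norm_conj]
    have h5 := le_toReal_of_enorm_le (ENNReal.mul_ne_top hBtop (hfin t ht)) h4
    rw [ENNReal.toReal_mul] at h5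
    have h6 : 2 * ∑ ξ ∈ lowFreq N, truncWeight (k + 2) N ξ *
        ((starRingEnd ℂ) (a t ξ) * R t ξ).re =
        -(2 * ∑ ξ ∈ lowFreq N, truncWeight (k + 2) N ξ *
          ((starRingEnd ℂ) (a t ξ) * τ t ξ).re) +
        2 * ∑ ξ ∈ lowFreq N, truncWeight (k + 2) N ξ *
          ((starRingEnd ℂ) (a t ξ) * S t ξ).re := by
      rw [← mul_neg, ← Finset.sum_neg_distrib, ← mul_add, ← Finset.sum_add_distrib]
      congr 1
      refine Finset.sum_congr rfl fun ξ _ => ?_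
      rw [hRdef t ht, mul_add, mul_neg, Complex.add_re, Complex.neg_re]
      ring
    rw [h6]
    have h7 := neg_abs_le (2 * ∑ ξ ∈ lowFreq N, truncWeight (k + 2) N ξ *
          ((starRingEnd ℂ) (a t ξ) * τ t ξ).re)
    have h8 := le_abs_self (∑ ξ ∈ lowFreq N, truncWeight (k + 2) N ξ *
          ((starRingEnd ℂ) (a t ξ) * S t ξ).re)
    -- The source contributes linearly in `E`; working with `1 + E²` absorbs it into a linear
    -- Grönwall inequality.
    have h9 : (E t).toReal ≤ 1 + (E t).toReal ^ 2 := by nlinarith [sq_nonneg ((E t).toReal - 1)]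
    have h10 : B.toReal * (E t).toReal ≤ B.toReal * (1 + (E t).toReal ^ 2) :=
      mul_le_mul_of_nonneg_left h9 ENNReal.toReal_nonneg
    have h11 : 0 ≤ c₁ := ENNReal.toReal_nonneg
    rw [hC]
    nlinarith
  have hyc : ContinuousOn (fun t => 1 + (E t).toReal ^ 2) (Icc 0 T) :=
    continuousOn_const.add (hcont.pow 2)
  have hΦ : ContinuousOn (fun t => C * (1 + (E t).toReal ^ 2)) (Icc 0 T) :=
    continuousOn_const.mul hyc
  have h0 : (0 : ℝ) ∈ Icc 0 T := ⟨le_rfl, ht.1.trans ht.2⟩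
  have hgr := gronwall_integral (a := 1 + (E 0).toReal ^ 2) (k := fun _ => C) hyc continuousOn_const
    (fun _ _ => hC0) (fun t ht => by
      have h1 := sobolev_energy_le hR ha hΦ hle ht
      have hi : 0 ≤ ∫ τ in (0 : ℝ)..t, C * (1 + (E τ).toReal ^ 2) :=
        intervalIntegral.integral_nonneg ht.1 fun τ _ => by positivity
      have h2 := ENNReal.toReal_mono
        (ENNReal.add_ne_top.2 ⟨ENNReal.pow_ne_top (hfin 0 h0), ENNReal.ofReal_ne_top⟩) h1
      rw [ENNReal.toReal_add (ENNReal.pow_ne_top (hfin 0 h0)) ENNReal.ofReal_ne_top,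
        ENNReal.toReal_pow, ENNReal.toReal_pow, ENNReal.toReal_ofReal hi] at h2
      simp only [hE] at h2 ⊢
      linarith) ht
  rw [intervalIntegral.integral_const, sub_zero, smul_eq_mul] at hgr
  exact hgr

/-! ### Continuity in time and evolution of the coefficients -/

lemma sobolevNorm_sub_comm (s : ℕ) (v w : L2 L) :
    sobolevNorm s (v - w : L2 L) = sobolevNorm s (w - v : L2 L) := by
  simp only [sobolevNorm_eq_ellTwo, fourierCoeff₂_sub]
  congr 1
  funext ξ
  rw [← enorm_neg, neg_sub]

lemma sobolevNorm_le_add (s : ℕ) (v w : L2 L) :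
    sobolevNorm s v ≤ sobolevNorm s w + sobolevNorm s (v - w : L2 L) := by
  simp only [sobolevNorm_eq_ellTwo, fourierCoeff₂_sub]
  refine le_trans (ellTwo_mono fun ξ => ?_) (ellTwo_add_le _ _)
  rw [← mul_add]
  gcongr
  calc ‖fourierCoeff₂ v ξ‖ₑ
      = ‖fourierCoeff₂ w ξ + (fourierCoeff₂ v ξ - fourierCoeff₂ w ξ)‖ₑ := by
        rw [add_sub_cancel]
    _ ≤ _ := enorm_add_le _ _

lemma sobolevNorm_mono {m n : ℕ} (h : m ≤ n) (v : Torus L → ℝ) :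
    sobolevNorm m v ≤ sobolevNorm n v := by
  simp only [sobolevNorm_eq_ellTwo]
  exact ellTwo_wt_mono h _

lemma enorm_le_sobolevNorm (s : ℕ) (v : L2 L) : ‖v‖ₑ ≤ ENNReal.ofReal L * sobolevNorm s v := by
  rw [enorm_eq_mul_ellTwo, sobolevNorm_eq_ellTwo]
  gcongr
  refine ellTwo_mono fun ξ => ?_
  exact le_mul_of_one_le_left zero_le (one_le_pow₀ (one_le_wt ξ))

/-- The reverse triangle inequality, usable in the reals because the norm of the difference is
finite near `t`. -/
lemma ContinuousInSobolev.continuousOn_toReal {s : ℕ} {T : ℝ} {v : ℝ → L2 L}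
    (h : ContinuousInSobolev s T v) :
    ContinuousOn (fun t => (sobolevNorm s (v t)).toReal) (Icc 0 T) := by
  intro t ht
  have hlim := (ENNReal.tendsto_toReal ENNReal.zero_ne_top).comp (h t ht).2
  refine tendsto_iff_norm_sub_tendsto_zero.2 ?_
  have hev : ∀ᶠ τ in 𝓝[Icc 0 T] t, sobolevNorm s (v τ - v t : L2 L) < ⊤ :=
    (h t ht).2.eventually_lt_const ENNReal.zero_lt_top
  refine squeeze_zero' (Eventually.of_forall fun _ => norm_nonneg _) ?_ hlim
  filter_upwards [hev, self_mem_nhdsWithin] with τ h1 hτ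
  have e1 := ENNReal.toReal_mono (ENNReal.add_ne_top.2 ⟨(h t ht).1.ne, h1.ne⟩)
    (sobolevNorm_le_add s (v τ) (v t))
  have h2 := h1
  rw [sobolevNorm_sub_comm] at h2
  have e2 := ENNReal.toReal_mono (ENNReal.add_ne_top.2 ⟨(h τ hτ).1.ne, h2.ne⟩)
    (sobolevNorm_le_add s (v t) (v τ))
  rw [ENNReal.toReal_add (h t ht).1.ne h1.ne] at e1
  rw [ENNReal.toReal_add (h τ hτ).1.ne h2.ne, sobolevNorm_sub_comm] at e2
  rw [Function.comp_apply, Real.norm_eq_abs, abs_le]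
  constructor <;> linarith

lemma ContinuousInSobolev.continuousOn {s : ℕ} {T : ℝ} {v : ℝ → L2 L}
    (h : ContinuousInSobolev s T v) : ContinuousOn v (Icc 0 T) := by
  intro t ht
  refine tendsto_iff_edist_tendsto_0.2 ?_
  have hlim : Tendsto (fun τ => ENNReal.ofReal L * sobolevNorm s (v τ - v t : L2 L))
      (𝓝[Icc 0 T] t) (𝓝 (ENNReal.ofReal L * 0)) :=
    ENNReal.Tendsto.const_mul (h t ht).2 (Or.inr ENNReal.ofReal_ne_top)
  rw [mul_zero] at hlim
  refine tendsto_of_tendsto_of_tendsto_of_le_of_le tendsto_const_nhds hlim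
    (fun _ => zero_le) fun τ => ?_
  rw [edist_eq_enorm_sub]
  exact enorm_le_sobolevNorm s _

/-- The velocity depends continuously on the vorticity. -/
lemma exists_enorm_velocity_sub_le (L : ℝ) [Fact (0 < L)] {α : ℝ} (hα : 0 < α) :
    ∃ C : ℝ≥0∞, C ≠ ⊤ ∧ ∀ (w w' : L2 L) (u u' : Fin 2 → L2 L), IsVelocity α w u →
      IsVelocity α w' u' → ∀ j, ‖u j - u' j‖ₑ ≤ C * ‖w - w'‖ₑ := by
  obtain ⟨C, hC, hCle⟩ := exists_wt_mul_streamCoeff_le L hα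
  refine ⟨ENNReal.ofReal (2 * Real.pi / L) * C, ENNReal.mul_ne_top ENNReal.ofReal_ne_top hC,
    fun w w' u u' h h' j => ?_⟩
  rw [enorm_eq_mul_ellTwo, enorm_eq_mul_ellTwo (w - w'), mul_left_comm]
  gcongr
  rw [← ellTwo_const_mul]
  refine ellTwo_mono fun ξ => ?_
  have hs : streamCoeff α (w - w' : L2 L) ξ = streamCoeff α w ξ - streamCoeff α w' ξ := by
    simp only [streamCoeff, fourierCoeff₂_sub, mul_sub]
  have key : ∀ i : Fin 2, ‖freq L (ξ i) * streamCoeff α (w - w' : L2 L) ξ‖ₑ ≤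
      ENNReal.ofReal (2 * Real.pi / L) * C * ‖fourierCoeff₂ (w - w' : L2 L) ξ‖ₑ := by
    intro i
    rw [enorm_mul, mul_assoc]
    refine le_trans ?_ (mul_le_mul_right (hCle (w - w' : L2 L) ξ) _)
    rw [← mul_assoc]
    gcongr
    refine (enorm_freq_le ξ i).trans ?_
    gcongr
    exact le_self_pow₀ (one_le_wt ξ) (by norm_num)
  rw [fourierCoeff₂_sub]
  have hj : j = 0 ∨ j = 1 := by fin_cases j <;> simp
  rcases hj with rfl | rfl
  · rw [(h.fourierCoeff₂_eq hα ξ).1, (h'.fourierCoeff₂_eq hα ξ).1, ← mul_sub, ← hs, neg_mul,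
      enorm_neg]
    exact key 1
  · rw [(h.fourierCoeff₂_eq hα ξ).2, (h'.fourierCoeff₂_eq hα ξ).2, ← mul_sub, ← hs]
    exact key 0

lemma continuousOn_velocity {α : ℝ} (hα : 0 < α) {w : ℝ → L2 L} {u : ℝ → Fin 2 → L2 L} {I : Set ℝ}
    (hw : ContinuousOn w I) (hu : ∀ t ∈ I, IsVelocity α (w t) (u t)) (j : Fin 2) :
    ContinuousOn (fun t => u t j) I := by
  obtain ⟨C, hC, hle⟩ := exists_enorm_velocity_sub_le L hα
  intro t ht
  refine tendsto_iff_edist_tendsto_0.2 ?_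
  have hlim := ENNReal.Tendsto.const_mul (a := C) (tendsto_iff_edist_tendsto_0.1 (hw t ht))
    (Or.inr hC)
  rw [mul_zero] at hlim
  refine tendsto_of_tendsto_of_tendsto_of_le_of_le' tendsto_const_nhds hlim
    (Eventually.of_forall fun _ => zero_le) ?_
  filter_upwards [self_mem_nhdsWithin] with τ hτ
  rw [edist_eq_enorm_sub, edist_eq_enorm_sub]
  exact hle _ _ _ _ (hu τ hτ) (hu t ht) j

lemma continuousOn_fourierCoeff₂_mul {g v : ℝ → L2 L} {I : Set ℝ}
    (hg : ContinuousOn g I) (hv : ContinuousOn v I) (ξ : Fin 2 → ℤ) :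
    ContinuousOn (fun t => fourierCoeff₂ (fun x => g t x * v t x) ξ) I := by
  have key : ∀ Φ : L2 L × L2 L → ℂ, Continuous Φ → ContinuousOn (fun t => Φ (g t, v t)) I :=
    fun Φ hΦ => hΦ.comp_continuousOn (hg.prodMk hv)
  have h := key _ (isBoundedBilinearMap_fourierCoeff₂_mul ξ).continuous
  simpa only using h

lemma continuousOn_divCoeff {g : ℝ → Fin 2 → L2 L} {v : ℝ → L2 L} {I : Set ℝ}
    (hg : ∀ j, ContinuousOn (fun t => g t j) I) (hv : ContinuousOn v I) (ξ : Fin 2 → ℤ) :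
    ContinuousOn (fun t => divCoeff (fun j => g t j) (v t) ξ) I := by
  unfold divCoeff
  exact continuousOn_finsetSum _ fun j _ =>
    continuousOn_const.mul (continuousOn_fourierCoeff₂_mul (hg j) hv ξ)

lemma divCoeff_sub_left (g h : Fin 2 → L2 L) (v : L2 L) (ξ : Fin 2 → ℤ) :
    divCoeff (fun j => (g j - h j : L2 L)) v ξ =
      divCoeff (fun j => g j) v ξ - divCoeff (fun j => h j) v ξ := by
  have h1 : ∀ j, fourierCoeff₂ (fun x => (g j - h j : L2 L) x * v x) ξ =
      fourierCoeff₂ (fun x => g j x * v x) ξ - fourierCoeff₂ (fun x => h j x * v x) ξ := fun j =>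
    (isBoundedBilinearMap_fourierCoeff₂_mul ξ).map_sub_left
  simp only [divCoeff, h1, mul_sub, Finset.sum_sub_distrib]

lemma fourierCoeff₂_sub_mul (v w u : L2 L) (ξ : Fin 2 → ℤ) :
    fourierCoeff₂ (fun x => (v x - w x) * u x) ξ =
      fourierCoeff₂ (fun x => u x * v x) ξ - fourierCoeff₂ (fun x => u x * w x) ξ := by
  have h : (fun x => (v x - w x) * u x) = fun x => u x * v x + -(u x * w x) := by
    funext x; ring
  rw [h, fourierCoeff₂_add (g := fun x => -(u x * w x)) (integrable_mul_L2 u v)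
    (integrable_mul_L2 u w).neg, fourierCoeff₂_neg,
    sub_eq_add_neg]

/-- A Fourier coefficient is a continuous linear functional on `L²`, so it passes through the
Bochner integral. -/
lemma fourierCoeff₂_integral_eq {T : ℝ} {v B : ℝ → L2 L} {v₀ : L2 L}
    (hB : IntervalIntegrable B volume 0 T)
    (h : ∀ t ∈ Icc 0 T, v t = v₀ - ∫ τ in (0 : ℝ)..t, B τ) {t : ℝ} (ht : t ∈ Icc 0 T)
    (ξ : Fin 2 → ℤ) :
    fourierCoeff₂ (v t) ξ = fourierCoeff₂ (v 0) ξ +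
      ∫ τ in (0 : ℝ)..t, -fourierCoeff₂ (B τ) ξ := by
  have hT : 0 ≤ T := ht.1.trans ht.2
  have hBt : IntervalIntegrable B volume 0 t :=
    hB.mono_set (by rw [uIcc_of_le ht.1, uIcc_of_le hT]; exact Icc_subset_Icc_right ht.2)
  have h0 : v 0 = v₀ := by simpa using h 0 ⟨le_rfl, hT⟩
  rw [h t ht, h0, ← coeffCLM_apply, map_sub, ← ContinuousLinearMap.intervalIntegral_comp_comm _ hBt,
    sub_eq_add_neg, ← intervalIntegral.integral_neg]
  rfl

/-- The evolution of the Fourier coefficients of a local solution. -/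
lemma IsLocalSolution.exists_velocity {α : ℝ} {uh : Fin 2 → L2 L} {f b₀ ω₀ : L2 L}
    {b ω : ℝ → L2 L} {T : ℝ} (h : IsLocalSolution α uh f b₀ ω₀ b ω T) :
    ∃ u : ℝ → Fin 2 → L2 L, (∀ t ∈ Icc 0 T, IsVelocity α (ω t - f) (u t)) ∧
      (∀ ξ, ∀ t ∈ Icc 0 T, fourierCoeff₂ (b t) ξ = fourierCoeff₂ (b 0) ξ +
        ∫ τ in (0 : ℝ)..t, -divCoeff (fun j => u τ j) (b τ) ξ) ∧
      (∀ ξ, ∀ t ∈ Icc 0 T, fourierCoeff₂ (ω t) ξ = fourierCoeff₂ (ω 0) ξ +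
        ∫ τ in (0 : ℝ)..t, (-divCoeff (fun j => u τ j) (ω τ) ξ +
          divCoeff (fun j => (u τ j - uh j : L2 L)) (b τ) ξ)) := by
  obtain ⟨u, B, W, Z, hu, hB, hW, hZ, hBi, hWi, hZi, hb, hω⟩ := h.equations
  refine ⟨u, hu, fun ξ t ht => ?_, fun ξ t ht => ?_⟩
  · rw [fourierCoeff₂_integral_eq hBi hb ht]
    congr 1
    refine integral_congr_of_eqOn (fun τ hτ => ?_) ht
    simp only [(hB τ hτ).fourierCoeff₂_eq, divCoeff, mul_comm (b τ _)]
  -- The two fluxes regroup as `div (ω u) - div (b (u - u_h))`, which exhibits pure transport of `ω`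
  -- plus a source.
  · rw [fourierCoeff₂_integral_eq (hWi.add hZi) hω ht]
    congr 1
    refine integral_congr_of_eqOn (fun τ hτ => ?_) ht
    have h1 : fourierCoeff₂ (W τ + Z τ : L2 L) ξ =
        fourierCoeff₂ (W τ) ξ + fourierCoeff₂ (Z τ) ξ := (coeffCLM L ξ).map_add _ _
    simp only [divCoeff_sub_left]
    simp only [h1, (hW τ hτ).fourierCoeff₂_eq, (hZ τ hτ).fourierCoeff₂_eq,
      divCoeff, fourierCoeff₂_sub_mul, mul_comm (b τ _)]
    simp only [mul_sub, Finset.sum_sub_distrib]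
    ring

/-! ### The `L²` estimate for the vorticity -/

lemma truncWeight_zero_le_one {N : ℝ} (hN : 0 < N) (ξ : Fin 2 → ℤ) : truncWeight 0 N ξ ≤ 1 := by
  simpa using truncWeight_le 0 hN ξ

lemma ofReal_sum_sq_le {ι : Type*} (a : ι → ℂ) (G : Finset ι) :
    ENNReal.ofReal (∑ ξ ∈ G, ‖a ξ‖ ^ 2) ≤ (ellTwo fun ξ => ‖a ξ‖ₑ) ^ 2 := by
  rw [ellTwo_sq, ENNReal.ofReal_sum_of_nonneg fun ξ _ => sq_nonneg _]
  refine le_trans (le_of_eq (Finset.sum_congr rfl fun ξ _ => ?_)) (ENNReal.sum_le_tsum G)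
  rw [ENNReal.ofReal_pow (norm_nonneg _), ofReal_norm]

lemma sqrt_sum_sq_le {ι : Type*} (a : ι → ℂ) (G : Finset ι) :
    ENNReal.ofReal (√(∑ ξ ∈ G, ‖a ξ‖ ^ 2)) ≤ ellTwo fun ξ => ‖a ξ‖ₑ := by
  rw [← ENNReal.pow_le_pow_left_iff two_ne_zero, ← ENNReal.ofReal_pow (Real.sqrt_nonneg _),
    Real.sq_sqrt (Finset.sum_nonneg fun _ _ => sq_nonneg _)]
  exact ofReal_sum_sq_le a G

lemma sum_truncWeight_re_le {N : ℝ} (hN : 0 < N) (a S : (Fin 2 → ℤ) → ℂ)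
    (F : Finset (Fin 2 → ℤ)) (hfin : (ellTwo fun ξ => ‖a ξ‖ₑ) ≠ ⊤) :
    ∑ ξ ∈ F, truncWeight 0 N ξ * ((starRingEnd ℂ) (a ξ) * S ξ).re ≤
      (ellTwo fun ξ => ‖a ξ‖ₑ).toReal * √(∑ ξ ∈ F, ‖S ξ‖ ^ 2) := by
  calc ∑ ξ ∈ F, truncWeight 0 N ξ * ((starRingEnd ℂ) (a ξ) * S ξ).re
      ≤ ∑ ξ ∈ F, ‖a ξ‖ * ‖S ξ‖ := by
        refine Finset.sum_le_sum fun ξ _ => ?_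
        have h1 : ((starRingEnd ℂ) (a ξ) * S ξ).re ≤ ‖a ξ‖ * ‖S ξ‖ := by
          refine (Complex.re_le_norm _).trans_eq ?_
          rw [norm_mul, RCLike.norm_conj]
        calc _ ≤ truncWeight 0 N ξ * (‖a ξ‖ * ‖S ξ‖) :=
              mul_le_mul_of_nonneg_left h1 (truncWeight_nonneg 0 N ξ)
          _ ≤ 1 * (‖a ξ‖ * ‖S ξ‖) := by
              gcongr
              exact truncWeight_zero_le_one hN ξ
          _ = _ := one_mul _
    _ ≤ √(∑ ξ ∈ F, ‖a ξ‖ ^ 2) * √(∑ ξ ∈ F, ‖S ξ‖ ^ 2) :=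
        Real.sum_mul_le_sqrt_mul_sqrt F (fun ξ => ‖a ξ‖) (fun ξ => ‖S ξ‖)
    _ ≤ _ := by
        gcongr
        exact (ENNReal.ofReal_le_iff_le_toReal hfin).1 (sqrt_sum_sq_le a F)

/-- What the cutoff removes is at most `⟨ξ⟩/N ≤ ⟨ξ⟩⁴/N`, which the order-two norm pays for. -/
lemma ellTwo_sq_le_trunc {N : ℝ} (hN : 0 < N) (a : (Fin 2 → ℤ) → ℂ) :
    (ellTwo fun ξ => ‖a ξ‖ₑ) ^ 2 ≤
      ENNReal.ofReal (∑ ξ ∈ lowFreq N, truncWeight 0 N ξ * ‖a ξ‖ ^ 2) +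
        ENNReal.ofReal N⁻¹ * (ellTwo fun ξ => wt ξ ^ 2 * ‖a ξ‖ₑ) ^ 2 := by
  have h1 : ENNReal.ofReal (∑ ξ ∈ lowFreq N, truncWeight 0 N ξ * ‖a ξ‖ ^ 2) =
      ∑' ξ, ENNReal.ofReal (truncWeight 0 N ξ) * ‖a ξ‖ₑ ^ 2 := by
    rw [tsum_eq_sum (s := lowFreq N) fun ξ hξ => by
        rw [truncWeight_eq_zero hN ξ hξ, ENNReal.ofReal_zero, zero_mul],
      ENNReal.ofReal_sum_of_nonneg fun ξ _ =>
        mul_nonneg (truncWeight_nonneg 0 N ξ) (sq_nonneg _)]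
    refine Finset.sum_congr rfl fun ξ _ => ?_
    rw [ENNReal.ofReal_mul (truncWeight_nonneg 0 N ξ), ENNReal.ofReal_pow (norm_nonneg _),
      ofReal_norm]
  rw [h1, ellTwo_sq, ellTwo_sq, ← ENNReal.tsum_mul_left, ← ENNReal.tsum_add]
  refine ENNReal.tsum_le_tsum fun ξ => ?_
  have hb := one_le_bracket ξ
  have h2 : (1 : ℝ≥0∞) ≤ ENNReal.ofReal (truncWeight 0 N ξ) +
      ENNReal.ofReal N⁻¹ * (wt ξ ^ 2) ^ 2 := by
    rw [← ofReal_bracket_pow, ← ENNReal.ofReal_pow (by positivity),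
      ← ENNReal.ofReal_mul (by positivity),
      ← ENNReal.ofReal_add (truncWeight_nonneg 0 N ξ) (by positivity), ENNReal.one_le_ofReal]
    have h3 := one_sub_cutoff_le N (bracket ξ)
    have h4 : bracket ξ / N ≤ N⁻¹ * (bracket ξ ^ 2) ^ 2 := by
      rw [div_eq_inv_mul, ← pow_mul]
      gcongr
      exact le_self_pow₀ hb (by norm_num)
    simp only [truncWeight, mul_zero, pow_zero, one_mul]
    linarith
  calc ‖a ξ‖ₑ ^ 2 = 1 * ‖a ξ‖ₑ ^ 2 := (one_mul _).symm
    _ ≤ (ENNReal.ofReal (truncWeight 0 N ξ) + ENNReal.ofReal N⁻¹ * (wt ξ ^ 2) ^ 2) *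
        ‖a ξ‖ₑ ^ 2 := by gcongr
    _ = _ := by ring

/-- The `L²` a priori estimate for a transport equation with a source `S`: the growth is governed
by the time integral of `‖S‖ / (1 + ‖a‖)`. -/
lemma ellTwo_gronwall {κ T : ℝ} {a p τ S R : ℝ → (Fin 2 → ℤ) → ℂ}
    (hp : ∀ t ∈ Icc 0 T, ∀ ξ, (starRingEnd ℂ) (p t ξ) = p t (-ξ))
    (hτ : ∀ t ∈ Icc 0 T, ∀ ξ,
      HasSum (fun η => ((κ * cross ξ η : ℝ) : ℂ) * (p t (ξ - η) * a t η)) (τ t ξ))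
    (hRdef : ∀ t ∈ Icc 0 T, ∀ ξ, R t ξ = -τ t ξ + S t ξ)
    (hR : ∀ ξ, ContinuousOn (fun t => R t ξ) (Icc 0 T))
    (hSc : ∀ ξ, ContinuousOn (fun t => S t ξ) (Icc 0 T))
    (ha : ∀ ξ, ∀ t ∈ Icc 0 T, a t ξ = a 0 ξ + ∫ τ in (0 : ℝ)..t, R τ ξ)
    {A D : ℝ≥0∞} (hAtop : A ≠ ⊤) (hDtop : D ≠ ⊤)
    (hA : ∀ t ∈ Icc 0 T, (ellTwo fun ξ => wt ξ ^ 4 * ‖p t ξ‖ₑ) ≤ A)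
    (hD : ∀ t ∈ Icc 0 T, (ellTwo fun ξ => wt ξ ^ 2 * ‖a t ξ‖ₑ) ≤ D)
    (hcont : ContinuousOn (fun t => (ellTwo fun ξ => ‖a t ξ‖ₑ).toReal) (Icc 0 T))
    {K : ℝ} (hK : ∀ F : Finset (Fin 2 → ℤ), ∀ t ∈ Icc 0 T,
      ∫ τ in (0 : ℝ)..t, √(∑ ξ ∈ F, ‖S τ ξ‖ ^ 2) / (1 + (ellTwo fun ξ => ‖a τ ξ‖ₑ).toReal) ≤ K)
    {t : ℝ} (ht : t ∈ Icc 0 T) :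
    1 + (ellTwo fun ξ => ‖a t ξ‖ₑ).toReal ^ 2 ≤
      (1 + (ellTwo fun ξ => ‖a 0 ξ‖ₑ).toReal ^ 2) * Real.exp (4 * K) := by
  set e : ℝ → ℝ := fun t => (ellTwo fun ξ => ‖a t ξ‖ₑ).toReal with he
  have he0 : ∀ t, 0 ≤ e t := fun t => ENNReal.toReal_nonneg
  have hfin : ∀ t ∈ Icc 0 T, (ellTwo fun ξ => ‖a t ξ‖ₑ) ≠ ⊤ := fun t ht =>
    ne_top_of_le_ne_top hDtop (le_trans (ellTwo_mono fun ξ =>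
      le_mul_of_one_le_left zero_le (one_le_pow₀ (one_le_wt ξ))) (hD t ht))
  set C : ℝ := (ENNReal.ofReal |κ| * (embConst * A * D ^ 2)).toReal with hC
  have hCtop : ENNReal.ofReal |κ| * (embConst * A * D ^ 2) ≠ ⊤ :=
    ENNReal.mul_ne_top ENNReal.ofReal_ne_top (ENNReal.mul_ne_top
      (ENNReal.mul_ne_top embConst_ne_top hAtop) (ENNReal.pow_ne_top hDtop))
  have hC0 : 0 ≤ C := ENNReal.toReal_nonneg
  have h0 : (0 : ℝ) ∈ Icc 0 T := ⟨le_rfl, ht.1.trans ht.2⟩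
  -- The truncation error has two parts: the commutator over time, `C T / N`, and the removed part
  -- of the energy, `D² / N`. Both disappear in the limit, so `A` and `D` do not enter the
  -- conclusion.
  have main : ∀ N > 0, 1 + e t ^ 2 ≤
      (1 + e 0 ^ 2 + (C * T + D.toReal ^ 2) * N⁻¹) * Real.exp (4 * K) := by
    intro N hN
    set F := lowFreq N with hF
    -- Restricting the source to finitely many modes makes this rate continuous in time; dividing by
    -- `1 + e` removes the growth of the source with the vorticity.
    set k : ℝ → ℝ := fun t => √(∑ ξ ∈ F, ‖S t ξ‖ ^ 2) / (1 + e t) with hk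
    have hk0 : ∀ t, 0 ≤ k t := fun t => div_nonneg (Real.sqrt_nonneg _) (by linarith [he0 t])
    have hkc : ContinuousOn k (Icc 0 T) := by
      refine ContinuousOn.div ?_ (continuousOn_const.add hcont) fun t _ => by
        have := he0 t
        simp only [he] at this
        positivity
      exact (continuousOn_finsetSum _ fun ξ _ => (hSc ξ).norm.pow 2).sqrt
    have hyc : ContinuousOn (fun t => 1 + e t ^ 2) (Icc 0 T) :=
      continuousOn_const.add (hcont.pow 2)
    have hic : ContinuousOn (fun t => 4 * k t * (1 + e t ^ 2)) (Icc 0 T) :=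
      (continuousOn_const.mul hkc).mul hyc
    have hΦ : ContinuousOn (fun t => C * N⁻¹ + 4 * k t * (1 + e t ^ 2)) (Icc 0 T) :=
      continuousOn_const.add hic
    have hle : ∀ t ∈ Icc 0 T, 2 * ∑ ξ ∈ F, truncWeight 0 N ξ *
        ((starRingEnd ℂ) (a t ξ) * R t ξ).re ≤ C * N⁻¹ + 4 * k t * (1 + e t ^ 2) := by
      intro t ht
      have h1 := enorm_transport_energy_le (hp t ht) (hτ t ht) (truncWeight_eq_zero (s := 0) hN)
      have h2 : ‖2 * ∑ ξ ∈ F, truncWeight 0 N ξ * ((starRingEnd ℂ) (a t ξ) * τ t ξ).re‖ₑ ≤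
          ENNReal.ofReal |κ| * (embConst * A * D ^ 2) * ENNReal.ofReal N⁻¹ := by
        refine h1.trans ?_
        rw [mul_assoc]
        gcongr
        refine (tsum_commutator_zero_le hN (fun ξ => ‖p t ξ‖ₑ) (fun ξ => ‖a t ξ‖ₑ)).trans ?_
        rw [mul_comm]
        gcongr
        · exact hA t ht
        · exact hD t ht
      have h3 := le_toReal_of_enorm_le (ENNReal.mul_ne_top hCtop ENNReal.ofReal_ne_top) h2
      rw [ENNReal.toReal_mul, ENNReal.toReal_ofReal (by positivity), ← hC] at h3
      have h4 := sum_truncWeight_re_le hN (a t) (S t) F (hfin t ht)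
      have h5 : √(∑ ξ ∈ F, ‖S t ξ‖ ^ 2) = k t * (1 + e t) := by
        rw [hk, div_mul_cancel₀ _ (by linarith [he0 t])]
      rw [h5] at h4
      have h6 : 2 * ∑ ξ ∈ F, truncWeight 0 N ξ * ((starRingEnd ℂ) (a t ξ) * R t ξ).re =
          -(2 * ∑ ξ ∈ F, truncWeight 0 N ξ * ((starRingEnd ℂ) (a t ξ) * τ t ξ).re) +
          2 * ∑ ξ ∈ F, truncWeight 0 N ξ * ((starRingEnd ℂ) (a t ξ) * S t ξ).re := by
        rw [← mul_neg, ← Finset.sum_neg_distrib, ← mul_add, ← Finset.sum_add_distrib]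
        congr 1
        refine Finset.sum_congr rfl fun ξ _ => ?_
        rw [hRdef t ht, mul_add, mul_neg, Complex.add_re, Complex.neg_re]
        ring
      rw [h6]
      have h7 := neg_abs_le (2 * ∑ ξ ∈ F, truncWeight 0 N ξ *
        ((starRingEnd ℂ) (a t ξ) * τ t ξ).re)
      -- From `e (1 + e) ≤ 2 (1 + e²)`; with the factor 2 of the energy identity this produces the 4
      -- in the exponent.
      have h8 : e t * (k t * (1 + e t)) ≤ 2 * k t * (1 + e t ^ 2) := by
        have := mul_nonneg (hk0 t) (add_nonneg (sq_nonneg (e t - 1)) (zero_le_one (α := ℝ)))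
        nlinarith [hk0 t, mul_nonneg (hk0 t) (sq_nonneg (e t))]
      have h9 : (ellTwo fun ξ => ‖a t ξ‖ₑ).toReal = e t := rfl
      rw [h9] at h4
      linarith
    have hgr := gronwall_integral (a := 1 + e 0 ^ 2 + (C * T + D.toReal ^ 2) * N⁻¹)
      (k := fun t => 4 * k t) hyc (continuousOn_const.mul hkc)
      (fun t _ => mul_nonneg (by norm_num) (hk0 t)) (fun t ht => by
        have h1 := weighted_energy_le hR ha hΦ hle ht
        have hii : IntervalIntegrable (fun t => 4 * k t * (1 + e t ^ 2)) volume 0 t := by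
          refine ContinuousOn.intervalIntegrable ?_
          rw [uIcc_of_le ht.1]
          exact hic.mono (Icc_subset_Icc_right ht.2)
        rw [intervalIntegral.integral_add intervalIntegrable_const hii,
          intervalIntegral.integral_const, sub_zero, smul_eq_mul] at h1
        have h2 : ∑ ξ ∈ F, truncWeight 0 N ξ * ‖a 0 ξ‖ ^ 2 ≤ e 0 ^ 2 := by
          have h3 := sum_truncWeight_le 0 hN (a 0) F
          simp only [pow_zero, one_mul] at h3
          rw [ENNReal.ofReal_le_iff_le_toReal (ENNReal.pow_ne_top (hfin 0 h0)),
            ENNReal.toReal_pow] at h3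
          exact h3
        have h4 : e t ^ 2 ≤ ∑ ξ ∈ F, truncWeight 0 N ξ * ‖a t ξ‖ ^ 2 + N⁻¹ * D.toReal ^ 2 := by
          have hnn : 0 ≤ ∑ ξ ∈ F, truncWeight 0 N ξ * ‖a t ξ‖ ^ 2 :=
            Finset.sum_nonneg fun ξ _ => mul_nonneg (truncWeight_nonneg 0 N ξ) (sq_nonneg _)
          have h5 : (ellTwo fun ξ => ‖a t ξ‖ₑ) ^ 2 ≤
              ENNReal.ofReal (∑ ξ ∈ F, truncWeight 0 N ξ * ‖a t ξ‖ ^ 2) +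
                ENNReal.ofReal N⁻¹ * D ^ 2 :=
            (ellTwo_sq_le_trunc hN (a t)).trans (by gcongr; exact hD t ht)
          have hDN : ENNReal.ofReal N⁻¹ * D ^ 2 ≠ ⊤ :=
            ENNReal.mul_ne_top ENNReal.ofReal_ne_top (ENNReal.pow_ne_top hDtop)
          have h6 := ENNReal.toReal_mono (ENNReal.add_ne_top.2 ⟨ENNReal.ofReal_ne_top, hDN⟩) h5
          rwa [ENNReal.toReal_add ENNReal.ofReal_ne_top hDN, ENNReal.toReal_pow,
            ENNReal.toReal_ofReal hnn, ENNReal.toReal_mul, ENNReal.toReal_pow,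
            ENNReal.toReal_ofReal (by positivity)] at h6
        have h7 : t * (C * N⁻¹) ≤ T * (C * N⁻¹) := by
          have := ht.2
          gcongr
        linarith) ht
    refine hgr.trans ?_
    have hK' := hK F t ht
    have hconst : 0 ≤ 1 + e 0 ^ 2 + (C * T + D.toReal ^ 2) * N⁻¹ := by
      have := h0.2
      positivity
    rw [intervalIntegral.integral_const_mul]
    gcongr
  have hlim : Tendsto (fun N : ℝ => (1 + e 0 ^ 2 + (C * T + D.toReal ^ 2) * N⁻¹) *
      Real.exp (4 * K)) atTop (𝓝 ((1 + e 0 ^ 2 + (C * T + D.toReal ^ 2) * 0) *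
      Real.exp (4 * K))) :=
    (tendsto_const_nhds.add (tendsto_const_nhds.mul tendsto_inv_atTop_zero)).mul_const _
  rw [mul_zero, add_zero] at hlim
  exact ge_of_tendsto hlim ((eventually_gt_atTop 0).mono fun N hN => main N hN)

lemma exists_enorm_velocity_le (L : ℝ) [Fact (0 < L)] {α : ℝ} (hα : 0 < α) :
    ∃ C : ℝ≥0∞, C ≠ ⊤ ∧ ∀ (w : L2 L) (u : Fin 2 → L2 L), IsVelocity α w u →
      ∀ j, ‖u j‖ₑ ≤ C * ‖w‖ₑ := by
  obtain ⟨C, hC, hCle⟩ := exists_wt_mul_streamCoeff_le L hα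
  refine ⟨ENNReal.ofReal (2 * Real.pi / L) * C, ENNReal.mul_ne_top ENNReal.ofReal_ne_top hC,
    fun w u h j => ?_⟩
  rw [enorm_eq_mul_ellTwo, enorm_eq_mul_ellTwo w, mul_left_comm]
  gcongr
  rw [← ellTwo_const_mul]
  refine ellTwo_mono fun ξ => (h.enorm_fourierCoeff₂_le hα j ξ).trans ?_
  rw [mul_assoc]
  refine mul_le_mul_right (le_trans ?_ (hCle w ξ)) _
  gcongr
  exact le_self_pow₀ (one_le_wt ξ) (by norm_num)

/-- The source term of the vorticity equation is controlled in `L²` by the supremum of `∇b`. -/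
lemma exists_ellTwo_source_le {α : ℝ} (hα : 0 < α) (uh : Fin 2 → L2 L)
    (huh_div : IsWeakDiv (fun j => uh j) 0) (f : L2 L) :
    ∃ C : ℝ≥0∞, C ≠ ⊤ ∧ ∀ (b w : L2 L) (u : Fin 2 → L2 L), IsVelocity α (w - f) u →
      sobolevNorm 1 b < ⊤ →
      (ellTwo fun ξ => ‖divCoeff (fun j => (u j - uh j : L2 L)) b ξ‖ₑ) ≤
        C * (1 + ellTwo fun ξ => ‖fourierCoeff₂ w ξ‖ₑ) * gradSupNorm b := by
  obtain ⟨C, hC, hCle⟩ := exists_enorm_velocity_le L hα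
  have hL0 : (ENNReal.ofReal L)⁻¹ ≠ ⊤ := ENNReal.inv_ne_top.2 (by simpa using period_pos (L := L))
  -- The added 1 keeps `C'` nonzero, so that the right side is infinite when `gradSupNorm b = ⊤`.
  set C' : ℝ≥0∞ := (ENNReal.ofReal L)⁻¹ *
    (2 * C * (ENNReal.ofReal L + ‖f‖ₑ) + ‖uh 0‖ₑ + ‖uh 1‖ₑ) + 1 with hC'
  have hC'top : C' ≠ ⊤ := by
    refine ENNReal.add_ne_top.2 ⟨ENNReal.mul_ne_top hL0 ?_, ENNReal.one_ne_top⟩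
    refine ENNReal.add_ne_top.2 ⟨ENNReal.add_ne_top.2 ⟨ENNReal.mul_ne_top
      (ENNReal.mul_ne_top (by norm_num) hC) ?_, enorm_ne_top⟩, enorm_ne_top⟩
    exact ENNReal.add_ne_top.2 ⟨ENNReal.ofReal_ne_top, enorm_ne_top⟩
  refine ⟨C', hC'top, fun b w u hu hb => ?_⟩
  rcases eq_or_ne (gradSupNorm b) ⊤ with hg | hg
  · rw [hg, ENNReal.mul_top]
    · exact le_top
    · simp [hC']
  have hdiv : ∀ ξ : Fin 2 → ℤ, ∑ j, freq L (ξ j) * fourierCoeff₂ (u j - uh j : L2 L) ξ = 0 := by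
    intro ξ
    have h0 := huh_div.fourierCoeff₂_eq ξ
    have hz : fourierCoeff₂ (0 : Torus L → ℝ) ξ = 0 := by simp [fourierCoeff₂]
    rw [hz] at h0
    simp only [fourierCoeff₂_sub, mul_sub, Finset.sum_sub_distrib, hu.div_eq_zero hα, ← h0,
      sub_zero]
  have h1 := ellTwo_divCoeff_le (fun j => Lp.memLp (u j - uh j)) hdiv (Lp.memLp b) hb hg.lt_top
  refine h1.trans ?_
  rw [← mul_assoc]
  refine mul_le_mul_left ?_ _
  set e := ellTwo fun ξ => ‖fourierCoeff₂ w ξ‖ₑ with he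
  have hw : ‖w‖ₑ = ENNReal.ofReal L * e := enorm_eq_mul_ellTwo w
  have h2 : ∀ j, eLpNorm (u j - uh j : L2 L) 2 volume ≤
      C * (ENNReal.ofReal L + ‖f‖ₑ) * (1 + e) + ‖uh j‖ₑ := by
    intro j
    rw [← Lp.enorm_def]
    refine (enorm_sub_le).trans ?_
    gcongr
    refine (hCle _ u hu j).trans ?_
    rw [mul_assoc]
    gcongr
    refine enorm_sub_le.trans ?_
    rw [hw]
    calc ENNReal.ofReal L * e + ‖f‖ₑ ≤ ENNReal.ofReal L * e + ‖f‖ₑ +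
          (ENNReal.ofReal L + ‖f‖ₑ * e) := le_self_add
      _ = _ := by ring
  calc _ ≤ (ENNReal.ofReal L)⁻¹ * ((C * (ENNReal.ofReal L + ‖f‖ₑ) * (1 + e) + ‖uh 0‖ₑ) +
        (C * (ENNReal.ofReal L + ‖f‖ₑ) * (1 + e) + ‖uh 1‖ₑ)) := by
        gcongr
        · exact h2 0
        · exact h2 1
    _ ≤ (ENNReal.ofReal L)⁻¹ * ((C * (ENNReal.ofReal L + ‖f‖ₑ) * (1 + e) + ‖uh 0‖ₑ * (1 + e)) +
        (C * (ENNReal.ofReal L + ‖f‖ₑ) * (1 + e) + ‖uh 1‖ₑ * (1 + e))) := by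
        gcongr
        · exact le_mul_of_one_le_right zero_le le_self_add
        · exact le_mul_of_one_le_right zero_le le_self_add
    _ = (ENNReal.ofReal L)⁻¹ *
        (2 * C * (ENNReal.ofReal L + ‖f‖ₑ) + ‖uh 0‖ₑ + ‖uh 1‖ₑ) * (1 + e) := by ring
    _ ≤ C' * (1 + e) := by
        gcongr
        exact le_self_add

lemma le_ofReal_of_one_add_sq_le {x : ℝ≥0∞} (hx : x ≠ ⊤) {K : ℝ} (h : 1 + x.toReal ^ 2 ≤ K) :
    x ≤ ENNReal.ofReal K := by
  rw [ENNReal.le_ofReal_iff_toReal_le hx (by nlinarith [sq_nonneg x.toReal])]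
  nlinarith [sq_nonneg (x.toReal - 1)]

lemma sobolevNorm_sub_le (s : ℕ) (v w : L2 L) :
    sobolevNorm s (v - w : L2 L) ≤ sobolevNorm s v + sobolevNorm s w := by
  simp only [sobolevNorm_eq_ellTwo, fourierCoeff₂_sub]
  refine le_trans (ellTwo_mono fun ξ => ?_) (ellTwo_add_le _ _)
  rw [← mul_add]
  gcongr
  exact enorm_sub_le

lemma sobolevNorm_zero_eq_ellTwo (v : Torus L → ℝ) :
    sobolevNorm 0 v = ellTwo fun ξ => ‖fourierCoeff₂ v ξ‖ₑ := by
  simp only [sobolevNorm_eq_ellTwo, pow_zero, one_mul]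

lemma exists_ellTwo_streamCoeff_le (L : ℝ) [Fact (0 < L)] {α : ℝ} (hα : 0 < α) :
    ∃ C : ℝ≥0∞, C ≠ ⊤ ∧ ∀ w f : L2 L,
      (ellTwo fun ξ => wt ξ ^ 4 * ‖streamCoeff α (w - f : L2 L) ξ‖ₑ) ≤
        C * (sobolevNorm 0 w + sobolevNorm 0 f) := by
  obtain ⟨C, hC, hle⟩ := exists_wt_mul_streamCoeff_le L hα
  refine ⟨C, hC, fun w f => (ellTwo_mono fun ξ => hle _ ξ).trans ?_⟩
  rw [ellTwo_const_mul, ← sobolevNorm_zero_eq_ellTwo]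
  gcongr
  exact sobolevNorm_sub_le 0 w f

lemma ContinuousInSobolev.exists_bound {s : ℕ} {T : ℝ} {v : ℝ → L2 L}
    (h : ContinuousInSobolev s T v) :
    ∃ D : ℝ≥0∞, D ≠ ⊤ ∧ ∀ t ∈ Icc 0 T, sobolevNorm s (v t) ≤ D := by
  obtain ⟨C, hC⟩ := isCompact_Icc.exists_bound_of_continuousOn h.continuousOn_toReal
  refine ⟨ENNReal.ofReal C, ENNReal.ofReal_ne_top, fun t ht => ?_⟩
  rw [← ENNReal.ofReal_toReal (h t ht).1.ne]
  exact ENNReal.ofReal_le_ofReal ((le_abs_self _).trans (hC t ht))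

lemma continuousOn_toReal_ellTwo {v : ℝ → L2 L} {I : Set ℝ} (hv : ContinuousOn v I) :
    ContinuousOn (fun t => (ellTwo fun ξ => ‖fourierCoeff₂ (v t) ξ‖ₑ).toReal) I := by
  simp only [ellTwo_fourierCoeff₂_L2, ENNReal.toReal_mul, toReal_enorm]
  exact continuousOn_const.mul hv.norm

/-- In the application `g` is the gradient norm, with no measurability in time established. Only
steps valid for arbitrary functions are used: monotonicity and multiplication by a finite constant.
-/
lemma integral_le_of_enorm_le {T t : ℝ} (ht : t ∈ Icc 0 T) {k : ℝ → ℝ} {g : ℝ → ℝ≥0∞}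
    {C G : ℝ≥0∞} (hC : C ≠ ⊤) (hG : G ≠ ⊤) (hkg : ∀ τ ∈ Icc 0 T, ‖k τ‖ₑ ≤ C * g τ)
    (hg : ∫⁻ τ in Ioo 0 T, g τ ≤ G) : ∫ τ in (0 : ℝ)..t, k τ ≤ (C * G).toReal := by
  refine (le_abs_self _).trans (le_toReal_of_enorm_le (ENNReal.mul_ne_top hC hG) ?_)
  rw [intervalIntegral.integral_of_le ht.1]
  calc ‖∫ τ in Ioc 0 t, k τ‖ₑ ≤ ∫⁻ τ in Ioc 0 t, ‖k τ‖ₑ := enorm_integral_le_lintegral_enorm _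
    _ = ∫⁻ τ in Ioo 0 t, ‖k τ‖ₑ := (setLIntegral_congr Ioo_ae_eq_Ioc).symm
    _ ≤ ∫⁻ τ in Ioo 0 T, ‖k τ‖ₑ := lintegral_mono_set (Ioo_subset_Ioo_right ht.2)
    _ ≤ ∫⁻ τ in Ioo 0 T, C * g τ :=
        setLIntegral_mono' measurableSet_Ioo fun τ hτ => hkg τ (Ioo_subset_Icc_self hτ)
    _ = C * ∫⁻ τ in Ioo 0 T, g τ := lintegral_const_mul' _ _ hC
    _ ≤ C * G := by gcongr

/-! ### A priori bounds for solutions, uniform in the final time -/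

variable {α : ℝ} {uh : Fin 2 → L2 L} {f b₀ ω₀ : L2 L} {b ω : ℝ → L2 L}

/-- The vorticity is bounded in `L²` as long as `∇b` is integrable in time with values in
`L^∞`. -/
lemma exists_sobolevNorm_zero_vorticity_le (hα : 0 < α) (huh_div : IsWeakDiv (fun j => uh j) 0)
    {G : ℝ≥0∞} (hG : G ≠ ⊤) :
    ∃ K : ℝ≥0∞, K ≠ ⊤ ∧ ∀ T, IsLocalSolution α uh f b₀ ω₀ b ω T →
      ∫⁻ t in Ioo 0 T, gradSupNorm (b t) ≤ G → ∀ t ∈ Icc 0 T, sobolevNorm 0 (ω t) ≤ K := by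
  obtain ⟨C₁, hC₁, hstream⟩ := exists_ellTwo_streamCoeff_le L hα
  obtain ⟨C₂, hC₂, hsource⟩ := exists_ellTwo_source_le hα uh huh_div f
  refine ⟨ENNReal.ofReal ((1 + (ellTwo fun ξ => ‖fourierCoeff₂ (ω 0) ξ‖ₑ).toReal ^ 2) *
    Real.exp (4 * (C₂ * G).toReal)), ENNReal.ofReal_ne_top, fun T hT hint t ht => ?_⟩
  obtain ⟨u, hu, -, hω⟩ := hT.exists_velocity
  -- `D` depends on `T` and may be large as `T` grows. This is harmless, since `ellTwo_gronwall`
  -- needs only its finiteness.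
  obtain ⟨D, hD, hDle⟩ := hT.continuous_ω.exists_bound
  have hfin : ∀ v : L2 L, sobolevNorm 0 v ≠ ⊤ := fun v => by
    rw [sobolevNorm_zero_eq_ellTwo, ellTwo_fourierCoeff₂_L2]
    exact ENNReal.mul_ne_top (ENNReal.inv_ne_top.2 (by simpa using period_pos (L := L)))
      enorm_ne_top
  have hωc := hT.continuous_ω.continuousOn
  have hbc := hT.continuous_b.continuousOn
  have huc : ∀ j, ContinuousOn (fun t => u t j) (Icc 0 T) :=
    continuousOn_velocity hα (hωc.sub continuousOn_const) hu
  have hSc := fun ξ => continuousOn_divCoeff (g := fun t j => u t j - uh j)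
    (fun j => (huc j).sub continuousOn_const) hbc ξ
  rw [sobolevNorm_zero_eq_ellTwo]
  have hfin' : (ellTwo fun ξ => ‖fourierCoeff₂ (ω t) ξ‖ₑ) ≠ ⊤ := by
    rw [← sobolevNorm_zero_eq_ellTwo]
    exact hfin _
  refine le_ofReal_of_one_add_sq_le hfin' ?_
  refine ellTwo_gronwall (a := fun t => fourierCoeff₂ (ω t))
    (p := fun t => streamCoeff α (ω t - f : L2 L)) (D := D) (A := C₁ * (D + sobolevNorm 0 f))
    (fun t _ ξ => conj_streamCoeff α _ ξ)
    (fun t ht ξ => (hu t ht).hasSum_divCoeff hα (Lp.memLp (ω t)) ξ) (fun t _ ξ => rfl)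
    (fun ξ => (continuousOn_divCoeff huc hωc ξ).neg.add (hSc ξ)) hSc hω
    (ENNReal.mul_ne_top hC₁ (ENNReal.add_ne_top.2 ⟨hD, hfin f⟩)) hD (fun t ht => ?_)
    (fun t ht => ?_) (continuousOn_toReal_ellTwo hωc) (fun F t ht => ?_) ht
  · refine (hstream _ _).trans ?_
    gcongr
    exact (sobolevNorm_mono (Nat.zero_le 2) _).trans (hDle t ht)
  · rw [← sobolevNorm_eq_ellTwo]
    exact hDle t ht
  · refine integral_le_of_enorm_le ht hC₂ hG (fun τ hτ => ?_) hint
    set e := ellTwo fun ξ => ‖fourierCoeff₂ (ω τ) ξ‖ₑ with he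
    have hetop : e ≠ ⊤ := by
      rw [he, ← sobolevNorm_zero_eq_ellTwo]
      exact hfin _
    have he0 : 0 < 1 + e.toReal := by positivity
    rw [← ofReal_norm, Real.norm_of_nonneg (div_nonneg (Real.sqrt_nonneg _) he0.le),
      ENNReal.ofReal_div_of_pos he0, ENNReal.ofReal_add zero_le_one ENNReal.toReal_nonneg,
      ENNReal.ofReal_one, ENNReal.ofReal_toReal hetop]
    refine ENNReal.div_le_of_le_mul ((sqrt_sum_sq_le _ F).trans ?_)
    refine (hsource _ _ _ (hu τ hτ) ?_).trans_eq (by ring)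
    exact (sobolevNorm_mono (by norm_num) _).trans_lt (hT.continuous_b τ hτ).1

/-- The `L²` bound on `ω` bounds the stream function with four weights, so `sobolev_gronwall`
applies with `k = 1` and no source. The horizon `S` makes the constant independent of `T`. -/
lemma exists_sobolevNorm_buoyancy_le (hα : 0 < α) {S : ℝ} {K : ℝ≥0∞} (hK : K ≠ ⊤)
    (hf : sobolevNorm 2 f < ⊤) :
    ∃ M : ℝ≥0∞, M ≠ ⊤ ∧ ∀ T ≤ S, IsLocalSolution α uh f b₀ ω₀ b ω T →
      (∀ t ∈ Icc 0 T, sobolevNorm 0 (ω t) ≤ K) → ∀ t ∈ Icc 0 T, sobolevNorm 3 (b t) ≤ M := by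
  obtain ⟨C₁, hC₁, hstream⟩ := exists_ellTwo_streamCoeff_le L hα
  set A : ℝ≥0∞ := C₁ * (K + sobolevNorm 2 f) with hAdef
  have hA : A ≠ ⊤ := ENNReal.mul_ne_top hC₁ (ENNReal.add_ne_top.2 ⟨hK, hf.ne⟩)
  -- The vanishing second summand is the source bound `B = 0`, kept to match the rate in
  -- `sobolev_gronwall`.
  set c : ℝ := (ENNReal.ofReal |(-(2 * Real.pi / L) ^ 2)| * (42 * embConst * A)).toReal +
    2 * (0 : ℝ≥0∞).toReal with hc
  have hc0 : 0 ≤ c := by positivity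
  refine ⟨ENNReal.ofReal ((1 + (sobolevNorm 3 (b 0)).toReal ^ 2) * Real.exp (S * c)),
    ENNReal.ofReal_ne_top, fun T hTS hT hω t ht => ?_⟩
  obtain ⟨u, hu, hb, -⟩ := hT.exists_velocity
  have hωc := hT.continuous_ω.continuousOn
  have hbc := hT.continuous_b.continuousOn
  have huc : ∀ j, ContinuousOn (fun t => u t j) (Icc 0 T) :=
    continuousOn_velocity hα (hωc.sub continuousOn_const) hu
  refine le_ofReal_of_one_add_sq_le (hT.continuous_b t ht).1.ne (le_trans ?_
    (mul_le_mul_of_nonneg_left (Real.exp_le_exp.2 (mul_le_mul_of_nonneg_right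
      (ht.2.trans hTS) hc0)) (by positivity)))
  have hcont := hT.continuous_b.continuousOn_toReal
  have hfin := fun t ht => (hT.continuous_b t ht).1.ne
  simp only [sobolevNorm_eq_ellTwo] at hcont hfin ⊢
  refine sobolev_gronwall (k := 1) le_rfl (a := fun t => fourierCoeff₂ (b t))
    (p := fun t => streamCoeff α (ω t - f : L2 L)) (S := fun _ _ => 0)
    (fun t _ ξ => conj_streamCoeff α _ ξ)
    (fun t ht ξ => (hu t ht).hasSum_divCoeff hα (Lp.memLp (b t)) ξ)
    (fun t _ ξ => (add_zero _).symm) (fun ξ => (continuousOn_divCoeff huc hbc ξ).neg) hb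
    hA ENNReal.zero_ne_top (fun t ht => ?_) (fun t _ => by simp) hfin hcont ht
  refine (hstream _ _).trans ?_
  rw [hAdef]
  gcongr
  · exact hω t ht
  · exact sobolevNorm_mono (Nat.zero_le 2) _

lemma enorm_divCoeff_le {g : Fin 2 → Torus L → ℝ} {v : Torus L → ℝ} (hg : ∀ j, MemLp (g j) 2)
    (hv : MemLp v 2) (ξ : Fin 2 → ℤ) :
    ‖divCoeff g v ξ‖ₑ ≤ ENNReal.ofReal (2 * Real.pi / L) * wt ξ *
      ∑' η, (‖fourierCoeff₂ (g 0) (ξ - η)‖ₑ + ‖fourierCoeff₂ (g 1) (ξ - η)‖ₑ) *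
        ‖fourierCoeff₂ v η‖ₑ := by
  have h1 : ∀ j, ‖freq L (ξ j) * fourierCoeff₂ (fun x => g j x * v x) ξ‖ₑ ≤
      ENNReal.ofReal (2 * Real.pi / L) * wt ξ *
        ∑' η, ‖fourierCoeff₂ (g j) (ξ - η)‖ₑ * ‖fourierCoeff₂ v η‖ₑ := by
    intro j
    rw [enorm_mul]
    gcongr
    · exact enorm_freq_le ξ j
    · rw [← (hasSum_fourierCoeff₂_mul (hg j) hv ξ).tsum_eq]
      refine enorm_tsum_le_tsum_enorm.trans_eq ?_
      simp only [enorm_mul]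
  rw [divCoeff, Fin.sum_univ_two]
  simp only [add_mul, ENNReal.tsum_add, mul_add]
  exact (enorm_add_le _ _).trans (add_le_add (h1 0) (h1 1))

/-- The pairing carries four weights and the divergence adds a fifth. Two go to `V` and three to the
product of `g` and `v`, which is why third-order norms of both appear. -/
lemma tsum_source_pairing_le {g : Fin 2 → L2 L} {v : L2 L} (V : (Fin 2 → ℤ) → ℝ≥0∞) :
    ∑' ξ, wt ξ ^ (2 * (0 + 2)) * (V ξ * ‖divCoeff (fun j => g j) v ξ‖ₑ) ≤
      ENNReal.ofReal (2 * Real.pi / L) * (8 * embConst *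
        (sobolevNorm 3 (g 0) + sobolevNorm 3 (g 1)) * sobolevNorm 3 v) *
        ellTwo fun ξ => wt ξ ^ (0 + 2) * V ξ := by
  set Q : (Fin 2 → ℤ) → ℝ≥0∞ := fun ξ => ‖fourierCoeff₂ (g 0) ξ‖ₑ + ‖fourierCoeff₂ (g 1) ξ‖ₑ
    with hQ
  have hQle : (ellTwo fun ξ => wt ξ ^ 3 * Q ξ) ≤ sobolevNorm 3 (g 0) + sobolevNorm 3 (g 1) := by
    simp only [sobolevNorm_eq_ellTwo, hQ, mul_add]
    exact ellTwo_add_le _ _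
  calc ∑' ξ, wt ξ ^ (2 * (0 + 2)) * (V ξ * ‖divCoeff (fun j => g j) v ξ‖ₑ)
      ≤ ∑' ξ, ENNReal.ofReal (2 * Real.pi / L) *
          ∑' η, wt ξ ^ 2 * V ξ * (wt ξ ^ 3 * (Q (ξ - η) * ‖fourierCoeff₂ v η‖ₑ)) := by
        refine ENNReal.tsum_le_tsum fun ξ => ?_
        simp only [ENNReal.tsum_mul_left]
        calc _ ≤ wt ξ ^ (2 * (0 + 2)) * (V ξ * (ENNReal.ofReal (2 * Real.pi / L) * wt ξ *
              ∑' η, Q (ξ - η) * ‖fourierCoeff₂ v η‖ₑ)) := by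
              gcongr
              exact enorm_divCoeff_le (fun j => Lp.memLp (g j)) (Lp.memLp v) ξ
          _ = _ := by ring
    _ ≤ ENNReal.ofReal (2 * Real.pi / L) * (8 * embConst * (ellTwo fun ξ => wt ξ ^ 2 * V ξ) *
          (sobolevNorm 3 (g 0) + sobolevNorm 3 (g 1)) * sobolevNorm 3 v) := by
        rw [ENNReal.tsum_mul_left]
        gcongr
        refine (tsum_source_le Q (fun ξ => ‖fourierCoeff₂ v ξ‖ₑ) V).trans ?_
        rw [← sobolevNorm_eq_ellTwo 3 v]
        gcongr
    _ = _ := by ring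

lemma IsVelocity.sobolevNorm_le (hα : 0 < α) {w : L2 L} {u : Fin 2 → L2 L}
    (h : IsVelocity α w u) (j : Fin 2) :
    sobolevNorm 3 (u j) ≤ ENNReal.ofReal (2 * Real.pi / L) *
      ellTwo fun ξ => wt ξ ^ 4 * ‖streamCoeff α w ξ‖ₑ := by
  rw [sobolevNorm_eq_ellTwo, ← ellTwo_const_mul]
  refine ellTwo_mono fun ξ => (mul_le_mul_right (h.enorm_fourierCoeff₂_le hα j ξ) _).trans_eq ?_
  ring

/-- With `u`, `u_h` and `b` all bounded in `W^{3,2}`, the source `div (b (u - u_h))` is bounded at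
order two, and `sobolev_gronwall` applies with `k = 0`. -/
lemma exists_sobolevNorm_vorticity_le (hα : 0 < α) (huh : ∀ j, sobolevNorm 3 (uh j) < ⊤)
    {S : ℝ} {K M : ℝ≥0∞} (hK : K ≠ ⊤) (hM : M ≠ ⊤) (hf : sobolevNorm 2 f < ⊤) :
    ∃ M' : ℝ≥0∞, M' ≠ ⊤ ∧ ∀ T ≤ S, IsLocalSolution α uh f b₀ ω₀ b ω T →
      (∀ t ∈ Icc 0 T, sobolevNorm 0 (ω t) ≤ K) → (∀ t ∈ Icc 0 T, sobolevNorm 3 (b t) ≤ M) →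
      ∀ t ∈ Icc 0 T, sobolevNorm 2 (ω t) ≤ M' := by
  obtain ⟨C₁, hC₁, hstream⟩ := exists_ellTwo_streamCoeff_le L hα
  set A : ℝ≥0∞ := C₁ * (K + sobolevNorm 2 f) with hAdef
  have hA : A ≠ ⊤ := ENNReal.mul_ne_top hC₁ (ENNReal.add_ne_top.2 ⟨hK, hf.ne⟩)
  set B : ℝ≥0∞ := ENNReal.ofReal (2 * Real.pi / L) * (8 * embConst *
    ((ENNReal.ofReal (2 * Real.pi / L) * A + sobolevNorm 3 (uh 0)) +
      (ENNReal.ofReal (2 * Real.pi / L) * A + sobolevNorm 3 (uh 1))) * M) with hBdef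
  have hg : ∀ j, ENNReal.ofReal (2 * Real.pi / L) * A + sobolevNorm 3 (uh j) ≠ ⊤ := fun j =>
    ENNReal.add_ne_top.2 ⟨ENNReal.mul_ne_top ENNReal.ofReal_ne_top hA, (huh j).ne⟩
  have hB : B ≠ ⊤ := ENNReal.mul_ne_top ENNReal.ofReal_ne_top (ENNReal.mul_ne_top
    (ENNReal.mul_ne_top (ENNReal.mul_ne_top (by norm_num) embConst_ne_top)
      (ENNReal.add_ne_top.2 ⟨hg 0, hg 1⟩)) hM)
  set c : ℝ := (ENNReal.ofReal |(-(2 * Real.pi / L) ^ 2)| * (42 * embConst * A)).toReal +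
    2 * B.toReal with hc
  have hc0 : 0 ≤ c := by positivity
  refine ⟨ENNReal.ofReal ((1 + (sobolevNorm 2 (ω 0)).toReal ^ 2) * Real.exp (S * c)),
    ENNReal.ofReal_ne_top, fun T hTS hT hωK hbM t ht => ?_⟩
  obtain ⟨u, hu, -, hω⟩ := hT.exists_velocity
  have hωc := hT.continuous_ω.continuousOn
  have hbc := hT.continuous_b.continuousOn
  have huc : ∀ j, ContinuousOn (fun t => u t j) (Icc 0 T) :=
    continuousOn_velocity hα (hωc.sub continuousOn_const) hu
  have hSc := fun ξ => continuousOn_divCoeff (g := fun t j => u t j - uh j)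
    (fun j => (huc j).sub continuousOn_const) hbc ξ
  have hstream' : ∀ t ∈ Icc 0 T,
      (ellTwo fun ξ => wt ξ ^ 4 * ‖streamCoeff α (ω t - f : L2 L) ξ‖ₑ) ≤ A := by
    intro t ht
    refine (hstream _ _).trans ?_
    rw [hAdef]
    gcongr
    · exact hωK t ht
    · exact sobolevNorm_mono (Nat.zero_le 2) _
  have hvel : ∀ t ∈ Icc 0 T, ∀ j, sobolevNorm 3 (u t j - uh j : L2 L) ≤
      ENNReal.ofReal (2 * Real.pi / L) * A + sobolevNorm 3 (uh j) := by
    intro t ht j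
    refine (sobolevNorm_sub_le 3 _ _).trans ?_
    gcongr
    refine ((hu t ht).sobolevNorm_le hα j).trans ?_
    gcongr
    exact hstream' t ht
  refine le_ofReal_of_one_add_sq_le (hT.continuous_ω t ht).1.ne (le_trans ?_
    (mul_le_mul_of_nonneg_left (Real.exp_le_exp.2 (mul_le_mul_of_nonneg_right
      (ht.2.trans hTS) hc0)) (by positivity)))
  have hcont := hT.continuous_ω.continuousOn_toReal
  have hfin := fun t ht => (hT.continuous_ω t ht).1.ne
  simp only [sobolevNorm_eq_ellTwo 2] at hcont hfin ⊢
  refine sobolev_gronwall (k := 0) zero_le_one (a := fun t => fourierCoeff₂ (ω t))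
    (p := fun t => streamCoeff α (ω t - f : L2 L))
    (fun t _ ξ => conj_streamCoeff α _ ξ)
    (fun t ht ξ => (hu t ht).hasSum_divCoeff hα (Lp.memLp (ω t)) ξ)
    (fun t _ ξ => rfl) (fun ξ => (continuousOn_divCoeff huc hωc ξ).neg.add (hSc ξ)) hω
    hA hB hstream' (fun t ht => ?_) hfin hcont ht
  refine (tsum_source_pairing_le (g := fun j => u t j - uh j) (v := b t) _).trans ?_
  rw [hBdef]
  gcongr
  · exact hvel t ht 0
  · exact hvel t ht 1
  · exact hbM t ht

end TQG

end

/-! ### The blow-up criterion -/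

theorem mainTheorem7 (L : ℝ) [Fact (0 < L)] (α : ℝ) (hα : 0 < α)
    (uh : Fin 2 → TQG.L2 L) (huh : ∀ j, TQG.sobolevNorm 3 (uh j) < ⊤)
    (huh_div : TQG.IsWeakDiv (fun j => uh j) 0)
    (f b₀ ω₀ : TQG.L2 L) (hf : TQG.sobolevNorm 2 f < ⊤)
    (hb₀ : TQG.sobolevNorm 3 b₀ < ⊤) (hω₀ : TQG.sobolevNorm 2 ω₀ < ⊤)
    (b ω : ℝ → TQG.L2 L) (Tmax : EReal)
    (hmax : TQG.IsMaximalSolution α uh f b₀ ω₀ b ω Tmax) (hTmax : Tmax < ⊤) :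
    ∫⁻ t in Set.Ioo 0 Tmax.toReal, TQG.gradSupNorm (b t) = ⊤ := by
  by_contra hG
  obtain ⟨hpos, T, hmono, hlim, hsol, hlimsup⟩ := hmax
  have hbot : Tmax ≠ ⊥ := (bot_le.trans_lt hpos).ne'
  have hTle : ∀ n, T n ≤ Tmax.toReal := fun n => by
    rw [← EReal.coe_le_coe_iff, EReal.coe_toReal hTmax.ne hbot]
    exact Monotone.ge_of_tendsto (fun m n h => EReal.coe_le_coe_iff.2 (hmono h)) hlim n
  -- The integral assumed finite itself serves as `G`, and `Tmax` as the horizon `S`. The constants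
  -- are thus fixed before any `T n` is chosen.
  obtain ⟨K, hK, hKle⟩ := TQG.exists_sobolevNorm_zero_vorticity_le (uh := uh) (f := f) (b₀ := b₀)
    (ω₀ := ω₀) (b := b) (ω := ω) hα huh_div hG
  obtain ⟨M, hM, hMle⟩ := TQG.exists_sobolevNorm_buoyancy_le (uh := uh) (b₀ := b₀)
    (ω₀ := ω₀) (b := b) (ω := ω) (S := Tmax.toReal) hα hK hf
  obtain ⟨M', hM', hMle'⟩ := TQG.exists_sobolevNorm_vorticity_le (b₀ := b₀)
    (ω₀ := ω₀) (b := b) (ω := ω) (S := Tmax.toReal) hα huh hK hM hf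
  have hbound : ∀ n, (TQG.sobolevNorm 3 (b (T n)) + TQG.sobolevNorm 2 (ω (T n))) ^ 2 ≤
      (M + M') ^ 2 := by
    intro n
    have hn : T n ∈ Icc 0 (T n) := ⟨(hsol n).time_pos.le, le_rfl⟩
    have h0 := hKle (T n) (hsol n) (lintegral_mono_set (Ioo_subset_Ioo_right (hTle n)))
    have h1 := hMle (T n) (hTle n) (hsol n) h0
    have h2 := hMle' (T n) (hTle n) (hsol n) h0 h1
    gcongr
    · exact h1 _ hn
    · exact h2 _ hn
  have htop := (limsup_le_of_le (f := atTop) (h := Eventually.of_forall hbound))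
  rw [hlimsup hTmax, top_le_iff] at htop
  exact ENNReal.pow_ne_top (ENNReal.add_ne_top.2 ⟨hM, hM'⟩) htop
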